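/- Let $d\ge 2$, $p\in(d,\infty]$ and $\frac1p+\frac1{p'}=1$. Let $\mathbb K$ be the family of all open bounded convex sets $K\subset\mathbb R^d$ that are symmetric with respect to the origin $\theta$ and contain it. For $K\in\mathbb K$ put $|x|_K=\inf\{\lambda>0: x\in\lambda K\}$, let $K^\circ=\{y:\sup_{x\in K}(x,y)\le 1\}$ be the polar set, and let $|\cdot|_{K^\circ}$ be the norm generated by $K^\circ$. We call $K\in\mathbb K$ a polytope if it is the interior of the convex hull of a finite set of points. Let $C\subset\mathbb R^d$ be an open convex cone generated by finitely many points, i.e. a non-empty set of the form $\operatorname{int}\{\sum_{k=1}^n c_kx_k : c_k\ge 0\}$. For $0\le a<b<\infty$ and $q\in[1,\infty]$, let $\mathcal L_q(a,b)$ be the space of measurable functions $w:(a,b)\to[0,\infty)$ with finite norm $\|w\|_{\mathcal L_q(a,b)}=\left(\int_a^b t^{d-1}w(t)^q\,dt\right)^{1/q}$ for $q<\infty$, and $\operatorname{ess\,sup}_{t\in(a,b)}t^{d-1}w(t)$ for $q=\infty$. For $h>0$, let $\mathcal W_q(0,h)$ be the space of all non-negative functions $w:(0,h]\to\mathbb R$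 such that $w\in\mathcal L_1(u,h)$ for all $u\in(0,h)$ and the function $$g_{w,h}(u)=\frac1{u^{d-1}}\int_u^h w(t)t^{d-1}\,dt$$ belongs to $\mathcal L_q(0,h)$. Let $\mathcal W^*_q(0,h)$ be the space of all non-negative functions $w:(0,h]\to\mathbb R$ such that $w\in\mathcal L_q(u,h)$ for all $u\in(0,h)$, the function $w_\nu(u)=\sup_{t\in[\nu u,u]}|w(t)-w(u)|$ is finite on $(0,h]$ and belongs to $\mathcal W_q(0,h)$ for all $\nu<1$ close enough to $1$, and $\lim_{\nu\to1-0}\|g_{w_\nu,h}\|_{\mathcal L_q(0,h)}=0$. Let $h>0$ and $K\in\mathbb K$. Each $f$ in the Sobolev space $W^{1,p}(hK\cap C)$ has a representative that is continuous on the closure of $hK\cap C$; $f$ is identified with it, which defines $f(\theta)$. **Theorem.** (i) Let $K\in\mathbb K$ be a polytope and $w\in\mathcal W_{p'}(0,h)$. For each $f\in W^{1,p}(hK\cap C)$ the integral below converges absolutely and $$\left|\int_{hK\cap C}w(|y|_K)\,[f(y)-f(\theta)]\,dy\right|\le\left(d\cdot\operatorname{meas}(K\cap C)\right)^{1/p'}\|g_{w,h}\|_{\mathcal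 L_{p'}(0,h)}\,\big\|\,|\nabla f|_{K^\circ}\big\|_{L_p(hK\cap C)}.\qquad(*)$$ The inequality is sharp: the constant in front of $\big\|\,|\nabla f|_{K^\circ}\big\|_{L_p(hK\cap C)}$ cannot be replaced by a smaller one. Moreover, for all $a,b\in\mathbb R$ the function $a\cdot f_e+b$, where $$f_e(y)=\int_0^{|y|_K}g_{w,h}(u)^{p'-1}\,du$$ (with $0^0=1$), belongs to $W^{1,p}(hK\cap C)$ and turns $(*)$ into an equality. (ii) If $w\in\mathcal W^*_{p'}(0,h)$, then for arbitrary $K\in\mathbb K$ inequality $(*)$ holds for each $f\in W^{1,p}(hK\cap C)$, with an absolutely convergent integral, and its constant cannot be replaced by a smaller one. -/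

import Mathlib

open Set Filter Topology MeasureTheory
open scoped ENNReal Pointwise ContDiff

noncomputable section

namespace Ostrowski

/-- The family of open bounded convex subsets of `ℝ^d` that are symmetric with respect to the
origin and contain it. The norm `|x|_K` generated by such a set is Mathlib's
`gauge K x = inf {r > 0 | x ∈ r • K}`. -/
structure IsSymmBody {d : ℕ} (K : Set (EuclideanSpace ℝ (Fin d))) : Prop where
  isOpen : IsOpen K
  convex : Convex ℝ K
  isBounded : Bornology.IsBounded K
  symm : ∀ x ∈ K, -x ∈ K
  zero_mem : (0 : EuclideanSpace ℝ (Fin d)) ∈ K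

/-- An open polytope: the interior of the convex hull of a finite set of points. -/
def IsOpenPolytope {d : ℕ} (K : Set (EuclideanSpace ℝ (Fin d))) : Prop :=
  ∃ S : Set (EuclideanSpace ℝ (Fin d)), S.Finite ∧ K = interior (convexHull ℝ S)

/-- The non-empty open convex cones generated by finitely many points. -/
def IsOpenFGCone {d : ℕ} (C : Set (EuclideanSpace ℝ (Fin d))) : Prop :=
  C.Nonempty ∧ ∃ (n : ℕ) (x : Fin n → EuclideanSpace ℝ (Fin d)),
    C = interior {y | ∃ c : Fin n → ℝ, (∀ k, 0 ≤ c k) ∧ y = ∑ k, c k • x k}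

/-- The polar set `K° = {y | sup_{x ∈ K} (x, y) ≤ 1}`. -/
def polarBody {d : ℕ} (K : Set (EuclideanSpace ℝ (Fin d))) : Set (EuclideanSpace ℝ (Fin d)) :=
  {y | ∀ x ∈ K, inner ℝ x y ≤ 1}

/-- `G` is the gradient of `f` in `Q` in the sense of distributions, where both `f` and `G` are
locally integrable in `Q`. -/
structure IsWeakGradient {d : ℕ} (Q : Set (EuclideanSpace ℝ (Fin d)))
    (f : EuclideanSpace ℝ (Fin d) → ℝ)
    (G : EuclideanSpace ℝ (Fin d) → EuclideanSpace ℝ (Fin d)) : Prop where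
  locallyIntegrableOn : LocallyIntegrableOn f Q
  locallyIntegrableOn_grad : LocallyIntegrableOn G Q
  integral_eq : ∀ φ : EuclideanSpace ℝ (Fin d) → ℝ, ContDiff ℝ ∞ φ → HasCompactSupport φ →
    tsupport φ ⊆ Q → ∀ i : Fin d,
      ∫ x in Q, f x * fderiv ℝ φ x (EuclideanSpace.single i 1) = - ∫ x in Q, G x i * φ x

/-- The Sobolev space `W^{1,p}(Q)`. -/
def MemW1p {d : ℕ} (p : ℝ≥0∞) (Q : Set (EuclideanSpace ℝ (Fin d)))
    (f : EuclideanSpace ℝ (Fin d) → ℝ) : Prop :=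
  MemLp f p (volume.restrict Q) ∧
    ∃ G : EuclideanSpace ℝ (Fin d) → EuclideanSpace ℝ (Fin d),
      IsWeakGradient Q f G ∧ MemLp G p (volume.restrict Q)

/-- `F` is a representative of the class of `f` (modulo equality almost everywhere in `Q`) that is
continuous up to the boundary of `Q`. For open `Q`, it is unique on the closure of `Q`. -/
def IsContRep {d : ℕ} (Q : Set (EuclideanSpace ℝ (Fin d)))
    (f F : EuclideanSpace ℝ (Fin d) → ℝ) : Prop :=
  ContinuousOn F (closure Q) ∧ F =ᵐ[volume.restrict Q] f

/-- `‖ |G|_{K°} ‖_{L_p(Q)}`. -/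
def polarLpNorm {d : ℕ} (p : ℝ≥0∞) (K Q : Set (EuclideanSpace ℝ (Fin d)))
    (G : EuclideanSpace ℝ (Fin d) → EuclideanSpace ℝ (Fin d)) : ℝ :=
  (eLpNorm (fun y => gauge (polarBody K) (G y)) p (volume.restrict Q)).toReal

/-- The weighted norm of a non-negative function on `(a, b)`: `(∫_a^b t^{d-1} w(t)^p dt)^{1/p}` for
`p < ∞`, and the essential supremum of `t^{d-1} w(t)` for `p = ∞`. -/
def radialNorm (d : ℕ) (p : ℝ≥0∞) (a b : ℝ) (w : ℝ → ℝ) : ℝ≥0∞ :=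
  if p = ⊤ then
    essSup (fun t => ENNReal.ofReal (t ^ (d - 1) * w t)) (volume.restrict (Ioo a b))
  else
    (∫⁻ t in Ioo a b, ENNReal.ofReal (t ^ (d - 1) * w t ^ p.toReal)) ^ (1 / p.toReal)

/-- The class `𝓛_p(a, b)`. -/
def MemRadialL (d : ℕ) (p : ℝ≥0∞) (a b : ℝ) (w : ℝ → ℝ) : Prop :=
  (∀ t ∈ Ioo a b, 0 ≤ w t) ∧ AEMeasurable w (volume.restrict (Ioo a b)) ∧
    radialNorm d p a b w < ⊤

/-- `g_{w,h}(u) = u^{-(d-1)} ∫_u^h w(t) t^{d-1} dt`. -/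
def gFun (d : ℕ) (w : ℝ → ℝ) (h u : ℝ) : ℝ :=
  1 / u ^ (d - 1) * ∫ t in u..h, w t * t ^ (d - 1)

/-- The class `𝓦_p(0, h)`. -/
def MemW (d : ℕ) (p : ℝ≥0∞) (h : ℝ) (w : ℝ → ℝ) : Prop :=
  (∀ t ∈ Ioc 0 h, 0 ≤ w t) ∧ (∀ u ∈ Ioo 0 h, MemRadialL d 1 u h w) ∧
    MemRadialL d p 0 h (gFun d w h)

/-- `w_ν(u) = sup_{t ∈ [νu, u]} |w(t) - w(u)|`. -/
def wNu (w : ℝ → ℝ) (ν u : ℝ) : ℝ :=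
  sSup ((fun t => |w t - w u|) '' Icc (ν * u) u)

/-- The class `𝓦*_p(0, h)`. The boundedness clause says that the suprema in `wNu` are finite. -/
def MemWStar (d : ℕ) (p : ℝ≥0∞) (h : ℝ) (w : ℝ → ℝ) : Prop :=
  (∀ t ∈ Ioc 0 h, 0 ≤ w t) ∧ (∀ u ∈ Ioo 0 h, MemRadialL d p u h w) ∧
    (∀ᶠ ν in 𝓝[<] (1 : ℝ),
      (∀ u ∈ Ioc 0 h, BddAbove ((fun t => |w t - w u|) '' Icc (ν * u) u)) ∧
        MemW d p h (wNu w ν)) ∧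
    Tendsto (fun ν => radialNorm d p 0 h (gFun d (wNu w ν) h)) (𝓝[<] (1 : ℝ)) (𝓝 0)

/-- The constant `(d · meas (K ∩ C))^{1/q} ‖g_{w,h}‖_{𝓛_q(0,h)}`. -/
def ostrowskiConst {d : ℕ} (q : ℝ≥0∞) (K C : Set (EuclideanSpace ℝ (Fin d))) (h : ℝ)
    (w : ℝ → ℝ) : ℝ :=
  (d * (volume (K ∩ C)).toReal) ^ (1 / q.toReal) * (radialNorm d q 0 h (gFun d w h)).toReal

/-- `f_e(y) = ∫_0^{|y|_K} g_{w,h}(u)^{q-1} du`. -/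
def extremalFun {d : ℕ} (q : ℝ≥0∞) (K : Set (EuclideanSpace ℝ (Fin d))) (h : ℝ) (w : ℝ → ℝ)
    (y : EuclideanSpace ℝ (Fin d)) : ℝ :=
  ∫ u in (0 : ℝ)..(gauge K y), gFun d w h u ^ (q.toReal - 1)

/-- The inequality
`|∫_{hK ∩ C} w(|y|_K) (f(y) - f(0)) dy| ≤ M ‖ |∇f|_{K°} ‖_{L_p(hK ∩ C)}`
holds for all `f ∈ W^{1,p}(hK ∩ C)`, the integral on the left being absolutely convergent. Here `F`
is the continuous representative of `f`, which gives a meaning to `f(0)`, and `G = ∇f`. -/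
def OstrowskiIneq {d : ℕ} (p : ℝ≥0∞) (K C : Set (EuclideanSpace ℝ (Fin d))) (h : ℝ)
    (w : ℝ → ℝ) (M : ℝ) : Prop :=
  ∀ (f F : EuclideanSpace ℝ (Fin d) → ℝ)
    (G : EuclideanSpace ℝ (Fin d) → EuclideanSpace ℝ (Fin d)),
    MemW1p p (h • K ∩ C) f → IsContRep (h • K ∩ C) f F → IsWeakGradient (h • K ∩ C) f G →
      IntegrableOn (fun y => w (gauge K y) * (F y - F 0)) (h • K ∩ C) ∧
      |∫ y in h • K ∩ C, w (gauge K y) * (F y - F 0)| ≤ M * polarLpNorm p K (h • K ∩ C) G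

end Ostrowski

end

open Ostrowski

open Ostrowski

noncomputable section

/-! Write r = |y|_K, q = p' and g = g_{w,h}. For a C¹ function u, integrating along the segment from
the origin gives |u(y) - u(θ)| ≤ |y|_K ∫_0^1 |∇u(ty)|_{K°} dt. Multiply by w(|y|_K), integrate over
the sector and substitute z = ty. Since hK ∩ C is star-shaped about the origin and homothetic to its
own dilates, the total weight falling on |∇u(z)|_{K°} is ∫_{r/h}^1 t^{-d} w(r/t)(r/t) dt with r =
|z|_K, and s = r/t turns this into g(r). Hence ∫ w(|y|_K)|u(y) - u(θ)| dy ≤ ∫ |∇u|_{K°} g(|y|_K) dy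
(`lintegral_mul_enorm_sub_le_of_contDiff`). Hölder's inequality then yields (*), because the image
of Lebesgue measure on the sector under |·|_K has density d·meas(K ∩ C) r^{d-1}
(`map_gauge_sector`), so that the constant is the L_q norm of g(|y|_K).

The passage to Sobolev functions needs C¹ approximations that converge uniformly up to the boundary.
They are obtained by averaging f((1-t)y + tz) over z in a small ball inside the sector: convexity
keeps every point inside, so no extension of f is needed. Morrey's estimate
(`lintegral_enorm_sub_le`, where p > d enters) upgrades L_p convergence to uniform convergence.
Weights singular at the origin are reached by truncation and Fatou's lemma, and p = ∞ by
approximating in some L_s with d < s < ∞.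

Sharpness comes from radial functions f(y) = ∫_0^{|y|_K} φ. The gauge is Lipschitz, hence
differentiable almost everywhere, and its gradient has polar norm 1 there
(`gauge_polarBody_gradient`), so |∇f|_{K°} = φ(|y|_K) and the first inequality becomes an identity
by Tonelli. The choice φ = g^{q-1} gives equality in Hölder's inequality.

For part (ii) it suffices that 𝓦*_q ⊆ 𝓦_q (`MemWStar.memW`). Comparing w(νt) with w(t) bounds g(νu)
by νg(u) plus terms of finite norm, and ν < 1 makes this a contraction that can be iterated towards
the origin. -/

namespace Ostrowski

/-! ### Gauges, polar bodies and convex cones -/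

section

variable {d : ℕ} {K C : Set (EuclideanSpace ℝ (Fin d))}

namespace IsSymmBody

theorem mem_nhds (hK : IsSymmBody K) : K ∈ 𝓝 0 := hK.isOpen.mem_nhds hK.zero_mem

theorem absorbent (hK : IsSymmBody K) : Absorbent ℝ K := absorbent_nhds_zero hK.mem_nhds

theorem continuous_gauge (hK : IsSymmBody K) : Continuous (gauge K) :=
  _root_.continuous_gauge hK.convex hK.mem_nhds

theorem gauge_lt_one_iff (hK : IsSymmBody K) {x : EuclideanSpace ℝ (Fin d)} :
    gauge K x < 1 ↔ x ∈ K := by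
  rw [gauge_lt_one_iff_mem_interior hK.convex hK.mem_nhds, hK.isOpen.interior_eq]

theorem gauge_smul (_ : IsSymmBody K) {r : ℝ} (hr : 0 ≤ r) (x : EuclideanSpace ℝ (Fin d)) :
    gauge K (r • x) = r * gauge K x := by
  rw [gauge_smul_of_nonneg hr, smul_eq_mul]

theorem mem_smul_iff (hK : IsSymmBody K) {r : ℝ} (hr : 0 < r) {x : EuclideanSpace ℝ (Fin d)} :
    x ∈ r • K ↔ gauge K x < r := by
  rw [mem_smul_set_iff_inv_smul_mem₀ hr.ne', ← hK.gauge_lt_one_iff,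
    hK.gauge_smul (inv_nonneg.2 hr.le), inv_mul_lt_iff₀ hr, mul_one]

theorem gauge_pos_iff (hK : IsSymmBody K) {x : EuclideanSpace ℝ (Fin d)} :
    0 < gauge K x ↔ x ≠ 0 :=
  gauge_pos hK.absorbent (NormedSpace.isVonNBounded_iff ℝ |>.2 hK.isBounded)

theorem exists_lipschitz (hK : IsSymmBody K) : ∃ L, LipschitzWith L (gauge K) :=
  hK.convex.lipschitz_gauge hK.mem_nhds

theorem exists_norm_le (hK : IsSymmBody K) : ∃ R : ℝ, 0 < R ∧ ∀ x ∈ K, ‖x‖ ≤ R :=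
  hK.isBounded.exists_pos_norm_le

theorem polarBody_mem_nhds (hK : IsSymmBody K) : polarBody K ∈ 𝓝 0 := by
  obtain ⟨R, hR, hKR⟩ := hK.exists_norm_le
  filter_upwards [Metric.ball_mem_nhds (0 : EuclideanSpace ℝ (Fin d)) (inv_pos.2 hR)] with y hy
  intro x hx
  rw [mem_ball_zero_iff] at hy
  calc inner ℝ x y ≤ ‖x‖ * ‖y‖ := real_inner_le_norm x y
    _ ≤ R * R⁻¹ := by gcongr; exact hKR x hx
    _ = 1 := mul_inv_cancel₀ hR.ne'

end IsSymmBody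

theorem convex_polarBody : Convex ℝ (polarBody K) := by
  intro y hy z hz a b ha hb hab x hx
  rw [inner_add_right, inner_smul_right, inner_smul_right]
  have h1 := mul_le_mul_of_nonneg_left (hy x hx) ha
  have h2 := mul_le_mul_of_nonneg_left (hz x hx) hb
  linarith

namespace IsSymmBody

theorem continuous_gauge_polarBody (hK : IsSymmBody K) : Continuous (gauge (polarBody K)) :=
  _root_.continuous_gauge convex_polarBody hK.polarBody_mem_nhds

theorem exists_gauge_polarBody_le (hK : IsSymmBody K) :
    ∃ L : NNReal, ∀ x, gauge (polarBody K) x ≤ L * ‖x‖ := by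
  obtain ⟨L, hL⟩ := convex_polarBody.lipschitz_gauge hK.polarBody_mem_nhds
  refine ⟨L, fun x => ?_⟩
  have := hL.dist_le_mul x 0
  rw [gauge_zero, dist_zero_right, dist_zero_right, Real.norm_of_nonneg (gauge_nonneg _)] at this
  exact this

theorem gauge_polarBody_add_le (hK : IsSymmBody K) (x y : EuclideanSpace ℝ (Fin d)) :
    gauge (polarBody K) (x + y) ≤ gauge (polarBody K) x + gauge (polarBody K) y :=
  gauge_add_le convex_polarBody (absorbent_nhds_zero hK.polarBody_mem_nhds) x y

/-- If z ∈ rK° and y ∈ sK, then (z, y) ≤ rs by the definition of the polar set. Taking r and s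
strictly above the two gauges and letting them decrease avoids asking whether the infima are
attained. -/
theorem inner_le (hK : IsSymmBody K) (z y : EuclideanSpace ℝ (Fin d)) :
    inner ℝ z y ≤ gauge (polarBody K) z * gauge K y := by
  have key : ∀ r > gauge (polarBody K) z, ∀ s > gauge K y, inner ℝ z y ≤ r * s := by
    intro r hr s hs
    obtain ⟨r', hr'0, hr'r, z', hz', rfl⟩ := exists_lt_of_gauge_lt
      (absorbent_nhds_zero hK.polarBody_mem_nhds) hr
    obtain ⟨s', hs'0, hs's, y', hy', rfl⟩ := exists_lt_of_gauge_lt hK.absorbent hs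
    rw [inner_smul_left, inner_smul_right, real_inner_comm]
    have h1 := hz' y' hy'
    have hr0 : 0 ≤ r := (hr'0.trans hr'r).le
    calc r' * (s' * inner ℝ y' z') ≤ r' * (s' * 1) := by gcongr
      _ ≤ r * s := by rw [mul_one]; gcongr
  have h2 : ∀ r > gauge (polarBody K) z, inner ℝ z y ≤ r * gauge K y := by
    intro r hr
    refine ge_of_tendsto (x := 𝓝[>] gauge K y) (f := fun s => r * s) ?_ ?_
    · exact ((continuous_const.mul continuous_id).tendsto _).mono_left nhdsWithin_le_nhds
    · filter_upwards [self_mem_nhdsWithin] with s hs using key r hr s hs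
  refine ge_of_tendsto (x := 𝓝[>] gauge (polarBody K) z) (f := fun r => r * gauge K y) ?_ ?_
  · exact ((continuous_id.mul continuous_const).tendsto _).mono_left nhdsWithin_le_nhds
  · filter_upwards [self_mem_nhdsWithin] with s hs using h2 s hs

theorem abs_inner_le (hK : IsSymmBody K) (z y : EuclideanSpace ℝ (Fin d)) :
    |inner ℝ z y| ≤ gauge (polarBody K) z * gauge K y := by
  refine abs_le.2 ⟨?_, hK.inner_le z y⟩
  have := hK.inner_le z (-y)
  rw [gauge_neg hK.symm, inner_neg_right] at this
  linarith

theorem gauge_polarBody_smul (hK : IsSymmBody K) (a : ℝ) (x : EuclideanSpace ℝ (Fin d)) :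
    gauge (polarBody K) (a • x) = |a| * gauge (polarBody K) x := by
  have hsymm : ∀ y ∈ polarBody K, -y ∈ polarBody K := by
    intro y hy z hz
    have := hy (-z) (hK.symm z hz)
    rwa [inner_neg_right, ← inner_neg_left]
  rcases le_total 0 a with ha | ha
  · rw [gauge_smul_of_nonneg ha, abs_of_nonneg ha, smul_eq_mul]
  · rw [abs_of_nonpos ha, ← neg_neg (a • x), gauge_neg hsymm, ← neg_smul,
      gauge_smul_of_nonneg (neg_nonneg.2 ha), smul_eq_mul]

/-- Subadditivity bounds the derivative in a direction x by |x|_K, which puts the gradient into K°.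
Homogeneity makes the derivative in the direction y equal to |y|_K, and `inner_le` then forces the
polar norm to be at least 1. -/
theorem gauge_polarBody_gradient (hK : IsSymmBody K) {y : EuclideanSpace ℝ (Fin d)} (hy : y ≠ 0)
    (hdiff : DifferentiableAt ℝ (gauge K) y) :
    gauge (polarBody K) (gradient (gauge K) y) = 1 := by
  have hgrad : ∀ x, inner ℝ (gradient (gauge K) y) x = fderiv ℝ (gauge K) y x := by
    intro x
    rw [gradient, InnerProductSpace.toDual_symm_apply]
  have hline : ∀ x, Tendsto (fun t : ℝ => t⁻¹ * (gauge K (y + t • x) - gauge K y)) (𝓝[>] 0)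
      (𝓝 (fderiv ℝ (gauge K) y x)) := by
    intro x
    have h1 := (hdiff.hasFDerivAt.hasLineDerivAt x).tendsto_slope_zero_right
    simpa only [smul_eq_mul] using h1
  have hle : ∀ x, fderiv ℝ (gauge K) y x ≤ gauge K x := by
    intro x
    refine le_of_tendsto (hline x) ?_
    filter_upwards [self_mem_nhdsWithin] with t (ht : 0 < t)
    have := gauge_add_le hK.convex hK.absorbent y (t • x)
    rw [hK.gauge_smul ht.le] at this
    rw [inv_mul_le_iff₀ ht]; linarith
  have heq : fderiv ℝ (gauge K) y y = gauge K y := by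
    refine tendsto_nhds_unique (hline y) (tendsto_const_nhds.congr' ?_)
    filter_upwards [self_mem_nhdsWithin] with t (ht : 0 < t)
    have : y + t • y = (1 + t) • y := by rw [add_smul, one_smul]
    rw [this, hK.gauge_smul (by positivity)]
    field_simp; ring
  refine le_antisymm (gauge_le_one_of_mem fun x hx => ?_) ?_
  · rw [real_inner_comm, hgrad]
    exact (hle x).trans (gauge_le_one_of_mem hx)
  · have h1 := hK.inner_le (gradient (gauge K) y) y
    rw [hgrad, heq] at h1
    have := hK.gauge_pos_iff.2 hy
    by_contra! h
    nlinarith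

end IsSymmBody

/-- Convex open cones. -/
structure IsConvexOpenCone (C : Set (EuclideanSpace ℝ (Fin d))) : Prop where
  isOpen : IsOpen C
  convex : Convex ℝ C
  nonempty : C.Nonempty
  smul_mem : ∀ r : ℝ, 0 < r → ∀ x ∈ C, r • x ∈ C

theorem IsOpenFGCone.isConvexOpenCone (hC : IsOpenFGCone C) : IsConvexOpenCone C := by
  obtain ⟨hne, n, x, rfl⟩ := hC
  refine ⟨isOpen_interior, Convex.interior ?_, hne, ?_⟩
  · rintro _ ⟨c, hc, rfl⟩ _ ⟨e, he, rfl⟩ a b ha hb _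
    refine ⟨fun k => a * c k + b * e k, fun k => ?_, ?_⟩
    · have := hc k; have := he k; positivity
    · simp only [add_smul, Finset.sum_add_distrib, Finset.smul_sum, mul_smul]
  · intro r hr y hy
    have : r • interior {y | ∃ c : Fin n → ℝ, (∀ k, 0 ≤ c k) ∧ y = ∑ k, c k • x k} ⊆
        interior {y | ∃ c : Fin n → ℝ, (∀ k, 0 ≤ c k) ∧ y = ∑ k, c k • x k} := by
      rw [← interior_smul₀ hr.ne']
      refine interior_mono ?_
      rintro _ ⟨_, ⟨c, hc, rfl⟩, rfl⟩
      refine ⟨fun k => r * c k, fun k => by have := hc k; positivity, ?_⟩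
      simp only [Finset.smul_sum, mul_smul]
    exact this (smul_mem_smul_set hy)

namespace IsConvexOpenCone

theorem smul_mem_iff (hC : IsConvexOpenCone C) {r : ℝ} (hr : 0 < r)
    {x : EuclideanSpace ℝ (Fin d)} : r • x ∈ C ↔ x ∈ C := by
  refine ⟨fun h => ?_, hC.smul_mem r hr x⟩
  have := hC.smul_mem r⁻¹ (inv_pos.2 hr) _ h
  rwa [inv_smul_smul₀ hr.ne'] at this

theorem smul_eq (hC : IsConvexOpenCone C) {r : ℝ} (hr : 0 < r) : r • C = C := by
  ext x
  rw [mem_smul_set_iff_inv_smul_mem₀ hr.ne', hC.smul_mem_iff (inv_pos.2 hr)]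

theorem mem_smul_inter_iff (_ : IsConvexOpenCone C) (hK : IsSymmBody K) {h : ℝ} (hh : 0 < h)
    {x : EuclideanSpace ℝ (Fin d)} : x ∈ h • K ∩ C ↔ gauge K x < h ∧ x ∈ C := by
  rw [mem_inter_iff, hK.mem_smul_iff hh]

theorem isOpen_sector (hC : IsConvexOpenCone C) (hK : IsSymmBody K) {h : ℝ} (hh : 0 < h) :
    IsOpen (h • K ∩ C) := (hK.isOpen.smul₀ hh.ne').inter hC.isOpen

theorem convex_sector (hC : IsConvexOpenCone C) (hK : IsSymmBody K) (h : ℝ) :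
    Convex ℝ (h • K ∩ C) := (hK.convex.smul h).inter hC.convex

theorem isBounded_sector (_ : IsConvexOpenCone C) (hK : IsSymmBody K) (h : ℝ) :
    Bornology.IsBounded (h • K ∩ C) := (hK.isBounded.smul₀ h).subset inter_subset_left

theorem nonempty_sector (hC : IsConvexOpenCone C) (hK : IsSymmBody K) {h : ℝ} (hh : 0 < h) :
    (h • K ∩ C).Nonempty := by
  obtain ⟨x, hx⟩ := hC.nonempty
  have hpos : 0 < gauge K x + 1 := by have := gauge_nonneg (s := K) x; positivity
  refine ⟨(h / (gauge K x + 1)) • x, (hC.mem_smul_inter_iff hK hh).2 ⟨?_, hC.smul_mem _ (by positivity) x hx⟩⟩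
  rw [hK.gauge_smul (by positivity), div_mul_eq_mul_div, div_lt_iff₀ hpos]
  nlinarith

/-- This is what gives f(θ) a meaning: the continuous representative lives on the closure of the
sector, and the origin need not belong to the open cone. -/
theorem zero_mem_closure_sector (hC : IsConvexOpenCone C) (hK : IsSymmBody K) {h : ℝ}
    (hh : 0 < h) : (0 : EuclideanSpace ℝ (Fin d)) ∈ closure (h • K ∩ C) := by
  obtain ⟨x, hx⟩ := hC.nonempty_sector hK hh
  have h1 : Tendsto (fun t : ℝ => t • x) (𝓝[>] 0) (𝓝 0) := by
    have : Continuous fun t : ℝ => t • x := by fun_prop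
    simpa using (this.tendsto 0).mono_left nhdsWithin_le_nhds
  refine mem_closure_of_tendsto h1 ?_
  filter_upwards [Ioo_mem_nhdsGT (zero_lt_one' ℝ)] with t ht
  rw [hC.mem_smul_inter_iff hK hh] at hx ⊢
  refine ⟨?_, hC.smul_mem t ht.1 x hx.2⟩
  rw [hK.gauge_smul ht.1.le]
  nlinarith [hx.1, ht.1, ht.2, gauge_nonneg (s := K) x]

theorem gauge_le_of_mem_closure (_ : IsConvexOpenCone C) (hK : IsSymmBody K) {h : ℝ}
    (hh : 0 < h) {x : EuclideanSpace ℝ (Fin d)} (hx : x ∈ closure (h • K ∩ C)) :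
    gauge K x ≤ h := by
  have : closure (h • K ∩ C) ⊆ {x | gauge K x ≤ h} :=
    closure_minimal (fun y hy => ((hK.mem_smul_iff hh).1 hy.1).le)
      (isClosed_le hK.continuous_gauge continuous_const)
  exact this hx

theorem volume_inter_lt_top (_ : IsConvexOpenCone C) (hK : IsSymmBody K) :
    volume (K ∩ C) < ⊤ := (hK.isBounded.subset inter_subset_left).measure_lt_top

end IsConvexOpenCone

end

/-! ### Integration of radial functions over the sector -/

section

variable {d : ℕ} {K C : Set (EuclideanSpace ℝ (Fin d))}

theorem lintegral_Ioo_pow {d : ℕ} (hd : d ≠ 0) {b : ℝ} (hb : 0 ≤ b) :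
    ∫⁻ r in Ioo 0 b, ENNReal.ofReal (r ^ (d - 1)) = ENNReal.ofReal (b ^ d / d) := by
  rw [← ofReal_integral_eq_lintegral_ofReal, ← integral_Ioc_eq_integral_Ioo,
    ← intervalIntegral.integral_of_le hb, integral_pow]
  · have : d - 1 + 1 = d := by omega
    have h2 : ((d - 1 : ℕ) : ℝ) + 1 = d := by exact_mod_cast this
    rw [this, h2, zero_pow hd, sub_zero]
  · exact ((continuous_pow _).integrableOn_Icc (a := 0) (b := b)).mono_set Ioo_subset_Icc_self
  · filter_upwards [ae_restrict_mem measurableSet_Ioo] with r hr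
    exact pow_nonneg hr.1.le _

/-- Both measures are finite and agree on the half-lines (-∞, a), a π-system that generates the
Borel sets. There the claim is the scaling law meas(bK ∩ C) = b^d meas(K ∩ C), a consequence of bC =
C. -/
theorem map_gauge_sector (hd : d ≠ 0) (hK : IsSymmBody K) (hC : IsConvexOpenCone C) {h : ℝ}
    (hh : 0 < h) :
    (volume.restrict (h • K ∩ C)).map (gauge K) =
      (volume.restrict (Ioo 0 h)).withDensity
        (fun r => d * volume (K ∩ C) * ENNReal.ofReal (r ^ (d - 1))) := by
  have hm : volume (K ∩ C) ≠ ⊤ := (hC.volume_inter_lt_top hK).ne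
  have hvol : ∀ b : ℝ, 0 < b → volume (b • K ∩ C) = ENNReal.ofReal (b ^ d) * volume (K ∩ C) := by
    intro b hb
    rw [← hC.smul_eq hb, ← smul_set_inter₀ hb.ne', Measure.addHaar_smul,
      finrank_euclideanSpace_fin, abs_of_pos (by positivity), hC.smul_eq hb]
  have hden : ∀ b : ℝ, 0 < b →
      ∫⁻ r in Ioo 0 b, d * volume (K ∩ C) * ENNReal.ofReal (r ^ (d - 1)) =
        ENNReal.ofReal (b ^ d) * volume (K ∩ C) := by
    intro b hb
    rw [lintegral_const_mul _ (by fun_prop), lintegral_Ioo_pow hd hb.le]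
    have h2 : (d : ℝ≥0∞) = ENNReal.ofReal d := by simp
    rw [h2, mul_right_comm, ← ENNReal.ofReal_mul (by positivity)]
    congr 2
    field_simp
  have hIio : ∀ a : ℝ, (volume.restrict (h • K ∩ C)).map (gauge K) (Iio a) =
      (volume.restrict (Ioo 0 h)).withDensity
        (fun r => d * volume (K ∩ C) * ENNReal.ofReal (r ^ (d - 1))) (Iio a) := by
    intro a
    rw [Measure.map_apply hK.continuous_gauge.measurable measurableSet_Iio,
      withDensity_apply _ measurableSet_Iio,
      Measure.restrict_apply (hK.continuous_gauge.measurable measurableSet_Iio),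
      Measure.restrict_restrict measurableSet_Iio]
    rcases le_or_gt a 0 with ha | ha
    · have h1 : gauge K ⁻¹' Iio a ∩ (h • K ∩ C) = ∅ := by
        ext x
        simp only [mem_inter_iff, mem_preimage, mem_Iio, mem_empty_iff_false, iff_false]
        intro h; linarith [gauge_nonneg (s := K) x, h.1]
      have h2 : Iio a ∩ Ioo 0 h = ∅ := by
        ext x
        simp only [mem_inter_iff, mem_Ioo, mem_Iio, mem_empty_iff_false, iff_false]
        intro h; linarith [h.1, h.2.1]
      rw [h1, h2]; simp
    · have hb : 0 < min a h := lt_min ha hh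
      have h1 : gauge K ⁻¹' Iio a ∩ (h • K ∩ C) = (min a h) • K ∩ C := by
        ext x
        rw [mem_inter_iff, hC.mem_smul_inter_iff hK hh, hC.mem_smul_inter_iff hK hb, lt_min_iff,
          mem_preimage, mem_Iio, and_assoc]
      have h2 : Iio a ∩ Ioo 0 h = Ioo 0 (min a h) := by
        ext x
        simp only [mem_inter_iff, mem_Ioo, mem_Iio, lt_min_iff]; tauto
      rw [h1, h2, hvol _ hb, hden _ hb]
  have huniv : (volume.restrict (h • K ∩ C)).map (gauge K) univ =
      (volume.restrict (Ioo 0 h)).withDensity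
        (fun r => d * volume (K ∩ C) * ENNReal.ofReal (r ^ (d - 1))) univ := by
    rw [Measure.map_apply hK.continuous_gauge.measurable MeasurableSet.univ, preimage_univ,
      Measure.restrict_apply_univ, withDensity_apply _ MeasurableSet.univ, Measure.restrict_univ,
      hvol _ hh, hden _ hh]
  have : IsFiniteMeasure ((volume.restrict (h • K ∩ C)).map (gauge K)) := by
    refine ⟨?_⟩
    rw [Measure.map_apply hK.continuous_gauge.measurable MeasurableSet.univ, preimage_univ,
      Measure.restrict_apply_univ, hvol _ hh]
    exact ENNReal.mul_lt_top ENNReal.ofReal_lt_top hm.lt_top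
  refine ext_of_generate_finite (range Iio) ?_ isPiSystem_Iio ?_ huniv
  · rw [← borel_eq_generateFrom_Iio, BorelSpace.measurable_eq (α := ℝ)]
  · rintro _ ⟨a, rfl⟩
    exact hIio a

/-- Transfers null sets and almost everywhere measurability from (0, h) to the sector, so that
weights known only up to null sets can be composed with the gauge. -/
theorem quasiMeasurePreserving_gauge (hd : d ≠ 0) (hK : IsSymmBody K) (hC : IsConvexOpenCone C)
    {h : ℝ} (hh : 0 < h) :
    Measure.QuasiMeasurePreserving (gauge K) (volume.restrict (h • K ∩ C))
      (volume.restrict (Ioo 0 h)) := by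
  refine ⟨hK.continuous_gauge.measurable, ?_⟩
  rw [map_gauge_sector hd hK hC hh]
  exact withDensity_absolutelyContinuous _ _

theorem lintegral_comp_gauge (hd : d ≠ 0) (hK : IsSymmBody K) (hC : IsConvexOpenCone C) {h : ℝ}
    (hh : 0 < h) {φ : ℝ → ℝ≥0∞} (hφ : AEMeasurable φ (volume.restrict (Ioo 0 h))) :
    ∫⁻ y in h • K ∩ C, φ (gauge K y) =
      d * volume (K ∩ C) * ∫⁻ r in Ioo 0 h, ENNReal.ofReal (r ^ (d - 1)) * φ r := by
  have hm : volume (K ∩ C) ≠ ⊤ := (hC.volume_inter_lt_top hK).ne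
  have hac := (quasiMeasurePreserving_gauge hd hK hC hh).absolutelyContinuous
  rw [← lintegral_map' (hφ.mono_ac hac) hK.continuous_gauge.aemeasurable,
    map_gauge_sector hd hK hC hh,
    lintegral_withDensity_eq_lintegral_mul₀ (by fun_prop) hφ,
    ← lintegral_const_mul' _ _ (ENNReal.mul_ne_top (by simp) hm)]
  simp only [Pi.mul_apply, mul_assoc]

end

/-! ### Averages over homotheties in L_p -/

section

variable {d : ℕ} {Q : Set (EuclideanSpace ℝ (Fin d))} {P : Measure (EuclideanSpace ℝ (Fin d))}
  {F : Type*} [NormedAddCommGroup F]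

/-- The average of the homothetic copies `y ↦ v ((1 - t) y + t z)` over the centres `z`. -/
def homothetyAvg [NormedSpace ℝ F] (P : Measure (EuclideanSpace ℝ (Fin d))) (t : ℝ)
    (v : EuclideanSpace ℝ (Fin d) → F) (y : EuclideanSpace ℝ (Fin d)) : F :=
  ∫ z, v ((1 - t) • y + t • z) ∂P

/-- For a fixed centre z ∈ Q the homothety maps Q into itself by convexity and multiplies volumes by
(1 - t)^d. Integrating the resulting bound over z costs nothing, since P has mass one. -/
theorem map_homothety_le [IsProbabilityMeasure P] (hQc : Convex ℝ Q)
    (hP : ∀ᵐ z ∂P, z ∈ Q) {t : ℝ} (ht : t ∈ Ico (0 : ℝ) 1) :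
    ((volume.restrict Q).prod P).map (fun x => (1 - t) • x.1 + t • x.2) ≤
      ENNReal.ofReal (((1 - t) ^ d)⁻¹) • volume.restrict Q := by
  have ht1 : 0 < 1 - t := sub_pos.2 ht.2
  refine Measure.le_iff.2 fun s hs => ?_
  have hmeas : Measurable fun x : EuclideanSpace ℝ (Fin d) × EuclideanSpace ℝ (Fin d) =>
    (1 - t) • x.1 + t • x.2 := by fun_prop
  rw [Measure.map_apply hmeas hs, Measure.prod_apply_symm (hmeas hs), Measure.smul_apply,
    Measure.restrict_apply hs]
  calc ∫⁻ z, (volume.restrict Q) ((fun x => (x, z)) ⁻¹' ((fun x => (1 - t) • x.1 + t • x.2) ⁻¹' s)) ∂P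
      ≤ ∫⁻ z, ENNReal.ofReal (((1 - t) ^ d)⁻¹) * volume (s ∩ Q) ∂P := by
        refine lintegral_mono_ae ?_
        filter_upwards [hP] with z hz
        rw [Measure.restrict_apply ((measurable_prodMk_right : Measurable fun x => (x, z)) (hmeas hs))]
        have hsub : (fun x => (x, z)) ⁻¹' ((fun x => (1 - t) • x.1 + t • x.2) ⁻¹' s) ∩ Q ⊆
            (fun y => (1 - t) • y) ⁻¹' ((fun y => y + t • z) ⁻¹' (s ∩ Q)) := by
          rintro y ⟨hy1, hy2⟩
          exact ⟨hy1, hQc hy2 hz ht1.le ht.1 (by ring)⟩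
        refine (measure_mono hsub).trans ?_
        rw [Measure.addHaar_preimage_smul _ ht1.ne', measure_preimage_add_right,
          finrank_euclideanSpace_fin, abs_of_pos (by positivity)]
    _ = _ := by rw [lintegral_const, measure_univ, mul_one, smul_eq_mul]

theorem quasiMeasurePreserving_homothety [IsProbabilityMeasure P] (hQc : Convex ℝ Q)
    (hP : ∀ᵐ z ∂P, z ∈ Q) {t : ℝ} (ht : t ∈ Ico (0 : ℝ) 1) :
    Measure.QuasiMeasurePreserving
      (fun x : EuclideanSpace ℝ (Fin d) × EuclideanSpace ℝ (Fin d) => (1 - t) • x.1 + t • x.2)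
      ((volume.restrict Q).prod P) (volume.restrict Q) :=
  ⟨by fun_prop, (Measure.absolutelyContinuous_of_le (map_homothety_le hQc hP ht)).trans
    (Measure.smul_absolutelyContinuous)⟩

theorem eLpNorm_comp_homothety_le [IsProbabilityMeasure P] (hQc : Convex ℝ Q)
    (hP : ∀ᵐ z ∂P, z ∈ Q) {t : ℝ} (ht : t ∈ Ico (0 : ℝ) 1) {p : ℝ≥0∞} (hp : p ≠ ⊤)
    {v : EuclideanSpace ℝ (Fin d) → F} (hv : AEStronglyMeasurable v (volume.restrict Q)) :
    eLpNorm (fun x : EuclideanSpace ℝ (Fin d) × EuclideanSpace ℝ (Fin d) =>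
      v ((1 - t) • x.1 + t • x.2)) p ((volume.restrict Q).prod P) ≤
      ENNReal.ofReal (((1 - t) ^ d)⁻¹) ^ (1 / p).toReal * eLpNorm v p (volume.restrict Q) := by
  have hq := quasiMeasurePreserving_homothety hQc hP ht
  have h1 := eLpNorm_map_measure (p := p) (hv.mono_ac hq.absolutelyContinuous) hq.aemeasurable
  have h2 := eLpNorm_mono_measure (p := p) v (map_homothety_le hQc hP ht)
  rw [eLpNorm_smul_measure_of_ne_top hp, smul_eq_mul, h1] at h2
  exact h2

/-- The classical argument for continuity of translations in L_p: replace v by a compactly supported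
continuous g. The error of the replacement is controlled uniformly in t < 1/2 by
`eLpNorm_comp_homothety_le`, and for g the displacement t(z - y) is uniformly small. -/
theorem tendsto_eLpNorm_comp_homothety_sub [IsProbabilityMeasure P] [NormedSpace ℝ F]
    (hQo : IsOpen Q) (hQc : Convex ℝ Q) (hQb : Bornology.IsBounded Q) (hP : ∀ᵐ z ∂P, z ∈ Q)
    {p : ℝ≥0∞} (hp1 : 1 ≤ p) (hp : p ≠ ⊤)
    {v : EuclideanSpace ℝ (Fin d) → F} (hv : MemLp v p (volume.restrict Q)) :
    Tendsto (fun t : ℝ => eLpNorm (fun x : EuclideanSpace ℝ (Fin d) × EuclideanSpace ℝ (Fin d) =>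
      v ((1 - t) • x.1 + t • x.2) - v x.1) p ((volume.restrict Q).prod P)) (𝓝[>] 0) (𝓝 0) := by
  have hvol : volume Q ≠ ⊤ := hQb.measure_lt_top.ne
  have : IsFiniteMeasure (volume.restrict Q) := ⟨by simpa using hQb.measure_lt_top⟩
  -- One summand for each of three terms: v - g after the homothety, where (1 - t)^{-d} ≤ 2^d for t
  -- < 1/2, then v - g itself, then the oscillation of g, bounded by ε on a set of measure meas Q.
  set M : ℝ≥0∞ := ENNReal.ofReal (2 ^ d) ^ (1 / p).toReal + 1 + volume Q ^ (1 / p).toReal with hM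
  have hMtop : M ≠ ⊤ := by
    refine ENNReal.add_ne_top.2 ⟨ENNReal.add_ne_top.2 ⟨?_, ENNReal.one_ne_top⟩, ?_⟩
    · exact ENNReal.rpow_ne_top_of_nonneg ENNReal.toReal_nonneg ENNReal.ofReal_ne_top
    · exact ENNReal.rpow_ne_top_of_nonneg ENNReal.toReal_nonneg hvol
  have key : ∀ ε : ℝ, 0 < ε → ∀ᶠ t : ℝ in 𝓝[>] 0,
      eLpNorm (fun x : EuclideanSpace ℝ (Fin d) × EuclideanSpace ℝ (Fin d) =>
      v ((1 - t) • x.1 + t • x.2) - v x.1) p ((volume.restrict Q).prod P) ≤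
        M * ENNReal.ofReal ε := by
    intro ε hε
    have hε' : ENNReal.ofReal ε ≠ 0 := by simpa using hε
    obtain ⟨g, hgs, hvg, hgc, hgm⟩ := hv.exists_hasCompactSupport_eLpNorm_sub_le hp hε'
    obtain ⟨δ, hδ, hgδ⟩ := Metric.uniformContinuous_iff.1
      (hgs.uniformContinuous_of_continuous hgc) ε hε
    obtain ⟨R, hR, hQR⟩ := hQb.exists_pos_norm_le
    have hsmall : ∀ᶠ t : ℝ in 𝓝[>] 0, t ∈ Ioo (0 : ℝ) (min (1 / 2) (δ / (2 * R))) :=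
      Ioo_mem_nhdsGT (lt_min (by norm_num) (by positivity))
    filter_upwards [hsmall] with t ht
    have ht2 : t < 1 / 2 := ht.2.trans_le (min_le_left _ _)
    have htδ : t < δ / (2 * R) := ht.2.trans_le (min_le_right _ _)
    have htI : t ∈ Ico (0 : ℝ) 1 := ⟨ht.1.le, by linarith⟩
    have hq := quasiMeasurePreserving_homothety hQc hP htI
    have hfst : Measure.QuasiMeasurePreserving (Prod.fst : EuclideanSpace ℝ (Fin d) ×
      EuclideanSpace ℝ (Fin d) → _) ((volume.restrict Q).prod P) (volume.restrict Q) :=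
      Measure.quasiMeasurePreserving_fst
    have hvgm : AEStronglyMeasurable (v - g) (volume.restrict Q) :=
      hv.aestronglyMeasurable.sub hgc.aestronglyMeasurable
    set A := fun x : EuclideanSpace ℝ (Fin d) × EuclideanSpace ℝ (Fin d) =>
      (v - g) ((1 - t) • x.1 + t • x.2) with hA
    set B := fun x : EuclideanSpace ℝ (Fin d) × EuclideanSpace ℝ (Fin d) =>
      g ((1 - t) • x.1 + t • x.2) - g x.1 with hB
    set D := fun x : EuclideanSpace ℝ (Fin d) × EuclideanSpace ℝ (Fin d) => (v - g) x.1 with hD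
    have hAm : AEStronglyMeasurable A ((volume.restrict Q).prod P) :=
      hvgm.comp_quasiMeasurePreserving hq
    have hDm : AEStronglyMeasurable D ((volume.restrict Q).prod P) :=
      hvgm.comp_quasiMeasurePreserving hfst
    have hBm : AEStronglyMeasurable B ((volume.restrict Q).prod P) := by
      have : Continuous B := by fun_prop
      exact this.aestronglyMeasurable
    have hsum : (fun x : EuclideanSpace ℝ (Fin d) × EuclideanSpace ℝ (Fin d) =>
      v ((1 - t) • x.1 + t • x.2) - v x.1) = A + B - D := by
      ext x; simp [A, B, D]
    have hAle : eLpNorm A p ((volume.restrict Q).prod P) ≤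
        ENNReal.ofReal (2 ^ d) ^ (1 / p).toReal * ENNReal.ofReal ε := by
      refine (eLpNorm_comp_homothety_le hQc hP htI hp hvgm).trans ?_
      gcongr
      rw [← inv_pow]
      have : (1 - t)⁻¹ ≤ 2 := by
        rw [inv_le_comm₀ (by linarith) (by norm_num)]; linarith
      gcongr
      exact inv_nonneg.2 (by linarith)
    have hDle : eLpNorm D p ((volume.restrict Q).prod P) ≤ 1 * ENNReal.ofReal ε := by
      have := eLpNorm_comp_measurePreserving (p := p) hvgm
        (measurePreserving_fst (μ := volume.restrict Q) (ν := P))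
      rw [one_mul]
      exact this.le.trans hvg
    have hBle : eLpNorm B p ((volume.restrict Q).prod P) ≤
        volume Q ^ (1 / p).toReal * ENNReal.ofReal ε := by
      have hmem : ∀ᵐ x ∂(volume.restrict Q).prod P, ‖B x‖ ≤ ε := by
        have h1 : ∀ᵐ x ∂(volume.restrict Q).prod P, x.1 ∈ Q :=
          hfst.ae (ae_restrict_mem hQo.measurableSet)
        have h2 : ∀ᵐ x ∂(volume.restrict Q).prod P, x.2 ∈ Q :=
          (Measure.quasiMeasurePreserving_snd).ae hP
        filter_upwards [h1, h2] with x hx1 hx2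
        rw [← dist_eq_norm]
        refine (hgδ ?_).le
        have : (1 - t) • x.1 + t • x.2 - x.1 = t • (x.2 - x.1) := by
          rw [sub_smul, one_smul, smul_sub]; abel
        rw [dist_eq_norm, this, norm_smul, Real.norm_of_nonneg ht.1.le]
        have h3 : ‖x.2 - x.1‖ ≤ 2 * R := by
          have := norm_sub_le x.2 x.1
          linarith [hQR _ hx1, hQR _ hx2]
        calc t * ‖x.2 - x.1‖ ≤ t * (2 * R) := by gcongr; exact ht.1.le
          _ < δ := by rwa [← lt_div_iff₀ (by positivity)]
      refine (eLpNorm_le_of_ae_bound hmem).trans ?_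
      rw [Measure.prod_apply MeasurableSet.univ]
      simp
    rw [hsum]
    calc eLpNorm (A + B - D) p ((volume.restrict Q).prod P)
        ≤ eLpNorm A p ((volume.restrict Q).prod P) + eLpNorm B p ((volume.restrict Q).prod P)
          + eLpNorm D p ((volume.restrict Q).prod P) :=
          (eLpNorm_sub_le (hAm.add hBm) hDm hp1).trans
            (by gcongr; exact eLpNorm_add_le hAm hBm hp1)
      _ ≤ ENNReal.ofReal (2 ^ d) ^ (1 / p).toReal * ENNReal.ofReal ε +
          volume Q ^ (1 / p).toReal * ENNReal.ofReal ε + 1 * ENNReal.ofReal ε := by gcongr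
      _ = M * ENNReal.ofReal ε := by rw [hM]; ring
  refine ENNReal.tendsto_nhds_zero.2 fun ε hε => ?_
  rcases eq_or_ne ε ⊤ with rfl | hεt
  · exact Eventually.of_forall fun _ => le_top
  have hM0 : M ≠ 0 := by simp [hM]
  have h0 : 0 < ε / M := ENNReal.div_pos hε.ne' hMtop
  have h1 : ε / M ≠ ⊤ := ENNReal.div_ne_top hεt hM0
  filter_upwards [key (ε / M).toReal (ENNReal.toReal_pos h0.ne' h1)] with t ht
  rwa [ENNReal.ofReal_toReal h1, ENNReal.mul_div_cancel hM0 hMtop] at ht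

/-- Since P is a probability measure, the difference is itself an average of v((1 - t)y + tz) -
v(y), and its modulus is at most the L_1(P) norm of these differences, hence at most their L_p(P)
norm. -/
theorem eLpNorm_homothetyAvg_sub_le [IsProbabilityMeasure P] [NormedSpace ℝ F] [CompleteSpace F] (hQc : Convex ℝ Q) (hQb : Bornology.IsBounded Q) (hP : ∀ᵐ z ∂P, z ∈ Q)
    {p : ℝ≥0∞} (hp1 : 1 ≤ p) (hp : p ≠ ⊤) {t : ℝ} (ht : t ∈ Ico (0 : ℝ) 1)
    {v : EuclideanSpace ℝ (Fin d) → F} (hv : MemLp v p (volume.restrict Q)) :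
    eLpNorm (homothetyAvg P t v - v) p (volume.restrict Q) ≤
      eLpNorm (fun x : EuclideanSpace ℝ (Fin d) × EuclideanSpace ℝ (Fin d) =>
        v ((1 - t) • x.1 + t • x.2) - v x.1) p ((volume.restrict Q).prod P) := by
  have : IsFiniteMeasure (volume.restrict Q) := ⟨by simpa using hQb.measure_lt_top⟩
  have hq := quasiMeasurePreserving_homothety hQc hP ht
  have hp0 : p ≠ 0 := (zero_lt_one.trans_le hp1).ne'
  set Φ := fun x : EuclideanSpace ℝ (Fin d) × EuclideanSpace ℝ (Fin d) =>
        v ((1 - t) • x.1 + t • x.2) with hΦ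
  have hΦm : AEStronglyMeasurable Φ ((volume.restrict Q).prod P) :=
    hv.aestronglyMeasurable.comp_quasiMeasurePreserving hq
  have hvm : AEStronglyMeasurable (fun x : EuclideanSpace ℝ (Fin d) × EuclideanSpace ℝ (Fin d) =>
      v x.1) ((volume.restrict Q).prod P) :=
    hv.aestronglyMeasurable.comp_quasiMeasurePreserving Measure.quasiMeasurePreserving_fst
  have hΦL : MemLp Φ p ((volume.restrict Q).prod P) := by
    refine ⟨hΦm, (eLpNorm_comp_homothety_le hQc hP ht hp hv.aestronglyMeasurable).trans_lt ?_⟩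
    exact ENNReal.mul_lt_top (ENNReal.rpow_lt_top_of_nonneg ENNReal.toReal_nonneg
      ENNReal.ofReal_ne_top) hv.eLpNorm_lt_top
  have hint := (hΦL.integrable hp1).prod_right_ae
  have hsub : AEStronglyMeasurable (fun x : EuclideanSpace ℝ (Fin d) × EuclideanSpace ℝ (Fin d) =>
      v ((1 - t) • x.1 + t • x.2) - v x.1) ((volume.restrict Q).prod P) := hΦm.sub hvm
  have hsm := hsub.prodMk_left
  have hppos : 0 < p.toReal := ENNReal.toReal_pos hp0 hp
  rw [eLpNorm_eq_lintegral_rpow_enorm_toReal hp0 hp, eLpNorm_eq_lintegral_rpow_enorm_toReal hp0 hp]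
  gcongr
  rw [lintegral_prod _ (hsub.enorm.pow_const _)]
  refine lintegral_mono_ae ?_
  filter_upwards [hint, hsm] with y hy hym
  have h1 : (homothetyAvg P t v - v) y = ∫ z, (Φ (y, z) - v y) ∂P := by
    rw [integral_sub hy (integrable_const _), integral_const]
    simp [homothetyAvg, Φ]
  rw [h1]
  calc ‖∫ z, (Φ (y, z) - v y) ∂P‖ₑ ^ p.toReal
      ≤ (eLpNorm (fun z => Φ (y, z) - v y) 1 P) ^ p.toReal := by
        gcongr
        rw [eLpNorm_one_eq_lintegral_enorm]
        exact enorm_integral_le_lintegral_enorm _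
    _ ≤ (eLpNorm (fun z => Φ (y, z) - v y) p P) ^ p.toReal := by
        gcongr
        exact eLpNorm_le_eLpNorm_of_exponent_le hp1 hym
    _ = _ := by
        rw [eLpNorm_eq_lintegral_rpow_enorm_toReal hp0 hp, ← ENNReal.rpow_mul,
          one_div_mul_cancel hppos.ne', ENNReal.rpow_one]

theorem tendsto_eLpNorm_homothetyAvg_sub [IsProbabilityMeasure P] [NormedSpace ℝ F] [CompleteSpace F]
    (hQo : IsOpen Q) (hQc : Convex ℝ Q) (hQb : Bornology.IsBounded Q) (hP : ∀ᵐ z ∂P, z ∈ Q)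
    {p : ℝ≥0∞} (hp1 : 1 ≤ p) (hp : p ≠ ⊤)
    {v : EuclideanSpace ℝ (Fin d) → F} (hv : MemLp v p (volume.restrict Q)) :
    Tendsto (fun t : ℝ => eLpNorm (homothetyAvg P t v - v) p (volume.restrict Q))
      (𝓝[>] 0) (𝓝 0) := by
  refine tendsto_of_tendsto_of_tendsto_of_le_of_le' tendsto_const_nhds
    (tendsto_eLpNorm_comp_homothety_sub hQo hQc hQb hP hp1 hp hv)
    (Eventually.of_forall fun _ => zero_le) ?_
  filter_upwards [Ioo_mem_nhdsGT (zero_lt_one' ℝ)] with t ht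
  exact eLpNorm_homothetyAvg_sub_le hQc hQb hP hp1 hp ⟨ht.1.le, ht.2⟩ hv

end

/-! ### Density of C¹ functions in W^{1,p} of a bounded convex open set -/

section

variable {d : ℕ} {Q : Set (EuclideanSpace ℝ (Fin d))} {c : EuclideanSpace ℝ (Fin d)}
  {F : Type*} [NormedAddCommGroup F] [NormedSpace ℝ F]

/-- The probability measure whose density is a normalized bump function. -/
def bumpMeasure (β : ContDiffBump c) : Measure (EuclideanSpace ℝ (Fin d)) :=
  volume.withDensity fun z => ENNReal.ofReal (β.normed volume z)

instance (β : ContDiffBump c) : IsProbabilityMeasure (bumpMeasure β) := by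
  refine ⟨?_⟩
  rw [bumpMeasure, withDensity_apply _ MeasurableSet.univ, Measure.restrict_univ,
    ← ofReal_integral_eq_lintegral_ofReal β.integrable_normed
      (Eventually.of_forall β.nonneg_normed), β.integral_normed, ENNReal.ofReal_one]

theorem ae_mem_bumpMeasure (β : ContDiffBump c) (hβ : Metric.closedBall c β.rOut ⊆ Q) :
    ∀ᵐ z ∂bumpMeasure β, z ∈ Q := by
  rw [bumpMeasure, ae_withDensity_iff (by have := β.continuous_normed (μ := volume); fun_prop)]
  refine Eventually.of_forall fun z hz => hβ ?_
  rw [← β.tsupport_normed_eq (μ := volume)]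
  refine subset_tsupport _ fun h0 => hz ?_
  rw [h0, ENNReal.ofReal_zero]

/-- The kernel of the averaging operator given by a bump function. -/
def bumpKernel (β : ContDiffBump c) (t : ℝ) (x : EuclideanSpace ℝ (Fin d)) : ℝ :=
  (t ^ d)⁻¹ * β.normed volume ((-t⁻¹) • x)

theorem contDiff_bumpKernel (β : ContDiffBump c) (t : ℝ) : ContDiff ℝ ∞ (bumpKernel β t) := by
  have h : ContDiff ℝ ∞ (β.normed volume) := β.contDiff_normed
  exact contDiff_const.mul (h.comp (contDiff_const_smul _))

theorem hasCompactSupport_bumpKernel (β : ContDiffBump c) {t : ℝ} (ht : t ≠ 0) :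
    HasCompactSupport (bumpKernel β t) :=
  (β.hasCompactSupport_normed.comp_smul (neg_ne_zero.2 (inv_ne_zero ht))).mul_left

/-- Substituting x = (1 - t)y + tz turns the average into a convolution evaluated at (1 - t)y. Here
z = (x - (1 - t)y)/t, whereas a convolution kernel receives (1 - t)y - x; hence the minus sign
inside `bumpKernel`. -/
theorem homothetyAvg_bumpMeasure (β : ContDiffBump c) {t : ℝ} (ht : 0 < t)
    (v : EuclideanSpace ℝ (Fin d) → F) (y : EuclideanSpace ℝ (Fin d)) :
    homothetyAvg (bumpMeasure β) t v y = ∫ x, bumpKernel β t ((1 - t) • y - x) • v x := by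
  set x₀ := (1 - t) • y with hx₀
  have h1 : homothetyAvg (bumpMeasure β) t v y =
      ∫ z, (fun x => β.normed volume (t⁻¹ • x) • v (x₀ + x)) (t • z) := by
    rw [homothetyAvg, bumpMeasure, integral_withDensity_eq_integral_toReal_smul
      (by have := β.continuous_normed (μ := volume); fun_prop) (by simp)]
    refine integral_congr_ae (Eventually.of_forall fun z => ?_)
    simp only [ENNReal.toReal_ofReal (β.nonneg_normed z), inv_smul_smul₀ ht.ne', hx₀]
  rw [h1, Measure.integral_comp_smul volume (fun x => β.normed volume (t⁻¹ • x) • v (x₀ + x)) t,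
    finrank_euclideanSpace_fin, abs_of_pos (by positivity),
    ← integral_smul, ← integral_sub_right_eq_self _ x₀]
  refine integral_congr_ae (Eventually.of_forall fun x => ?_)
  simp only [bumpKernel, smul_smul, add_sub_cancel, neg_smul, ← smul_neg, neg_sub]

/-- The support consists of points (1 - t)y + tz with z in a ball inside Q, so convexity keeps it in
Q. The kernel is thus an admissible test function for every y ∈ Q, with no need to stay away from
the boundary. -/
theorem bumpKernel_test (β : ContDiffBump c) (hQc : Convex ℝ Q)
    (hβ : Metric.closedBall c β.rOut ⊆ Q) {t : ℝ} (ht : t ∈ Ioo (0 : ℝ) 1)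
    {y : EuclideanSpace ℝ (Fin d)} (hy : y ∈ Q) :
    tsupport (fun x => bumpKernel β t ((1 - t) • y - x)) ⊆ Q := by
  have h1 : tsupport (fun x => bumpKernel β t ((1 - t) • y - x)) ⊆
      (fun x => (-t⁻¹) • ((1 - t) • y - x)) ⁻¹' tsupport (β.normed volume) := by
    refine closure_minimal ?_ ((isClosed_tsupport _).preimage (by fun_prop))
    intro x hx
    refine subset_tsupport _ fun h0 => hx ?_
    simp only [bumpKernel, h0, mul_zero]
  intro x hx
  have h2 := h1 hx
  rw [mem_preimage, β.tsupport_normed_eq] at h2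
  have h3 := hQc hy (hβ h2) (sub_nonneg.2 ht.2.le) ht.1.le (by ring)
  convert h3 using 1
  rw [smul_smul, mul_neg, mul_inv_cancel₀ ht.1.ne', neg_one_smul]
  abel

theorem contDiff_homothetyAvg (β : ContDiffBump c) {t : ℝ} (ht : 0 < t)
    {f : EuclideanSpace ℝ (Fin d) → ℝ} (hf : LocallyIntegrable f) :
    ContDiff ℝ 1 (homothetyAvg (bumpMeasure β) t f) := by
  have h1 : homothetyAvg (bumpMeasure β) t f =
      fun y => (convolution f (bumpKernel β t) (ContinuousLinearMap.lsmul ℝ ℝ) volume)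
        ((1 - t) • y) := by
    ext y
    rw [homothetyAvg_bumpMeasure β ht]
    simp only [convolution_def, ContinuousLinearMap.lsmul_apply, smul_eq_mul, mul_comm]
  have h2 : ContDiff ℝ 1
      (convolution f (bumpKernel β t) (ContinuousLinearMap.lsmul ℝ ℝ) volume) :=
    (hasCompactSupport_bumpKernel β ht.ne').contDiff_convolution_right _ hf
      ((contDiff_bumpKernel β t).of_le (by exact_mod_cast le_top))
  rw [h1]
  exact h2.comp (contDiff_const_smul _)

/-- The derivative of the convolution falls on the kernel, and the weak gradient identity with the
kernel as test function moves it back to f. The factor 1 - t is the chain rule for y ↦ (1 - t)y. -/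
theorem gradient_homothetyAvg (β : ContDiffBump c) (hQo : IsOpen Q) (hQc : Convex ℝ Q)
    (hQb : Bornology.IsBounded Q)
    (hβ : Metric.closedBall c β.rOut ⊆ Q) {t : ℝ} (ht : t ∈ Ioo (0 : ℝ) 1)
    {f : EuclideanSpace ℝ (Fin d) → ℝ} {G : EuclideanSpace ℝ (Fin d) → EuclideanSpace ℝ (Fin d)}
    (hfG : IsWeakGradient Q f G) (hf : IntegrableOn f Q) (hG : IntegrableOn G Q)
    {y : EuclideanSpace ℝ (Fin d)} (hy : y ∈ Q) :
    gradient (homothetyAvg (bumpMeasure β) t (Q.indicator f)) y =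
      (1 - t) • homothetyAvg (bumpMeasure β) t (Q.indicator G) y := by
  have hQm := hQo.measurableSet
  have hfI : Integrable (Q.indicator f) := (integrable_indicator_iff hQm).2 hf
  have hGI : Integrable (Q.indicator G) := (integrable_indicator_iff hQm).2 hG
  set κ := bumpKernel β t with hκ
  have hκs := hasCompactSupport_bumpKernel β ht.1.ne'
  have hκd : ContDiff ℝ ∞ κ := contDiff_bumpKernel β t
  have hκd1 : ContDiff ℝ 1 κ := hκd.of_le (by exact_mod_cast le_top)
  set x₀ := (1 - t) • y with hx₀
  have hderiv := hκs.hasFDerivAt_convolution_right (ContinuousLinearMap.lsmul ℝ ℝ)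
    hfI.locallyIntegrable hκd1 x₀
  have h1 : homothetyAvg (bumpMeasure β) t (Q.indicator f) =
      fun y => (convolution (Q.indicator f) κ (ContinuousLinearMap.lsmul ℝ ℝ) volume)
        ((1 - t) • y) := by
    ext y
    rw [homothetyAvg_bumpMeasure β ht.1]
    simp only [convolution_def, ContinuousLinearMap.lsmul_apply, smul_eq_mul, mul_comm, hκ]
  have hcomp := hderiv.comp y ((hasFDerivAt_id y).const_smul (1 - t))
  have hfd : ∀ i, fderiv ℝ (homothetyAvg (bumpMeasure β) t (Q.indicator f)) y
      (EuclideanSpace.single i 1) = (1 - t) *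
        ∫ x in Q, f x * fderiv ℝ κ (x₀ - x) (EuclideanSpace.single i 1) := by
    intro i
    have h2 := hcomp.fderiv
    rw [h1]
    refine (congrArg (fun A => A (EuclideanSpace.single i 1)) h2).trans ?_
    rw [ContinuousLinearMap.comp_apply, FunLike.coe_smul, Pi.smul_apply,
      ContinuousLinearMap.id_apply, ContinuousLinearMap.map_smul, smul_eq_mul]
    congr 1
    have h3 : ConvolutionExistsAt (Q.indicator f) (fderiv ℝ κ) x₀
        ((ContinuousLinearMap.lsmul ℝ ℝ).precompR (EuclideanSpace ℝ (Fin d))) volume :=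
      (hκs.fderiv ℝ).convolutionExists_right _ hfI.locallyIntegrable
        (hκd1.continuous_fderiv one_ne_zero) x₀
    rw [convolution_def, ContinuousLinearMap.integral_apply h3, ← integral_indicator hQm]
    refine integral_congr_ae (Eventually.of_forall fun x => ?_)
    simp only [ContinuousLinearMap.precompR_apply]
    by_cases hx : x ∈ Q <;> simp [hx]
  have htest := hfG.integral_eq (fun x => κ (x₀ - x)) (hκd.comp (contDiff_const.sub contDiff_id))
    (Metric.isCompact_of_isClosed_isBounded (isClosed_tsupport _)
      (hQb.subset (bumpKernel_test β hQc hβ ht hy))) (bumpKernel_test β hQc hβ ht hy)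
  -- The sign from differentiating in x rather than in x₀ cancels the one in the definition of the
  -- weak gradient.
  have hfdκ : ∀ x v, fderiv ℝ (fun x => κ (x₀ - x)) x v = - fderiv ℝ κ (x₀ - x) v := by
    intro x v
    have h7 : HasFDerivAt κ (fderiv ℝ κ (x₀ - x)) (x₀ - x) :=
      (hκd1.differentiable one_ne_zero).differentiableAt.hasFDerivAt
    have h8 := h7.comp x ((hasFDerivAt_const x₀ x).sub (hasFDerivAt_id x))
    have h9 : fderiv ℝ (fun x => κ (x₀ - x)) x = _ := h8.fderiv
    rw [h9]
    simp
  have hvec : homothetyAvg (bumpMeasure β) t (Q.indicator G) y =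
      ∫ x in Q, κ (x₀ - x) • G x := by
    rw [homothetyAvg_bumpMeasure β ht.1, ← integral_indicator hQm]
    refine integral_congr_ae (Eventually.of_forall fun x => ?_)
    by_cases hx : x ∈ Q <;> simp [hx, hκ, hx₀]
  obtain ⟨M, hM⟩ := hκd.continuous.bounded_above_of_compact_support hκs
  have hvecI : IntegrableOn (fun x => κ (x₀ - x) • G x) Q := by
    refine hG.bdd_smul (C := M) ?_ (Eventually.of_forall fun x => hM _)
    have := hκd.continuous
    have : Continuous fun x => κ (x₀ - x) := by fun_prop
    exact this.aestronglyMeasurable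
  ext i
  have h4 : gradient (homothetyAvg (bumpMeasure β) t (Q.indicator f)) y i =
      fderiv ℝ (homothetyAvg (bumpMeasure β) t (Q.indicator f)) y
        (EuclideanSpace.single i 1) := by
    rw [← InnerProductSpace.toDual_symm_apply (𝕜 := ℝ), real_inner_comm,
      EuclideanSpace.inner_single_left]
    simp [gradient]
  have h5 : (∫ x in Q, κ (x₀ - x) • G x) i = ∫ x in Q, G x i * κ (x₀ - x) := by
    have := (EuclideanSpace.proj (𝕜 := ℝ) i : EuclideanSpace ℝ (Fin d) →L[ℝ] ℝ).integral_comp_comm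
      hvecI
    simp only [PiLp.proj_apply, PiLp.smul_apply, smul_eq_mul] at this
    rw [← this]
    simp only [mul_comm]
  rw [h4, hfd, PiLp.smul_apply, smul_eq_mul, hvec, h5]
  congr 1
  have h6 := htest i
  simp only [hfdκ, mul_neg, integral_neg, neg_inj] at h6
  exact h6

/-- Sobolev functions in a bounded convex open set are limits of functions of class `C¹`. -/
theorem IsWeakGradient.exists_contDiff_tendsto (hQo : IsOpen Q) (hQc : Convex ℝ Q)
    (hQb : Bornology.IsBounded Q) (hQn : Q.Nonempty) {p : ℝ≥0∞} (hp1 : 1 ≤ p) (hp : p ≠ ⊤)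
    {f : EuclideanSpace ℝ (Fin d) → ℝ} {G : EuclideanSpace ℝ (Fin d) → EuclideanSpace ℝ (Fin d)}
    (hfG : IsWeakGradient Q f G) (hf : MemLp f p (volume.restrict Q))
    (hG : MemLp G p (volume.restrict Q)) :
    ∃ u : ℕ → EuclideanSpace ℝ (Fin d) → ℝ, (∀ n, ContDiff ℝ 1 (u n)) ∧
      Tendsto (fun n => eLpNorm (u n - f) p (volume.restrict Q)) atTop (𝓝 0) ∧
      Tendsto (fun n => eLpNorm (gradient (u n) - G) p (volume.restrict Q)) atTop (𝓝 0) := by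
  have : IsFiniteMeasure (volume.restrict Q) := ⟨by simpa using hQb.measure_lt_top⟩
  have hQm := hQo.measurableSet
  obtain ⟨c, hc⟩ := hQn
  obtain ⟨r, hr, hrQ⟩ := Metric.nhds_basis_closedBall.mem_iff.1 (hQo.mem_nhds hc)
  let β : ContDiffBump c := ⟨r / 2, r, half_pos hr, half_lt_self hr⟩
  have hβ : Metric.closedBall c β.rOut ⊆ Q := hrQ
  have hβQ := ae_mem_bumpMeasure β hβ
  have hfe : Q.indicator f =ᵐ[volume.restrict Q] f := indicator_ae_eq_restrict hQm
  have hGe : Q.indicator G =ᵐ[volume.restrict Q] G := indicator_ae_eq_restrict hQm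
  have hfI : IntegrableOn f Q := hf.integrable hp1
  have hGI : IntegrableOn G Q := hG.integrable hp1
  -- The index is shifted because the parameter 1 is excluded: 1/(n + 2) is less than 1 already for
  -- n = 0.
  have hτ : Tendsto (fun n : ℕ => 1 / ((n + 1 : ℕ) + 1 : ℝ)) atTop (𝓝[>] 0) := by
    refine tendsto_nhdsWithin_iff.2
      ⟨(tendsto_one_div_add_atTop_nhds_zero_nat (𝕜 := ℝ)).comp (tendsto_add_atTop_nat 1), Eventually.of_forall fun n => ?_⟩
    exact mem_Ioi.2 (by positivity)
  set τ : ℕ → ℝ := fun n => 1 / ((n + 1 : ℕ) + 1 : ℝ) with hτd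
  have hτI : ∀ n, τ n ∈ Ioo (0 : ℝ) 1 := by
    intro n
    refine ⟨by positivity, ?_⟩
    rw [hτd, div_lt_one (by positivity)]
    push_cast
    linarith [n.cast_nonneg (α := ℝ)]
  refine ⟨fun n => homothetyAvg (bumpMeasure β) (τ n) (Q.indicator f), fun n => ?_, ?_, ?_⟩
  · exact contDiff_homothetyAvg β (hτI n).1
      ((integrable_indicator_iff hQm).2 hfI).locallyIntegrable
  · have h1 := (tendsto_eLpNorm_homothetyAvg_sub hQo hQc hQb hβQ hp1 hp
      (hf.ae_eq hfe.symm)).comp hτ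
    refine h1.congr fun n => ?_
    exact eLpNorm_congr_ae (EventuallyEq.rfl.sub hfe)
  · have h1 := (tendsto_eLpNorm_homothetyAvg_sub hQo hQc hQb hβQ hp1 hp
      (hG.ae_eq hGe.symm)).comp hτ
    -- With A the average of G, the error is (1 - τ)A - G = (1 - τ)(A - G) - τG, so the chain rule
    -- factor costs only τ‖G‖.
    have h2 : Tendsto (fun n => eLpNorm (homothetyAvg (bumpMeasure β) (τ n) (Q.indicator G) -
        Q.indicator G) p (volume.restrict Q) +
        ENNReal.ofReal (τ n) * eLpNorm G p (volume.restrict Q)) atTop (𝓝 (0 + 0)) := by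
      refine h1.add ?_
      have h3 : Tendsto (fun n => ENNReal.ofReal (τ n)) atTop (𝓝 0) := by
        have := (ENNReal.continuous_ofReal.tendsto 0).comp (hτ.mono_right nhdsWithin_le_nhds)
        simpa [Function.comp_def] using this
      have := ENNReal.Tendsto.mul_const (b := eLpNorm G p (volume.restrict Q)) h3
        (Or.inr hG.eLpNorm_lt_top.ne)
      simpa using this
    rw [add_zero] at h2
    refine tendsto_of_tendsto_of_tendsto_of_le_of_le tendsto_const_nhds h2
      (fun _ => zero_le) fun n => ?_
    set A := homothetyAvg (bumpMeasure β) (τ n) (Q.indicator G) with hA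
    have hAm : AEStronglyMeasurable A (volume.restrict Q) := by
      have hcont : Continuous A := by
        have hK := hasCompactSupport_bumpKernel β (hτI n).1.ne'
        have h4 : A = fun y => (convolution (Q.indicator G) (bumpKernel β (τ n))
            (ContinuousLinearMap.lsmul ℝ ℝ).flip volume) ((1 - τ n) • y) := by
          ext1 y
          rw [hA, homothetyAvg_bumpMeasure β (hτI n).1]
          simp only [convolution_def, ContinuousLinearMap.flip_apply,
            ContinuousLinearMap.lsmul_apply]
        rw [h4]
        exact (hK.continuous_convolution_right _
          ((integrable_indicator_iff hQm).2 hGI).locallyIntegrable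
          (contDiff_bumpKernel β (τ n)).continuous).comp (continuous_const_smul _)
      exact hcont.aestronglyMeasurable
    have hGm := hG.aestronglyMeasurable
    have hGm' := (hG.ae_eq hGe.symm).aestronglyMeasurable
    have h5 : gradient (homothetyAvg (bumpMeasure β) (τ n) (Q.indicator f)) - G
        =ᵐ[volume.restrict Q] (1 - τ n) • (A - Q.indicator G) - τ n • G := by
      filter_upwards [ae_restrict_mem hQm] with y hy
      rw [Pi.sub_apply, gradient_homothetyAvg β hQo hQc hQb hβ (hτI n) hfG hfI hGI hy]
      simp only [Pi.sub_apply, Pi.smul_apply, indicator_of_mem hy, hA]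
      module
    rw [eLpNorm_congr_ae h5]
    refine (eLpNorm_sub_le ((hAm.sub hGm').const_smul _) (hGm.const_smul _) hp1).trans ?_
    rw [eLpNorm_const_smul, eLpNorm_const_smul]
    have h6 : ‖1 - τ n‖ₑ ≤ 1 := by
      rw [Real.enorm_eq_ofReal (by linarith [(hτI n).2])]
      exact ENNReal.ofReal_le_one.2 (by linarith [(hτI n).1])
    have h7 : ‖τ n‖ₑ = ENNReal.ofReal (τ n) := Real.enorm_eq_ofReal (hτI n).1.le
    rw [h7]
    gcongr
    exact mul_le_of_le_one_left' h6

end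

/-! ### Morrey's estimate and uniform approximation for p > d -/

section

variable {d : ℕ} {Q : Set (EuclideanSpace ℝ (Fin d))}

theorem inner_gradient {u : EuclideanSpace ℝ (Fin d) → ℝ} (y v : EuclideanSpace ℝ (Fin d)) :
    inner ℝ (gradient u y) v = fderiv ℝ u y v := by
  rw [gradient, InnerProductSpace.toDual_symm_apply]

theorem continuous_gradient {u : EuclideanSpace ℝ (Fin d) → ℝ} (hu : ContDiff ℝ 1 u) :
    Continuous (gradient u) :=
  (InnerProductSpace.toDual ℝ _).symm.continuous.comp (hu.continuous_fderiv one_ne_zero)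

theorem enorm_sub_le_lintegral_gradient {u : EuclideanSpace ℝ (Fin d) → ℝ}
    (hu : ContDiff ℝ 1 u) (x y : EuclideanSpace ℝ (Fin d)) :
    ‖u y - u x‖ₑ ≤
      ∫⁻ t in Ioo (0 : ℝ) 1, ‖inner ℝ (gradient u (x + t • (y - x))) (y - x)‖ₑ := by
  have hc := continuous_gradient hu
  have hcont : Continuous fun t : ℝ => inner ℝ (gradient u (x + t • (y - x))) (y - x) := by
    fun_prop
  have h1 : ∀ t ∈ uIcc (0 : ℝ) 1, HasDerivAt (fun t : ℝ => u (x + t • (y - x)))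
      (inner ℝ (gradient u (x + t • (y - x))) (y - x)) t := by
    intro t _
    rw [inner_gradient]
    have h2 : HasDerivAt (fun t : ℝ => x + t • (y - x)) (y - x) t := by
      simpa using ((hasDerivAt_id t).smul_const (y - x)).const_add x
    exact ((hu.differentiable one_ne_zero).differentiableAt.hasFDerivAt).comp_hasDerivAt t h2
  have h2 := intervalIntegral.integral_eq_sub_of_hasDerivAt h1 (hcont.intervalIntegrable 0 1)
  simp only [one_smul, zero_smul, add_zero, add_sub_cancel] at h2
  rw [← h2, intervalIntegral.integral_of_le zero_le_one, integral_Ioc_eq_integral_Ioo]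
  exact enorm_integral_le_lintegral_enorm _

theorem lintegral_homothety {H : EuclideanSpace ℝ (Fin d) → ℝ≥0∞} (hH : Measurable H)
    (x : EuclideanSpace ℝ (Fin d)) {t : ℝ} (ht : 0 < t) :
    ∫⁻ y, H (x + t • (y - x)) = ENNReal.ofReal ((t ^ d)⁻¹) * ∫⁻ z, H z := by
  rw [lintegral_sub_right_eq_self (fun y => H (x + t • y)) x, ← lintegral_add_left_eq_self H x]
  have h1 := Measure.map_addHaar_smul (volume : Measure (EuclideanSpace ℝ (Fin d))) ht.ne'
  rw [finrank_euclideanSpace_fin, abs_of_pos (by positivity)] at h1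
  have h2 : Measurable fun z => H (x + z) := hH.comp (measurable_const_add x)
  have h3 := lintegral_map (μ := (volume : Measure (EuclideanSpace ℝ (Fin d)))) h2
    (measurable_const_smul t)
  rw [h1, lintegral_smul_measure, smul_eq_mul] at h3
  exact h3.symm

theorem setLIntegral_homothety {H : EuclideanSpace ℝ (Fin d) → ℝ≥0∞} (hH : Measurable H)
    {S : Set (EuclideanSpace ℝ (Fin d))} (hS : MeasurableSet S)
    (x : EuclideanSpace ℝ (Fin d)) {t : ℝ} (ht : 0 < t) :
    ∫⁻ y in S, H (x + t • (y - x)) = ENNReal.ofReal ((t ^ d)⁻¹) *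
      ∫⁻ z in {z | x + t⁻¹ • (z - x) ∈ S}, H z := by
  have hS' : MeasurableSet {z | x + t⁻¹ • (z - x) ∈ S} := by
    have : Measurable fun z : EuclideanSpace ℝ (Fin d) => x + t⁻¹ • (z - x) := by fun_prop
    exact this hS
  rw [← lintegral_indicator hS, ← lintegral_indicator hS',
    ← lintegral_homothety (hH.indicator hS') x ht]
  refine lintegral_congr fun y => ?_
  have : x + t⁻¹ • (x + t • (y - x) - x) = y := by
    rw [add_sub_cancel_left, inv_smul_smul₀ ht.ne', add_sub_cancel]
  by_cases hy : y ∈ S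
  · rw [indicator_of_mem hy, indicator_of_mem (by rwa [mem_ofPred_eq, this])]
  · rw [indicator_of_notMem hy, indicator_of_notMem (by rwa [mem_ofPred_eq, this])]

theorem volume_homothety {S : Set (EuclideanSpace ℝ (Fin d))} (hS : MeasurableSet S)
    (x : EuclideanSpace ℝ (Fin d)) {t : ℝ} (ht : 0 < t) :
    volume {z | x + t⁻¹ • (z - x) ∈ S} = ENNReal.ofReal (t ^ d) * volume S := by
  have h1 := setLIntegral_homothety (H := fun _ => 1) measurable_const hS x ht
  simp only [lintegral_one, Measure.restrict_apply_univ] at h1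
  rw [h1, ← mul_assoc, ← ENNReal.ofReal_mul (by positivity), mul_inv_cancel₀ (by positivity),
    ENNReal.ofReal_one, one_mul]

theorem lintegral_Ioo_rpow_lt_top {r : ℝ} (hr : -1 < r) (b : ℝ) :
    ∫⁻ t in Ioo (0 : ℝ) b, ENNReal.ofReal (t ^ r) < ⊤ := by
  rcases le_or_gt b 0 with hb | hb
  · simp [Ioo_eq_empty_of_le hb]
  have h1 : IntegrableOn (fun t : ℝ => t ^ r) (Ioo 0 b) :=
    ((intervalIntegral.intervalIntegrable_rpow' hr (a := 0) (b := b)).1).mono_set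
      Ioo_subset_Ioc_self
  exact h1.lintegral_lt_top

/-- Integrate |∇u| along segments from x and substitute z = x + t(y - x). The Jacobian is t^{-d},
and z runs over a subset of Q of measure t^d meas Q, so Hölder's inequality leaves t^{-d} t^{d(1 -
1/p)} = t^{-d/p}, integrable on (0, 1) exactly because p > d. -/
theorem lintegral_enorm_sub_le (hQo : IsOpen Q) (hQc : Convex ℝ Q) (hQb : Bornology.IsBounded Q)
    {p : ℝ≥0∞} (hpd : (d : ℝ≥0∞) < p) (hp1 : 1 ≤ p) (hp : p ≠ ⊤) :
    ∃ A : ℝ≥0∞, A ≠ ⊤ ∧ ∀ u : EuclideanSpace ℝ (Fin d) → ℝ, ContDiff ℝ 1 u →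
      ∀ x ∈ closure Q, ∫⁻ y in Q, ‖u y - u x‖ₑ ≤
        A * eLpNorm (gradient u) p (volume.restrict Q) := by
  obtain ⟨R, hR, hQR⟩ := hQb.closure.exists_pos_norm_le
  have hppos : 0 < p.toReal := ENNReal.toReal_pos (zero_lt_one.trans_le hp1).ne' hp
  have hp1' : 1 ≤ p.toReal := by
    rw [← ENNReal.toReal_one]; exact ENNReal.toReal_mono hp hp1
  have hdp : (d : ℝ) < p.toReal := by
    rw [← ENNReal.toReal_natCast d]; exact ENNReal.toReal_strict_mono hp hpd
  have hV : volume Q ≠ ⊤ := hQb.measure_lt_top.ne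
  have he0 : 0 ≤ 1 - 1 / p.toReal := by
    rw [sub_nonneg, div_le_one hppos]; exact hp1'
  have hI : ∫⁻ t in Ioo (0 : ℝ) 1, ENNReal.ofReal (t ^ (-(d : ℝ) / p.toReal)) < ⊤ := by
    refine lintegral_Ioo_rpow_lt_top ?_ 1
    rw [neg_div, neg_lt_neg_iff, div_lt_one hppos]
    exact hdp
  refine ⟨ENNReal.ofReal (2 * R) * volume Q ^ (1 - 1 / p.toReal) *
    ∫⁻ t in Ioo (0 : ℝ) 1, ENNReal.ofReal (t ^ (-(d : ℝ) / p.toReal)), ?_, ?_⟩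
  · exact ENNReal.mul_ne_top (ENNReal.mul_ne_top ENNReal.ofReal_ne_top
      (ENNReal.rpow_ne_top_of_nonneg he0 hV)) hI.ne
  intro u hu x hx
  have hc := continuous_gradient hu
  set N := eLpNorm (gradient u) p (volume.restrict Q) with hN
  have hxR := hQR x hx
  calc ∫⁻ y in Q, ‖u y - u x‖ₑ
      ≤ ∫⁻ y in Q, ∫⁻ t in Ioo (0 : ℝ) 1,
          ENNReal.ofReal (2 * R) * ‖gradient u (x + t • (y - x))‖ₑ := by
        refine setLIntegral_mono_ae' hQo.measurableSet (Eventually.of_forall fun y hy => ?_)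
        refine (enorm_sub_le_lintegral_gradient hu x y).trans (lintegral_mono fun t => ?_)
        have h1 : ‖y - x‖ ≤ 2 * R := by
          have := norm_sub_le y x
          linarith [hQR y (subset_closure hy)]
        rw [← ofReal_norm, ← ofReal_norm, ← ENNReal.ofReal_mul (by positivity)]
        refine ENNReal.ofReal_le_ofReal ((norm_inner_le_norm _ _).trans ?_)
        rw [mul_comm]; gcongr
    _ = ∫⁻ t in Ioo (0 : ℝ) 1, ∫⁻ y in Q,
          ENNReal.ofReal (2 * R) * ‖gradient u (x + t • (y - x))‖ₑ := by
        refine lintegral_lintegral_swap ?_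
        have : Continuous fun z : EuclideanSpace ℝ (Fin d) × ℝ =>
          gradient u (x + z.2 • (z.1 - x)) := by fun_prop
        exact ((this.measurable.enorm).const_mul _).aemeasurable
    _ ≤ ∫⁻ t in Ioo (0 : ℝ) 1, ENNReal.ofReal (2 * R) * volume Q ^ (1 - 1 / p.toReal) *
          ENNReal.ofReal (t ^ (-(d : ℝ) / p.toReal)) * N := by
        refine setLIntegral_mono_ae' measurableSet_Ioo (Eventually.of_forall fun t ht => ?_)
        have htd : 0 < t ^ d := pow_pos ht.1 _
        have hct : Continuous fun y => gradient u (x + t • (y - x)) := by fun_prop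
        rw [lintegral_const_mul _ hct.measurable.enorm,
          setLIntegral_homothety (H := fun z => ‖gradient u z‖ₑ) hc.measurable.enorm
            hQo.measurableSet x ht.1]
        set T := {z | x + t⁻¹ • (z - x) ∈ Q} with hT
        -- Here x may lie on the boundary: a segment from a point of the closure of a convex set to
        -- an interior point is interior except possibly at its start.
        have hTQ : T ⊆ Q := by
          intro z hz
          have h2 := hQc.combo_closure_interior_mem_interior hx
            (by rwa [hQo.interior_eq] : x + t⁻¹ • (z - x) ∈ interior Q)
            (sub_nonneg.2 ht.2.le) ht.1 (by ring)
          rw [hQo.interior_eq] at h2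
          convert h2 using 1
          rw [smul_add, smul_inv_smul₀ ht.1.ne']; module
        have h3 := eLpNorm_le_eLpNorm_mul_rpow_measure_univ (μ := volume.restrict T) hp1
          hc.aestronglyMeasurable (f := gradient u)
        rw [eLpNorm_one_eq_lintegral_enorm, Measure.restrict_apply_univ, ENNReal.toReal_one,
          volume_homothety hQo.measurableSet x ht.1, div_one] at h3
        have h4 : eLpNorm (gradient u) p (volume.restrict T) ≤ N :=
          eLpNorm_mono_measure _ (Measure.restrict_mono hTQ le_rfl)
        have h5 : ENNReal.ofReal ((t ^ d)⁻¹) *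
            (ENNReal.ofReal (t ^ d) * volume Q) ^ (1 - 1 / p.toReal) =
            ENNReal.ofReal (t ^ (-(d : ℝ) / p.toReal)) * volume Q ^ (1 - 1 / p.toReal) := by
          rw [ENNReal.mul_rpow_of_nonneg _ _ he0, ← mul_assoc,
            ENNReal.ofReal_rpow_of_nonneg htd.le he0, ← ENNReal.ofReal_mul (by positivity)]
          congr 2
          rw [← Real.rpow_natCast, ← Real.rpow_neg ht.1.le, ← Real.rpow_mul ht.1.le,
            ← Real.rpow_add ht.1]
          congr 1; field_simp; ring
        calc ENNReal.ofReal (2 * R) * (ENNReal.ofReal ((t ^ d)⁻¹) * ∫⁻ z in T, ‖gradient u z‖ₑ)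
            ≤ ENNReal.ofReal (2 * R) * (ENNReal.ofReal ((t ^ d)⁻¹) *
              (N * (ENNReal.ofReal (t ^ d) * volume Q) ^ (1 - 1 / p.toReal))) := by
              gcongr
              exact h3.trans (by gcongr)
          _ = ENNReal.ofReal (2 * R) * ((ENNReal.ofReal ((t ^ d)⁻¹) *
              (ENNReal.ofReal (t ^ d) * volume Q) ^ (1 - 1 / p.toReal)) * N) := by ring
          _ = _ := by rw [h5]; ring
    _ = _ := by
        have : Measurable fun t : ℝ => ENNReal.ofReal (t ^ (-(d : ℝ) / p.toReal)) := by fun_prop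
        rw [lintegral_mul_const _ (this.const_mul _), lintegral_const_mul _ this]

/-- Morrey's estimate of the supremum of a function in a bounded convex open set. -/
theorem enorm_le_eLpNorm_add (hQo : IsOpen Q) (hQc : Convex ℝ Q) (hQb : Bornology.IsBounded Q)
    (hQn : Q.Nonempty) {p : ℝ≥0∞} (hpd : (d : ℝ≥0∞) < p) (hp1 : 1 ≤ p) (hp : p ≠ ⊤) :
    ∃ A : ℝ≥0∞, A ≠ ⊤ ∧ ∀ u : EuclideanSpace ℝ (Fin d) → ℝ, ContDiff ℝ 1 u →
      ∀ x ∈ closure Q, ‖u x‖ₑ ≤ A * (eLpNorm u p (volume.restrict Q) +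
        eLpNorm (gradient u) p (volume.restrict Q)) := by
  obtain ⟨A, hA, hAu⟩ := lintegral_enorm_sub_le hQo hQc hQb hpd hp1 hp
  have hV : volume Q ≠ ⊤ := hQb.measure_lt_top.ne
  have hV0 : volume Q ≠ 0 := (hQo.measure_pos volume hQn).ne'
  have hppos : 0 < p.toReal := ENNReal.toReal_pos (zero_lt_one.trans_le hp1).ne' hp
  have hp1' : 1 ≤ p.toReal := by
    rw [← ENNReal.toReal_one]; exact ENNReal.toReal_mono hp hp1
  have he0 : 0 ≤ 1 / (1 : ℝ≥0∞).toReal - 1 / p.toReal := by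
    rw [ENNReal.toReal_one, div_one, sub_nonneg, div_le_one hppos]; exact hp1'
  set B := volume Q ^ (1 / (1 : ℝ≥0∞).toReal - 1 / p.toReal) with hB
  have hBt : B ≠ ⊤ := ENNReal.rpow_ne_top_of_nonneg he0 hV
  refine ⟨(A + B) / volume Q, ENNReal.div_ne_top (ENNReal.add_ne_top.2 ⟨hA, hBt⟩) hV0, ?_⟩
  intro u hu x hx
  -- Integrate |u(x)| ≤ |u(y)| + |u(y) - u(x)| over y ∈ Q.
  have h1 : ‖u x‖ₑ * volume Q ≤ (A + B) * (eLpNorm u p (volume.restrict Q) +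
        eLpNorm (gradient u) p (volume.restrict Q)) := by
    calc ‖u x‖ₑ * volume Q = ∫⁻ _ in Q, ‖u x‖ₑ := by simp
      _ ≤ ∫⁻ y in Q, (‖u y‖ₑ + ‖u y - u x‖ₑ) := by
          refine lintegral_mono fun y => ?_
          have := enorm_sub_le (a := u y) (b := u y - u x)
          rwa [sub_sub_cancel] at this
      _ = (∫⁻ y in Q, ‖u y‖ₑ) + ∫⁻ y in Q, ‖u y - u x‖ₑ :=
          lintegral_add_left hu.continuous.measurable.enorm _
      _ ≤ eLpNorm u p (volume.restrict Q) * B +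
          A * eLpNorm (gradient u) p (volume.restrict Q) := by
          refine add_le_add ?_ (hAu u hu x hx)
          have h3 := eLpNorm_le_eLpNorm_mul_rpow_measure_univ (μ := volume.restrict Q) hp1
            hu.continuous.aestronglyMeasurable (f := u)
          rwa [eLpNorm_one_eq_lintegral_enorm, Measure.restrict_apply_univ] at h3
      _ ≤ _ := by
          rw [mul_add, add_mul, add_mul, mul_comm _ B]
          exact add_le_add le_add_self le_self_add
  rw [← ENNReal.le_div_iff_mul_le (Or.inl hV0) (Or.inl hV)] at h1
  rwa [ENNReal.mul_div_right_comm] at h1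

/-- Sobolev's embedding for `p > d`: in a bounded convex open set, the approximations by functions
of class `C¹` converge uniformly. -/
theorem IsWeakGradient.exists_tendstoUniformlyOn (hQo : IsOpen Q) (hQc : Convex ℝ Q)
    (hQb : Bornology.IsBounded Q) (hQn : Q.Nonempty) {p : ℝ≥0∞} (hpd : (d : ℝ≥0∞) < p)
    (hp1 : 1 ≤ p) (hp : p ≠ ⊤) {f : EuclideanSpace ℝ (Fin d) → ℝ}
    {G : EuclideanSpace ℝ (Fin d) → EuclideanSpace ℝ (Fin d)}
    (hfG : IsWeakGradient Q f G) (hf : MemLp f p (volume.restrict Q))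
    (hG : MemLp G p (volume.restrict Q)) :
    ∃ (u : ℕ → EuclideanSpace ℝ (Fin d) → ℝ) (F : EuclideanSpace ℝ (Fin d) → ℝ),
      (∀ n, ContDiff ℝ 1 (u n)) ∧ TendstoUniformlyOn u F atTop (closure Q) ∧ IsContRep Q f F ∧
      Tendsto (fun n => eLpNorm (gradient (u n) - G) p (volume.restrict Q)) atTop (𝓝 0) := by
  obtain ⟨u, hu, huf, huG⟩ := hfG.exists_contDiff_tendsto hQo hQc hQb hQn hp1 hp hf hG
  obtain ⟨A, hA, hAu⟩ := enorm_le_eLpNorm_add hQo hQc hQb hQn hpd hp1 hp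
  set a : ℕ → ℝ≥0∞ := fun n => eLpNorm (u n - f) p (volume.restrict Q) +
    eLpNorm (gradient (u n) - G) p (volume.restrict Q) with ha
  have ha0 : Tendsto (fun n => A * (2 * a n)) atTop (𝓝 0) := by
    have h1 := huf.add huG
    have h2 := ENNReal.Tendsto.const_mul (a := A) (ENNReal.Tendsto.const_mul (a := 2) h1
      (Or.inr (by simp))) (Or.inr hA)
    simpa using h2
  -- The supremum estimate is applied to the C¹ function u_m - u_n, with f and G inserted in
  -- between.
  have hdiff : ∀ m n, ∀ x ∈ closure Q, ‖u m x - u n x‖ₑ ≤ A * (a m + a n) := by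
    intro m n x hx
    have h1 := hAu (u m - u n) ((hu m).sub (hu n)) x hx
    have h2 : gradient (u m - u n) = (gradient (u m) - G) - (gradient (u n) - G) := by
      ext1 y
      simp only [Pi.sub_apply, sub_sub_sub_cancel_right, gradient]
      rw [fderiv_sub ((hu m).differentiable one_ne_zero).differentiableAt
        ((hu n).differentiable one_ne_zero).differentiableAt, map_sub]
    have h3 : u m - u n = (u m - f) - (u n - f) := by ext1 y; simp
    have hgm : ∀ k, AEStronglyMeasurable (gradient (u k) - G) (volume.restrict Q) := fun k =>
      (continuous_gradient (hu k)).aestronglyMeasurable.sub hG.aestronglyMeasurable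
    have hum : ∀ k, AEStronglyMeasurable (u k - f) (volume.restrict Q) := fun k =>
      (hu k).continuous.aestronglyMeasurable.sub hf.aestronglyMeasurable
    have h4 : eLpNorm (u m - u n) p (volume.restrict Q) ≤
        eLpNorm (u m - f) p (volume.restrict Q) + eLpNorm (u n - f) p (volume.restrict Q) := by
      rw [h3]; exact eLpNorm_sub_le (hum m) (hum n) hp1
    have h5 : eLpNorm (gradient (u m - u n)) p (volume.restrict Q) ≤
        eLpNorm (gradient (u m) - G) p (volume.restrict Q) +
          eLpNorm (gradient (u n) - G) p (volume.restrict Q) := by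
      rw [h2]; exact eLpNorm_sub_le (hgm m) (hgm n) hp1
    refine h1.trans (mul_le_mul' le_rfl ?_)
    calc _ ≤ _ := add_le_add h4 h5
      _ = _ := by simp only [ha]; ring
  have hcauchy : UniformCauchySeqOn u atTop (closure Q) := by
    rw [Metric.uniformCauchySeqOn_iff]
    intro ε hε
    have h0 : (0 : ℝ≥0∞) < ENNReal.ofReal ε := by simpa using hε
    obtain ⟨N, hN⟩ := eventually_atTop.1 (ha0.eventually_lt_const h0)
    refine ⟨N, fun m hm n hn x hx => ?_⟩
    have h1 : ‖u m x - u n x‖ₑ < ENNReal.ofReal ε := by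
      refine (hdiff m n x hx).trans_lt ?_
      refine lt_of_le_of_lt ?_ (max_lt (hN m hm) (hN n hn))
      rw [← mul_max, ← mul_max]
      gcongr
      rw [two_mul]
      exact add_le_add (le_max_left _ _) (le_max_right _ _)
    rw [dist_eq_norm]
    rw [← ofReal_norm] at h1
    exact (ENNReal.ofReal_lt_ofReal_iff hε).1 h1
  have hlim : ∀ x ∈ closure Q, ∃ l, Tendsto (fun n => u n x) atTop (𝓝 l) := fun x hx =>
    cauchySeq_tendsto_of_complete (hcauchy.cauchySeq hx)
  choose! F hF using hlim
  have hunif := hcauchy.tendstoUniformlyOn_of_tendsto hF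
  refine ⟨u, F, hu, hunif, ⟨?_, ?_⟩, huG⟩
  · exact hunif.continuousOn (Frequently.of_forall fun n => (hu n).continuous.continuousOn)
  · have h1 : TendstoInMeasure (volume.restrict Q) u atTop f :=
      tendstoInMeasure_of_tendsto_eLpNorm (zero_lt_one.trans_le hp1).ne'
        (fun n => (hu n).continuous.aestronglyMeasurable) hf.aestronglyMeasurable huf
    obtain ⟨ns, hns, hae⟩ := h1.exists_seq_tendsto_ae
    filter_upwards [hae, ae_restrict_mem hQo.measurableSet] with x hx hxQ
    exact tendsto_nhds_unique ((hF x (subset_closure hxQ)).comp hns.tendsto_atTop) hx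

end

/-! ### The pointwise-weighted inequality for weights with values in [0, ∞] -/

section

variable {d : ℕ} {K C : Set (EuclideanSpace ℝ (Fin d))} {h : ℝ} {ρ : ℝ → ℝ≥0∞}

/-- The function `gFun` of a weight with values in `[0, ∞]`. -/
def gENN (d : ℕ) (ρ : ℝ → ℝ≥0∞) (h r : ℝ) : ℝ≥0∞ :=
  (ENNReal.ofReal (r ^ (d - 1)))⁻¹ * ∫⁻ s in Ioo r h, ρ s * ENNReal.ofReal (s ^ (d - 1))

/-- The substitution s = r/t. The left side collects the weights of all points z/t of the sector
whose segment to the origin passes through z, where |z|_K = r and t^{-d} is the Jacobian of the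
homothety. -/
theorem lintegral_ray_eq_gENN (hd : d ≠ 0) {r : ℝ} (hr : 0 < r) (hrh : r < h) :
    ∫⁻ t in Ioo (r / h) 1, ENNReal.ofReal ((t ^ d)⁻¹) * (ρ (r / t) * ENNReal.ofReal (r / t)) =
      gENN d ρ h r := by
  have hh : 0 < h := hr.trans hrh
  have hrh' : 0 < r / h := div_pos hr hh
  have himage : (fun t : ℝ => r / t) '' Ioo (r / h) 1 = Ioo r h := by
    ext s
    constructor
    · rintro ⟨t, ht, rfl⟩
      have ht0 : 0 < t := hrh'.trans ht.1
      refine ⟨?_, ?_⟩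
      · show r < r / t
        rw [lt_div_iff₀ ht0]; nlinarith [ht.2]
      · show r / t < h
        rw [div_lt_comm₀ ht0 hh]; exact ht.1
    · intro hs
      have hs0 : 0 < s := hr.trans hs.1
      refine ⟨r / s, ⟨div_lt_div_of_pos_left hr hs0 hs.2, (div_lt_one hs0).2 hs.1⟩, ?_⟩
      show r / (r / s) = s
      field_simp
  have hderiv : ∀ t ∈ Ioo (r / h) 1,
      HasDerivWithinAt (fun t : ℝ => r / t) (-r / t ^ 2) (Ioo (r / h) 1) t := by
    intro t ht
    have ht0 : t ≠ 0 := (hrh'.trans ht.1).ne'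
    have := ((hasDerivAt_inv ht0).const_mul r).hasDerivWithinAt (s := Ioo (r / h) 1)
    have h1 : -r / t ^ 2 = r * -(t ^ 2)⁻¹ := by rw [neg_div, mul_neg, div_eq_mul_inv]
    rw [h1]
    simpa only [div_eq_mul_inv] using this
  have hinj : InjOn (fun t : ℝ => r / t) (Ioo (r / h) 1) := by
    intro a ha b hb hab
    have ha0 : 0 < a := hrh'.trans ha.1
    have hb0 : 0 < b := hrh'.trans hb.1
    have : r / a = r / b := hab
    field_simp at this
    linarith
  have h1 := lintegral_image_eq_lintegral_abs_deriv_mul measurableSet_Ioo hderiv hinj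
    (fun s => (ENNReal.ofReal (r ^ (d - 1)))⁻¹ * (ρ s * ENNReal.ofReal (s ^ (d - 1))))
  rw [himage, lintegral_const_mul' _ _ (ENNReal.inv_ne_top.2
    (by simpa using pow_pos hr (d - 1)))] at h1
  rw [gENN, h1]
  refine setLIntegral_congr_fun measurableSet_Ioo fun t ht => ?_
  have ht0 : 0 < t := hrh'.trans ht.1
  have hd1 : t ^ d = t ^ (d - 1) * t := by
    rw [← pow_succ]; congr 1; omega
  have h2 : ENNReal.ofReal |-r / t ^ 2| * (ENNReal.ofReal (r ^ (d - 1)))⁻¹ *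
      ENNReal.ofReal ((r / t) ^ (d - 1)) =
      ENNReal.ofReal ((t ^ d)⁻¹) * ENNReal.ofReal (r / t) := by
    rw [← ENNReal.ofReal_inv_of_pos (by positivity), ← ENNReal.ofReal_mul (by positivity),
      ← ENNReal.ofReal_mul (by positivity), ← ENNReal.ofReal_mul (by positivity)]
    congr 1
    rw [neg_div, abs_neg, abs_of_pos (by positivity), hd1, div_pow]
    field_simp
  calc _ = (ENNReal.ofReal ((t ^ d)⁻¹) * ENNReal.ofReal (r / t)) * ρ (r / t) := by ring
    _ = _ := by rw [← h2]; ring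

/-- The heart of the inequality: the fundamental theorem of calculus on segments from the origin,
the duality of |·|_K and |·|_{K°}, and Tonelli's theorem on both sides of the substitution z = ty.
-/
theorem lintegral_mul_enorm_sub_le_of_contDiff (hd : d ≠ 0) (hK : IsSymmBody K)
    (hC : IsConvexOpenCone C) (hh : 0 < h) (hρ : Measurable ρ) {u : EuclideanSpace ℝ (Fin d) → ℝ}
    (hu : ContDiff ℝ 1 u) :
    ∫⁻ y in h • K ∩ C, ρ (gauge K y) * ‖u y - u 0‖ₑ ≤
      ∫⁻ y in h • K ∩ C, ENNReal.ofReal (gauge (polarBody K) (gradient u y)) *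
        gENN d ρ h (gauge K y) := by
  have hQm : MeasurableSet (h • K ∩ C) := (hC.isOpen_sector hK hh).measurableSet
  have hgc := hK.continuous_gauge
  have hc := continuous_gradient hu
  have hP : Continuous fun z => gauge (polarBody K) (gradient u z) :=
    hK.continuous_gauge_polarBody.comp hc
  set P : EuclideanSpace ℝ (Fin d) → ℝ≥0∞ :=
    fun z => ENNReal.ofReal (gauge (polarBody K) (gradient u z)) with hPd
  have hPm : Measurable P := hP.measurable.ennreal_ofReal
  -- For z in the cone and t > 0 this says that z/t still lies in hK; it records the image of the
  -- sector under y ↦ ty.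
  set D : Set (EuclideanSpace ℝ (Fin d) × ℝ) := {z | gauge K z.1 < z.2 * h} with hD
  have hDm : MeasurableSet D := by
    refine measurableSet_lt (hgc.measurable.comp measurable_fst) (measurable_snd.mul_const h)
  set J : EuclideanSpace ℝ (Fin d) × ℝ → ℝ≥0∞ := D.indicator fun z =>
    ENNReal.ofReal ((z.2 ^ d)⁻¹) * (ρ (gauge K z.1 / z.2) * ENNReal.ofReal (gauge K z.1 / z.2)) *
      P z.1 with hJ
  have hJm : Measurable J := by
    refine Measurable.indicator ?_ hDm
    have h1 : Measurable fun z : EuclideanSpace ℝ (Fin d) × ℝ => gauge K z.1 / z.2 :=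
      (hgc.measurable.comp measurable_fst).div measurable_snd
    exact (((measurable_snd.pow_const d).inv.ennreal_ofReal).mul
      ((hρ.comp h1).mul h1.ennreal_ofReal)).mul (hPm.comp measurable_fst)
  calc ∫⁻ y in h • K ∩ C, ρ (gauge K y) * ‖u y - u 0‖ₑ
      ≤ ∫⁻ y in h • K ∩ C, ∫⁻ t in Ioo (0 : ℝ) 1,
          ρ (gauge K y) * ENNReal.ofReal (gauge K y) * P (t • y) := by
        refine lintegral_mono fun y => ?_
        have hm : Measurable fun t : ℝ => P (t • y) := hPm.comp (by fun_prop)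
        rw [lintegral_const_mul _ hm, mul_assoc, ← lintegral_const_mul _ hm]
        gcongr
        refine (enorm_sub_le_lintegral_gradient hu 0 y).trans (lintegral_mono fun t => ?_)
        rw [zero_add, sub_zero, Real.enorm_eq_ofReal_abs, hPd,
          ← ENNReal.ofReal_mul (gauge_nonneg _), mul_comm]
        exact ENNReal.ofReal_le_ofReal (hK.abs_inner_le _ _)
    _ = ∫⁻ t in Ioo (0 : ℝ) 1, ∫⁻ y in h • K ∩ C,
          ρ (gauge K y) * ENNReal.ofReal (gauge K y) * P (t • y) := by
        refine lintegral_lintegral_swap (Measurable.aemeasurable ?_)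
        have h1 : Measurable fun z : EuclideanSpace ℝ (Fin d) × ℝ => gauge K z.1 :=
          hgc.measurable.comp measurable_fst
        have h2 : Measurable fun z : EuclideanSpace ℝ (Fin d) × ℝ => z.2 • z.1 := by fun_prop
        exact ((hρ.comp h1).mul h1.ennreal_ofReal).mul (hPm.comp h2)
    _ = ∫⁻ t in Ioo (0 : ℝ) 1, ∫⁻ z in h • K ∩ C, J (z, t) := by
        refine setLIntegral_congr_fun measurableSet_Ioo fun t ht => ?_
        have h1 : Measurable fun z : EuclideanSpace ℝ (Fin d) => gauge K z / t :=
          hgc.measurable.div_const t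
        have h2 : Measurable fun z : EuclideanSpace ℝ (Fin d) =>
            ρ (gauge K z / t) * ENNReal.ofReal (gauge K z / t) * P z :=
          ((hρ.comp h1).mul h1.ennreal_ofReal).mul hPm
        have h3 := setLIntegral_homothety h2 hQm 0 ht.1
        simp only [zero_add, sub_zero] at h3
        have h4 : ∀ y, gauge K (t • y) / t = gauge K y := by
          intro y
          rw [hK.gauge_smul ht.1.le, mul_div_cancel_left₀ _ ht.1.ne']
        simp only [h4] at h3
        have h5 : {z : EuclideanSpace ℝ (Fin d) | t⁻¹ • z ∈ h • K ∩ C} =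
            {z | gauge K z < t * h} ∩ (h • K ∩ C) := by
          ext z
          show t⁻¹ • z ∈ h • K ∩ C ↔ z ∈ {z | gauge K z < t * h} ∧ z ∈ h • K ∩ C
          rw [hC.mem_smul_inter_iff hK hh, hC.mem_smul_inter_iff hK hh, hC.smul_mem_iff (inv_pos.2 ht.1), mem_ofPred_eq,
            hK.gauge_smul (inv_nonneg.2 ht.1.le), inv_mul_lt_iff₀ ht.1]
          constructor
          · rintro ⟨h6, h7⟩
            exact ⟨h6, by nlinarith [ht.2], h7⟩
          · rintro ⟨h6, -, h7⟩
            exact ⟨h6, h7⟩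
        have h6 : MeasurableSet {z : EuclideanSpace ℝ (Fin d) | gauge K z < t * h} :=
          measurableSet_lt hgc.measurable measurable_const
        show ∫⁻ y in h • K ∩ C, ρ (gauge K y) * ENNReal.ofReal (gauge K y) * P (t • y) =
          ∫⁻ z in h • K ∩ C, J (z, t)
        rw [h3, h5, ← Measure.restrict_restrict h6, ← lintegral_indicator h6,
          ← lintegral_const_mul _ (h2.indicator h6)]
        refine lintegral_congr fun z => ?_
        by_cases hz : gauge K z < t * h
        · have hz1 : (z, t) ∈ D := hz
          rw [indicator_of_mem (show z ∈ {z | gauge K z < t * h} from hz), hJ,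
            indicator_of_mem hz1]
          ring
        · have hz1 : (z, t) ∉ D := hz
          rw [indicator_of_notMem (show z ∉ {z | gauge K z < t * h} from hz), hJ,
            indicator_of_notMem hz1, mul_zero]
    _ = ∫⁻ z in h • K ∩ C, ∫⁻ t in Ioo (0 : ℝ) 1, J (z, t) := by
        refine lintegral_lintegral_swap (Measurable.aemeasurable ?_)
        exact hJm.comp measurable_swap
    _ ≤ _ := by
        refine setLIntegral_mono_ae' hQm (Eventually.of_forall fun z hz => ?_)
        have hzh := ((hC.mem_smul_inter_iff hK hh).1 hz).1
        -- When |z|_K = 0, the factor |z|_K/t makes `J` vanish, even where ρ is infinite.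
        rcases (gauge_nonneg (s := K) z).eq_or_lt with hz0 | hz0
        · have : ∀ t, J (z, t) = 0 := by
            intro t
            simp only [hJ, indicator_apply, ← hz0, zero_div, ENNReal.ofReal_zero, mul_zero,
              zero_mul, ite_self]
          simp [this]
        · rw [← lintegral_ray_eq_gENN hd hz0 hzh, mul_comm, ← lintegral_mul_const'' _
            (Measurable.aemeasurable ?_)]
          · rw [← lintegral_indicator measurableSet_Ioo, ← lintegral_indicator measurableSet_Ioo]
            refine lintegral_mono fun t => ?_
            by_cases ht : t ∈ Ioo (0 : ℝ) 1
            · rw [indicator_of_mem ht, hJ]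
              by_cases hzt : gauge K z < t * h
              · have hz1 : (z, t) ∈ D := hzt
                rw [indicator_of_mem hz1, indicator_of_mem]
                exact ⟨by rwa [div_lt_iff₀ hh], ht.2⟩
              · have hz1 : (z, t) ∉ D := hzt
                rw [indicator_of_notMem hz1]; exact zero_le
            · rw [indicator_of_notMem ht]; exact zero_le
          · have h1 : Measurable fun t : ℝ => gauge K z / t := by fun_prop
            exact ((measurable_id.pow_const d).inv.ennreal_ofReal).mul
              ((hρ.comp h1).mul h1.ennreal_ofReal)

theorem measurable_gENN (hρ : Measurable ρ) : Measurable (gENN d ρ h) := by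
  refine Measurable.mul (by fun_prop) ?_
  have h1 : (fun r => ∫⁻ s in Ioo r h, ρ s * ENNReal.ofReal (s ^ (d - 1))) = fun r =>
      ∫⁻ s, {z : ℝ × ℝ | z.1 < z.2 ∧ z.2 < h}.indicator
        (fun z => ρ z.2 * ENNReal.ofReal (z.2 ^ (d - 1))) (r, s) := by
    ext1 r
    rw [← lintegral_indicator measurableSet_Ioo]
    rfl
  rw [h1]
  refine Measurable.lintegral_prod_right' (Measurable.indicator ?_ ?_)
  · exact (hρ.comp measurable_snd).mul (measurable_snd.pow_const _).ennreal_ofReal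
  · exact (measurableSet_lt measurable_fst measurable_snd).inter
      (measurableSet_lt measurable_snd measurable_const)

theorem gENN_mono {ρ₁ ρ₂ : ℝ → ℝ≥0∞} (hρ : ∀ s, ρ₁ s ≤ ρ₂ s) (r : ℝ) :
    gENN d ρ₁ h r ≤ gENN d ρ₂ h r := by
  unfold gENN
  gcongr with s
  exact hρ s

theorem gENN_congr {ρ₁ ρ₂ : ℝ → ℝ≥0∞} (hρ : ρ₁ =ᵐ[volume.restrict (Ioo 0 h)] ρ₂) {r : ℝ}
    (hr : 0 ≤ r) : gENN d ρ₁ h r = gENN d ρ₂ h r := by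
  unfold gENN
  congr 1
  refine lintegral_congr_ae ?_
  filter_upwards [ae_restrict_of_ae_restrict_of_subset (Ioo_subset_Ioo_left hr) hρ] with s hs
  rw [hs]

/-- If ρ(s)s^{d-1} is integrable up to the origin, then g(r) is at most a constant times r^{-(d-1)}.
The radial integral is then bounded by that of r^{-(d-1)(q-1)}, which converges. -/
theorem lintegral_gENN_rpow_lt_top (hd : d ≠ 0) (hK : IsSymmBody K) (hC : IsConvexOpenCone C)
    (hh : 0 < h) (hρ : Measurable ρ)
    (hρi : ∫⁻ s in Ioo 0 h, ρ s * ENNReal.ofReal (s ^ (d - 1)) ≠ ⊤) {q : ℝ} (hq : 0 ≤ q)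
    (hq' : (d - 1 : ℝ) * (q - 1) < 1) :
    ∫⁻ y in h • K ∩ C, gENN d ρ h (gauge K y) ^ q < ⊤ := by
  set J := ∫⁻ s in Ioo 0 h, ρ s * ENNReal.ofReal (s ^ (d - 1)) with hJ
  have hm : volume (K ∩ C) ≠ ⊤ := (hC.volume_inter_lt_top hK).ne
  rw [lintegral_comp_gauge hd hK hC hh (φ := fun r => gENN d ρ h r ^ q)
    ((measurable_gENN hρ).pow_const _).aemeasurable]
  refine ENNReal.mul_lt_top (ENNReal.mul_lt_top (by simp) hm.lt_top) ?_
  calc ∫⁻ r in Ioo 0 h, ENNReal.ofReal (r ^ (d - 1)) * gENN d ρ h r ^ q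
      ≤ ∫⁻ r in Ioo 0 h, J ^ q * ENNReal.ofReal (r ^ (-((d - 1 : ℝ) * (q - 1)))) := by
        refine setLIntegral_mono_ae' measurableSet_Ioo (Eventually.of_forall fun r hr => ?_)
        have h1 : gENN d ρ h r ≤ (ENNReal.ofReal (r ^ (d - 1)))⁻¹ * J := by
          unfold gENN
          gcongr
          exact lintegral_mono_set (Ioo_subset_Ioo_left hr.1.le)
        have hrd : 0 < r ^ (d - 1) := pow_pos hr.1 _
        calc _ ≤ ENNReal.ofReal (r ^ (d - 1)) * ((ENNReal.ofReal (r ^ (d - 1)))⁻¹ * J) ^ q := by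
              gcongr
          _ = J ^ q * ENNReal.ofReal (r ^ (d - 1) * ((r ^ (d - 1))⁻¹) ^ q) := by
              rw [ENNReal.mul_rpow_of_nonneg _ _ hq, ← ENNReal.ofReal_inv_of_pos hrd,
                ENNReal.ofReal_rpow_of_nonneg (by positivity) hq,
                ENNReal.ofReal_mul hrd.le]
              ring
          _ = _ := by
              congr 2
              rw [← Real.rpow_natCast, ← Real.rpow_neg hr.1.le, ← Real.rpow_mul hr.1.le,
                ← Real.rpow_add hr.1, Nat.cast_sub (Nat.one_le_iff_ne_zero.2 hd)]
              congr 1; push_cast; ring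
    _ < ⊤ := by
        rw [lintegral_const_mul _ (by fun_prop)]
        refine ENNReal.mul_lt_top (ENNReal.rpow_lt_top_of_nonneg hq hρi) ?_
        exact lintegral_Ioo_rpow_lt_top (by linarith) h

/-- Replacing ∇u_n by G changes the right side by at most L‖∇u_n - G‖_p ‖g(|·|_K)‖_q, and the last
norm is finite by `lintegral_gENN_rpow_lt_top`. The left side passes to the limit by Fatou's lemma;
the uniform convergence on the closure includes the value at the origin. -/
theorem lintegral_mul_enorm_sub_le_of_integrable (hd : d ≠ 0) (hK : IsSymmBody K)
    (hC : IsConvexOpenCone C) (hh : 0 < h) (hρ : Measurable ρ)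
    (hρi : ∫⁻ s in Ioo 0 h, ρ s * ENNReal.ofReal (s ^ (d - 1)) ≠ ⊤) {p : ℝ≥0∞}
    (hpd : (d : ℝ≥0∞) < p) (hp : p ≠ ⊤) {u : ℕ → EuclideanSpace ℝ (Fin d) → ℝ}
    {F : EuclideanSpace ℝ (Fin d) → ℝ} {G : EuclideanSpace ℝ (Fin d) → EuclideanSpace ℝ (Fin d)}
    (hu : ∀ n, ContDiff ℝ 1 (u n)) (huF : TendstoUniformlyOn u F atTop (closure (h • K ∩ C)))
    (hG : AEStronglyMeasurable G (volume.restrict (h • K ∩ C)))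
    (huG : Tendsto (fun n => eLpNorm (gradient (u n) - G) p (volume.restrict (h • K ∩ C)))
      atTop (𝓝 0)) :
    ∫⁻ y in h • K ∩ C, ρ (gauge K y) * ‖F y - F 0‖ₑ ≤
      ∫⁻ y in h • K ∩ C, ENNReal.ofReal (gauge (polarBody K) (G y)) *
        gENN d ρ h (gauge K y) := by
  have hQm : MeasurableSet (h • K ∩ C) := (hC.isOpen_sector hK hh).measurableSet
  have hgc := hK.continuous_gauge
  obtain ⟨L, hL⟩ := hK.exists_gauge_polarBody_le
  have hd1 : (1 : ℝ) ≤ d := by exact_mod_cast Nat.one_le_iff_ne_zero.2 hd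
  have hdp : (d : ℝ) < p.toReal := by
    rw [← ENNReal.toReal_natCast d]; exact ENNReal.toReal_strict_mono hp hpd
  have hconj := Real.HolderConjugate.conjExponent (hd1.trans_lt hdp)
  set q := Real.conjExponent p.toReal with hq
  -- For conjugate exponents q - 1 = 1/(p - 1), so this is the condition d < p.
  have hq' : (d - 1 : ℝ) * (q - 1) < 1 := by
    rw [hq, Real.conjExponent, div_sub_one (by linarith), mul_div_assoc', div_lt_one (by linarith)]
    linarith
  have hgm : Measurable fun y => gENN d ρ h (gauge K y) :=
    (measurable_gENN hρ).comp hgc.measurable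
  set B := (∫⁻ y in h • K ∩ C, gENN d ρ h (gauge K y) ^ q) ^ (1 / q) with hB
  have hBt : B ≠ ⊤ := ENNReal.rpow_ne_top_of_nonneg (by have := hconj.symm.pos; positivity)
    (lintegral_gENN_rpow_lt_top hd hK hC hh hρ hρi hconj.symm.nonneg hq').ne
  set I := ∫⁻ y in h • K ∩ C, ENNReal.ofReal (gauge (polarBody K) (G y)) *
        gENN d ρ h (gauge K y) with hI
  have hbound : ∀ n, ∫⁻ y in h • K ∩ C, ρ (gauge K y) * ‖u n y - u n 0‖ₑ ≤
      I + L * eLpNorm (gradient (u n) - G) p (volume.restrict (h • K ∩ C)) * B := by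
    intro n
    have hDm : AEStronglyMeasurable (gradient (u n) - G) (volume.restrict (h • K ∩ C)) :=
      (continuous_gradient (hu n)).aestronglyMeasurable.sub hG
    refine (lintegral_mul_enorm_sub_le_of_contDiff hd hK hC hh hρ (hu n)).trans ?_
    calc ∫⁻ y in h • K ∩ C, ENNReal.ofReal (gauge (polarBody K) (gradient (u n) y)) *
          gENN d ρ h (gauge K y)
        ≤ ∫⁻ y in h • K ∩ C, (ENNReal.ofReal (gauge (polarBody K) (G y)) *
            gENN d ρ h (gauge K y) + L * (‖(gradient (u n) - G) y‖ₑ * gENN d ρ h (gauge K y))) := by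
          refine lintegral_mono fun y => ?_
          rw [← mul_assoc, ← add_mul]
          gcongr
          have h1 := hK.gauge_polarBody_add_le (G y) ((gradient (u n) - G) y)
          rw [Pi.sub_apply, add_sub_cancel] at h1
          have h2 := hL ((gradient (u n) - G) y)
          rw [Pi.sub_apply] at h2
          calc _ ≤ ENNReal.ofReal (gauge (polarBody K) (G y) + L * ‖gradient (u n) y - G y‖) :=
                ENNReal.ofReal_le_ofReal (by linarith)
            _ = _ := by
                rw [ENNReal.ofReal_add (gauge_nonneg _) (by positivity),
                  ENNReal.ofReal_mul L.coe_nonneg, ofReal_norm, ENNReal.ofReal_coe_nnreal,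
                  Pi.sub_apply]
      _ = I + L * ∫⁻ y in h • K ∩ C, ‖(gradient (u n) - G) y‖ₑ * gENN d ρ h (gauge K y) := by
          have h3 : AEMeasurable (fun y => ‖(gradient (u n) - G) y‖ₑ * gENN d ρ h (gauge K y))
            (volume.restrict (h • K ∩ C)) := hDm.enorm.mul hgm.aemeasurable
          rw [lintegral_add_right' _ (h3.const_mul _), lintegral_const_mul'' _ h3]
      _ ≤ _ := by
          rw [mul_assoc]
          gcongr
          have h3 := ENNReal.lintegral_mul_le_Lp_mul_Lq (volume.restrict (h • K ∩ C)) hconj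
            hDm.enorm hgm.aemeasurable
          rwa [eLpNorm_eq_lintegral_rpow_enorm_toReal
            (by rintro rfl; simp at hpd) hp]
  have hlim : Tendsto (fun n => I + L *
      eLpNorm (gradient (u n) - G) p (volume.restrict (h • K ∩ C)) * B) atTop (𝓝 I) := by
    have h1 := ENNReal.Tendsto.mul_const (b := B) (ENNReal.Tendsto.const_mul (a := (L : ℝ≥0∞)) huG
      (Or.inr ENNReal.coe_ne_top)) (Or.inr hBt)
    simpa using tendsto_const_nhds.add h1
  have h0 := hC.zero_mem_closure_sector hK hh
  calc ∫⁻ y in h • K ∩ C, ρ (gauge K y) * ‖F y - F 0‖ₑ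
      ≤ ∫⁻ y in h • K ∩ C, liminf (fun n => ρ (gauge K y) * ‖u n y - u n 0‖ₑ) atTop := by
        refine setLIntegral_mono_ae' hQm (Eventually.of_forall fun y hy => ?_)
        have h1 : Tendsto (fun n => ‖u n y - u n 0‖ₑ) atTop (𝓝 ‖F y - F 0‖ₑ) :=
          (((huF.tendsto_at (subset_closure hy)).sub (huF.tendsto_at h0))).enorm
        -- Multiplication by ρ, possibly infinite, is discontinuous at 0, so a vanishing limit is
        -- treated apart.
        rcases eq_or_ne ‖F y - F 0‖ₑ 0 with h2 | h2
        · rw [h2, mul_zero]; exact zero_le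
        · exact (ENNReal.Tendsto.const_mul h1 (Or.inl h2)).liminf_eq.ge
    _ ≤ liminf (fun n => ∫⁻ y in h • K ∩ C, ρ (gauge K y) * ‖u n y - u n 0‖ₑ) atTop := by
        refine lintegral_liminf_le fun n => ?_
        have := (hu n).continuous
        exact (hρ.comp hgc.measurable).mul (by fun_prop)
    _ ≤ liminf (fun n => I + L *
          eLpNorm (gradient (u n) - G) p (volume.restrict (h • K ∩ C)) * B) atTop :=
        liminf_le_liminf (Eventually.of_forall hbound)
    _ = I := hlim.liminf_eq

/-- The weight is cut off near the origin. Each truncation satisfies the integrable case, with a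
right side dominated by that of ρ, and Fatou's lemma removes the truncation. -/
theorem lintegral_mul_enorm_sub_le (hd : d ≠ 0) (hK : IsSymmBody K)
    (hC : IsConvexOpenCone C) (hh : 0 < h) (hρ : Measurable ρ)
    (hρi : ∀ r ∈ Ioo 0 h, ∫⁻ s in Ioo r h, ρ s * ENNReal.ofReal (s ^ (d - 1)) ≠ ⊤) {p : ℝ≥0∞}
    (hpd : (d : ℝ≥0∞) < p) (hp : p ≠ ⊤) {f F : EuclideanSpace ℝ (Fin d) → ℝ}
    {G : EuclideanSpace ℝ (Fin d) → EuclideanSpace ℝ (Fin d)}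
    (hfG : IsWeakGradient (h • K ∩ C) f G) (hf : MemLp f p (volume.restrict (h • K ∩ C)))
    (hG : MemLp G p (volume.restrict (h • K ∩ C))) (hF : IsContRep (h • K ∩ C) f F) :
    ∫⁻ y in h • K ∩ C, ρ (gauge K y) * ‖F y - F 0‖ₑ ≤
      ∫⁻ y in h • K ∩ C, ENNReal.ofReal (gauge (polarBody K) (G y)) *
        gENN d ρ h (gauge K y) := by
  have hQo := hC.isOpen_sector hK hh
  have hgc := hK.continuous_gauge
  have hp1 : 1 ≤ p := by
    refine le_trans ?_ hpd.le
    exact_mod_cast Nat.one_le_iff_ne_zero.2 hd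
  obtain ⟨u, F', hu, huF, hF', huG⟩ := hfG.exists_tendstoUniformlyOn hQo (hC.convex_sector hK h)
    (hC.isBounded_sector hK h) (hC.nonempty_sector hK hh) hpd hp1 hp hf hG
  -- Two continuous representatives agree on the open sector, hence on its closure; in particular
  -- F(θ) is the limit of u_n(θ).
  have hFF : EqOn F F' (closure (h • K ∩ C)) := by
    have h1 : EqOn F F' (h • K ∩ C) :=
      Measure.eqOn_open_of_ae_eq (hF.2.trans hF'.2.symm) hQo (hF.1.mono subset_closure)
        (hF'.1.mono subset_closure)
    exact h1.of_subset_closure hF.1 hF'.1 subset_closure Subset.rfl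
  have h0 := hC.zero_mem_closure_sector hK hh
  set a : ℕ → ℝ := fun k => h / (k + 2) with ha
  have ha0 : ∀ k, 0 < a k := fun k => by positivity
  have hah : ∀ k, a k < h := fun k => by
    rw [ha, div_lt_iff₀ (by positivity)]; nlinarith [k.cast_nonneg (α := ℝ)]
  have hat : Tendsto a atTop (𝓝 0) := by
    refine tendsto_const_nhds.div_atTop ?_
    exact tendsto_atTop_add_const_right _ _ tendsto_natCast_atTop_atTop
  set ρk : ℕ → ℝ → ℝ≥0∞ := fun k => (Ioi (a k)).indicator ρ with hρk
  have hρkm : ∀ k, Measurable (ρk k) := fun k => hρ.indicator measurableSet_Ioi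
  have hρkle : ∀ k s, ρk k s ≤ ρ s := fun k s => indicator_le_self _ _ _
  have hρki : ∀ k, ∫⁻ s in Ioo 0 h, ρk k s * ENNReal.ofReal (s ^ (d - 1)) ≠ ⊤ := by
    intro k
    refine ne_top_of_le_ne_top (hρi (a k) ⟨ha0 k, hah k⟩) ?_
    rw [← lintegral_indicator measurableSet_Ioo, ← lintegral_indicator measurableSet_Ioo]
    refine lintegral_mono fun s => ?_
    by_cases hs : s ∈ Ioo (a k) h
    · rw [indicator_of_mem hs]
      refine (indicator_le_self _ _ _).trans ?_
      gcongr
      exact hρkle k s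
    · rw [indicator_of_notMem hs]
      by_cases hs0 : s ∈ Ioo 0 h
      · have : s ∉ Ioi (a k) := fun h => hs ⟨h, hs0.2⟩
        rw [indicator_of_mem hs0]
        simp only [hρk, indicator_of_notMem this, zero_mul, le_refl]
      · rw [indicator_of_notMem hs0]
  have hk : ∀ k, ∫⁻ y in h • K ∩ C, ρk k (gauge K y) * ‖F' y - F' 0‖ₑ ≤
      ∫⁻ y in h • K ∩ C, ENNReal.ofReal (gauge (polarBody K) (G y)) *
        gENN d ρ h (gauge K y) := by
    intro k
    refine (lintegral_mul_enorm_sub_le_of_integrable hd hK hC hh (hρkm k) (hρki k) hpd hp hu huF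
      hG.aestronglyMeasurable huG).trans (lintegral_mono fun y => ?_)
    gcongr
    exact gENN_mono (hρkle k) _
  have hF'm : AEMeasurable (fun y => ‖F' y - F' 0‖ₑ) (volume.restrict (h • K ∩ C)) :=
    (((hF'.1.mono subset_closure).aemeasurable hQo.measurableSet).sub_const _).enorm
  calc ∫⁻ y in h • K ∩ C, ρ (gauge K y) * ‖F y - F 0‖ₑ
      ≤ ∫⁻ y in h • K ∩ C, liminf (fun k => ρk k (gauge K y) * ‖F' y - F' 0‖ₑ) atTop := by
        refine setLIntegral_mono_ae' hQo.measurableSet (Eventually.of_forall fun y hy => ?_)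
        rw [hFF (subset_closure hy), hFF h0]
        -- At the origin the truncated weights never recover ρ, but there F(y) - F(θ) = 0.
        rcases (gauge_nonneg (s := K) y).eq_or_lt with hy0 | hy0
        · have : y = 0 := by
            by_contra hne
            exact (hK.gauge_pos_iff.2 hne).ne hy0
          simp [this]
        · refine le_liminf_of_le (by isBoundedDefault) ?_
          filter_upwards [hat.eventually_lt_const hy0] with k hk
          simp only [hρk, indicator_of_mem (show gauge K y ∈ Ioi (a k) from hk), le_refl]
    _ ≤ liminf (fun k => ∫⁻ y in h • K ∩ C, ρk k (gauge K y) * ‖F' y - F' 0‖ₑ) atTop :=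
        lintegral_liminf_le' fun k => (((hρkm k).comp hgc.measurable).aemeasurable).mul hF'm
    _ ≤ _ := by
        refine (liminf_le_liminf (Eventually.of_forall hk)).trans ?_
        rw [liminf_const]

end

/-! ### Real weights, uniqueness of weak gradients, and the inequality (*) -/

section

variable {d : ℕ} {K C : Set (EuclideanSpace ℝ (Fin d))} {h : ℝ} {w : ℝ → ℝ} {p q : ℝ≥0∞}

/-- Non-negative weights such that `w(t) t^{d-1}` is integrable away from the origin. -/
structure IsRadialWeight (d : ℕ) (h : ℝ) (w : ℝ → ℝ) : Prop where
  nonneg : ∀ t ∈ Ioc 0 h, 0 ≤ w t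
  integrableOn : ∀ u ∈ Ioo 0 h, IntegrableOn (fun t => w t * t ^ (d - 1)) (Ioo u h)

theorem iUnion_Ioo_div (hh : 0 < h) : ⋃ n : ℕ, Ioo (h / (n + 2)) h = Ioo 0 h := by
  ext t
  rw [mem_iUnion]
  constructor
  · rintro ⟨n, hn⟩
    exact ⟨lt_trans (by positivity) hn.1, hn.2⟩
  · intro ht
    obtain ⟨n, hn⟩ := exists_nat_gt (h / t)
    refine ⟨n, ?_, ht.2⟩
    rw [div_lt_comm₀ (by positivity) ht.1]
    linarith

theorem div_add_two_mem_Ioo (hh : 0 < h) (n : ℕ) : h / ((n : ℝ) + 2) ∈ Ioo 0 h := by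
  refine ⟨by positivity, ?_⟩
  rw [div_lt_iff₀ (by positivity)]; nlinarith [n.cast_nonneg (α := ℝ)]

theorem isRadialWeight_of_memRadialL_one (hw0 : ∀ t ∈ Ioc 0 h, 0 ≤ w t)
    (hw : ∀ u ∈ Ioo 0 h, MemRadialL d 1 u h w) : IsRadialWeight d h w := by
  refine ⟨hw0, fun u hu => ⟨?_, ?_⟩⟩
  · exact ((hw u hu).2.1.mul (by fun_prop)).aestronglyMeasurable
  · have h1 := (hw u hu).2.2
    simp only [radialNorm, ENNReal.one_ne_top, if_false, ENNReal.toReal_one, Real.rpow_one,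
      div_one, ENNReal.rpow_one] at h1
    rw [hasFiniteIntegral_iff_enorm]
    refine lt_of_le_of_lt (le_of_eq ?_) h1
    refine setLIntegral_congr_fun measurableSet_Ioo fun t ht => ?_
    have ht0 : 0 < t := hu.1.trans ht.1
    have := hw0 t ⟨ht0, ht.2.le⟩
    show ‖w t * t ^ (d - 1)‖ₑ = ENNReal.ofReal (t ^ (d - 1) * w t)
    rw [Real.enorm_eq_ofReal (by positivity), mul_comm]

theorem MemW.isRadialWeight (hw : MemW d q h w) : IsRadialWeight d h w :=
  isRadialWeight_of_memRadialL_one hw.1 hw.2.1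

namespace IsRadialWeight

theorem aemeasurable (hw : IsRadialWeight d h w) (hh : 0 < h) :
    AEMeasurable w (volume.restrict (Ioo 0 h)) := by
  rw [← iUnion_Ioo_div hh, aemeasurable_iUnion_iff]
  intro n
  have hn := div_add_two_mem_Ioo hh n
  have h1 : AEMeasurable (fun t => (w t * t ^ (d - 1)) * (t ^ (d - 1))⁻¹)
      (volume.restrict (Ioo (h / ((n : ℝ) + 2)) h)) :=
    (hw.integrableOn _ hn).aestronglyMeasurable.aemeasurable.mul (by fun_prop)
  refine h1.congr ?_
  filter_upwards [ae_restrict_mem measurableSet_Ioo] with t ht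
  have : 0 < t := hn.1.trans ht.1
  field_simp

theorem integrableOn_Icc (hw : IsRadialWeight d h w) {u : ℝ} (hu : u ∈ Ioo 0 h) :
    IntegrableOn (fun t => w t * t ^ (d - 1)) (Icc u h) :=
  (integrableOn_Icc_iff_integrableOn_Ioo enorm_ne_top enorm_ne_top).2 (hw.integrableOn u hu)

theorem mul_pow_nonneg (hw : IsRadialWeight d h w) {t : ℝ} (ht : t ∈ Ioc 0 h) :
    0 ≤ w t * t ^ (d - 1) := by
  have := hw.nonneg t ht
  have := ht.1
  positivity

theorem gFun_nonneg (hw : IsRadialWeight d h w) {u : ℝ} (hu : u ∈ Ioc 0 h) :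
    0 ≤ gFun d w h u := by
  have := hu.1
  refine mul_nonneg (by positivity) (intervalIntegral.integral_nonneg hu.2 fun t ht => ?_)
  exact hw.mul_pow_nonneg ⟨hu.1.trans_le ht.1, ht.2⟩

theorem continuousOn_gFun (hw : IsRadialWeight d h w) : ContinuousOn (gFun d w h) (Ioc 0 h) := by
  have h1 : ContinuousOn (fun u => ∫ t in u..h, w t * t ^ (d - 1)) (Ioc 0 h) := by
    intro u hu
    rcases hu.2.eq_or_lt with rfl | huh
    · have hu2 : u / 2 ∈ Ioo 0 u := ⟨half_pos hu.1, half_lt_self hu.1⟩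
      have h2 := intervalIntegral.continuousOn_primitive_interval_left (μ := volume)
        (a := u / 2) (b := u) (f := fun t => w t * t ^ (d - 1))
        (by rw [uIcc_of_le hu2.2.le]; exact hw.integrableOn_Icc hu2)
      rw [uIcc_of_le hu2.2.le] at h2
      refine (h2 u ⟨hu2.2.le, le_rfl⟩).mono_of_mem_nhdsWithin ?_
      filter_upwards [self_mem_nhdsWithin, mem_nhdsWithin_of_mem_nhds (Ioi_mem_nhds hu2.2)]
        with x hx hx'
      exact ⟨(le_of_lt hx'), hx.2⟩
    · have hu2 : u / 2 ∈ Ioo 0 h := ⟨half_pos hu.1, (half_lt_self hu.1).trans huh⟩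
      have h2 := intervalIntegral.continuousOn_primitive_interval_left (μ := volume)
        (a := u / 2) (b := h) (f := fun t => w t * t ^ (d - 1))
        (by rw [uIcc_of_le hu2.2.le]; exact hw.integrableOn_Icc hu2)
      rw [uIcc_of_le hu2.2.le] at h2
      exact (h2.continuousAt (Icc_mem_nhds (half_lt_self hu.1) huh)).continuousWithinAt
  refine ContinuousOn.mul (continuousOn_const.div (by fun_prop) fun u hu => ?_) h1
  exact (pow_pos hu.1 _).ne'

theorem antitoneOn_gFun (hw : IsRadialWeight d h w) : AntitoneOn (gFun d w h) (Ioc 0 h) := by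
  intro a ha b hb hab
  rcases hab.eq_or_lt with rfl | hab'
  · exact le_rfl
  have haI : a ∈ Ioo 0 h := ⟨ha.1, hab'.trans_le hb.2⟩
  have hint := hw.integrableOn_Icc haI
  have h1 : ∫ t in b..h, w t * t ^ (d - 1) ≤ ∫ t in a..h, w t * t ^ (d - 1) := by
    rw [intervalIntegral.integral_of_le hb.2, intervalIntegral.integral_of_le ha.2]
    refine setIntegral_mono_set (hint.mono_set Ioc_subset_Icc_self) ?_
      (Ioc_subset_Ioc_left hab).eventuallyLE
    filter_upwards [ae_restrict_mem measurableSet_Ioc] with t ht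
    exact hw.mul_pow_nonneg ⟨ha.1.trans ht.1, ht.2⟩
  have h2 : 0 ≤ ∫ t in b..h, w t * t ^ (d - 1) :=
    intervalIntegral.integral_nonneg hb.2 fun t ht =>
      hw.mul_pow_nonneg ⟨hb.1.trans_le ht.1, ht.2⟩
  have ha0 := ha.1
  have : (0 : ℝ) < a ^ (d - 1) := by positivity
  unfold gFun
  gcongr

theorem gENN_eq (hw : IsRadialWeight d h w) {r : ℝ} (hr : r ∈ Ioo 0 h) :
    gENN d (fun t => ENNReal.ofReal (w t)) h r = ENNReal.ofReal (gFun d w h r) := by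
  have hr0 : 0 < r ^ (d - 1) := pow_pos hr.1 _
  rw [gENN, gFun, ENNReal.ofReal_mul (by positivity), one_div, ENNReal.ofReal_inv_of_pos hr0,
    intervalIntegral.integral_of_le hr.2.le, integral_Ioc_eq_integral_Ioo,
    ofReal_integral_eq_lintegral_ofReal (hw.integrableOn r hr)]
  · congr 1
    refine setLIntegral_congr_fun measurableSet_Ioo fun t ht => ?_
    exact (ENNReal.ofReal_mul (hw.nonneg t ⟨hr.1.trans ht.1, ht.2.le⟩)).symm
  · filter_upwards [ae_restrict_mem measurableSet_Ioo] with t ht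
    exact hw.mul_pow_nonneg ⟨hr.1.trans ht.1, ht.2.le⟩

theorem aemeasurable_gFun (hw : IsRadialWeight d h w) :
    AEMeasurable (gFun d w h) (volume.restrict (Ioo 0 h)) :=
  (hw.continuousOn_gFun.mono Ioo_subset_Ioc_self).aemeasurable measurableSet_Ioo

theorem eLpNorm_gFun_comp_gauge (hw : IsRadialWeight d h w) (hd : d ≠ 0) (hK : IsSymmBody K)
    (hC : IsConvexOpenCone C) (hh : 0 < h) (hq0 : q ≠ 0) (hq : q ≠ ⊤) :
    eLpNorm (fun y => gFun d w h (gauge K y)) q (volume.restrict (h • K ∩ C)) =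
      (d * volume (K ∩ C)) ^ (1 / q.toReal) * radialNorm d q 0 h (gFun d w h) := by
  have hqp : 0 < q.toReal := ENNReal.toReal_pos hq0 hq
  rw [eLpNorm_eq_lintegral_rpow_enorm_toReal hq0 hq, radialNorm, if_neg hq,
    ← ENNReal.mul_rpow_of_nonneg _ _ (by positivity),
    lintegral_comp_gauge hd hK hC hh (φ := fun r => ‖gFun d w h r‖ₑ ^ q.toReal)
      (hw.aemeasurable_gFun.enorm.pow_const _)]
  congr 2
  refine setLIntegral_congr_fun measurableSet_Ioo fun t ht => ?_
  have h1 := hw.gFun_nonneg (Ioo_subset_Ioc_self ht)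
  have := ht.1
  show ENNReal.ofReal (t ^ (d - 1)) * ‖gFun d w h t‖ₑ ^ q.toReal =
    ENNReal.ofReal (t ^ (d - 1) * gFun d w h t ^ q.toReal)
  rw [ENNReal.ofReal_mul (by positivity), Real.enorm_eq_ofReal h1,
    ENNReal.ofReal_rpow_of_nonneg h1 hqp.le]

/-- Puts the constant into the form in which Hölder's inequality on the sector produces it. -/
theorem ostrowskiConst_eq (hw : IsRadialWeight d h w) (hd : d ≠ 0) (hK : IsSymmBody K)
    (hC : IsConvexOpenCone C) (hh : 0 < h) (hq0 : q ≠ 0) (hq : q ≠ ⊤) :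
    ostrowskiConst q K C h w =
      (eLpNorm (fun y => gFun d w h (gauge K y)) q (volume.restrict (h • K ∩ C))).toReal := by
  rw [hw.eLpNorm_gFun_comp_gauge hd hK hC hh hq0 hq, ostrowskiConst, ENNReal.toReal_mul,
    ← ENNReal.toReal_rpow, ENNReal.toReal_mul, ENNReal.toReal_natCast]

theorem aestronglyMeasurable_comp_gauge (hw : IsRadialWeight d h w) (hd : d ≠ 0)
    (hK : IsSymmBody K) (hC : IsConvexOpenCone C) (hh : 0 < h) :
    AEStronglyMeasurable (fun y => w (gauge K y)) (volume.restrict (h • K ∩ C)) :=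
  (hw.aemeasurable hh).aestronglyMeasurable.comp_quasiMeasurePreserving
    (quasiMeasurePreserving_gauge hd hK hC hh)

theorem gauge_mem_Ioo_ae (hd : d ≠ 0) (hK : IsSymmBody K) (hC : IsConvexOpenCone C) (hh : 0 < h) :
    ∀ᵐ y ∂volume.restrict (h • K ∩ C), gauge K y ∈ Ioo 0 h :=
  (quasiMeasurePreserving_gauge hd hK hC hh).ae (ae_restrict_mem measurableSet_Ioo)

/-- The weight is only almost everywhere measurable, so it is replaced by a Borel representative ρ;
neither `gENN` on (0, h) nor the integral over the sector notices the change. -/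
theorem lintegral_mul_enorm_sub_le (hw : IsRadialWeight d h w) (hd : d ≠ 0) (hK : IsSymmBody K)
    (hC : IsConvexOpenCone C) (hh : 0 < h)
    (hpd : (d : ℝ≥0∞) < p) (hp : p ≠ ⊤) {f F : EuclideanSpace ℝ (Fin d) → ℝ}
    {G : EuclideanSpace ℝ (Fin d) → EuclideanSpace ℝ (Fin d)}
    (hfG : IsWeakGradient (h • K ∩ C) f G) (hf : MemLp f p (volume.restrict (h • K ∩ C)))
    (hG : MemLp G p (volume.restrict (h • K ∩ C))) (hF : IsContRep (h • K ∩ C) f F) :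
    ∫⁻ y in h • K ∩ C, ‖w (gauge K y) * (F y - F 0)‖ₑ ≤
      ∫⁻ y in h • K ∩ C, ‖gauge (polarBody K) (G y) * gFun d w h (gauge K y)‖ₑ := by
  have hwm := (hw.aemeasurable hh).ennreal_ofReal
  obtain ⟨ρ, hρ, hρw⟩ := hwm
  have hqmp := quasiMeasurePreserving_gauge hd hK hC hh
  have hQ := gauge_mem_Ioo_ae hd hK hC hh
  have hgr : ∀ r ∈ Ioo 0 h, gENN d ρ h r = ENNReal.ofReal (gFun d w h r) := fun r hr => by
    rw [← hw.gENN_eq hr, gENN_congr hρw hr.1.le]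
  have h1 := Ostrowski.lintegral_mul_enorm_sub_le hd hK hC hh hρ (fun r hr => ?_) hpd hp hfG hf
    hG hF
  · calc ∫⁻ y in h • K ∩ C, ‖w (gauge K y) * (F y - F 0)‖ₑ
        = ∫⁻ y in h • K ∩ C, ρ (gauge K y) * ‖F y - F 0‖ₑ := by
          refine lintegral_congr_ae ?_
          filter_upwards [hqmp.ae hρw, hQ] with y hy hyQ
          rw [← hy, enorm_mul, Real.enorm_eq_ofReal (hw.nonneg _ (Ioo_subset_Ioc_self hyQ))]
      _ ≤ _ := h1
      _ = _ := by
          refine lintegral_congr_ae ?_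
          filter_upwards [hQ] with y hy
          rw [hgr _ hy, enorm_mul, Real.enorm_eq_ofReal (gauge_nonneg _),
            Real.enorm_eq_ofReal (hw.gFun_nonneg (Ioo_subset_Ioc_self hy))]
  -- Integrability of ρ away from the origin: otherwise `gENN` would be infinite at r, whereas it
  -- equals the finite g(r).
  · intro htop
    have h2 := hgr r hr
    rw [gENN, htop, ENNReal.mul_top (ENNReal.inv_ne_zero.2 ENNReal.ofReal_ne_top)] at h2
    exact ENNReal.ofReal_ne_top h2.symm

end IsRadialWeight

/-- The fundamental lemma of the calculus of variations. `OstrowskiIneq` and the equality statement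
speak of an arbitrary weak gradient, which this identifies with the p-integrable or the explicit
one. -/
theorem IsWeakGradient.ae_eq {Q : Set (EuclideanSpace ℝ (Fin d))} (hQ : IsOpen Q)
    {f : EuclideanSpace ℝ (Fin d) → ℝ} {G G' : EuclideanSpace ℝ (Fin d) → EuclideanSpace ℝ (Fin d)}
    (hG : IsWeakGradient Q f G) (hG' : IsWeakGradient Q f G') : G =ᵐ[volume.restrict Q] G' := by
  have hli : LocallyIntegrableOn (fun x => G x - G' x) Q :=
    hG.locallyIntegrableOn_grad.sub hG'.locallyIntegrableOn_grad
  have hint : ∀ {H : EuclideanSpace ℝ (Fin d) → EuclideanSpace ℝ (Fin d)},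
      LocallyIntegrableOn H Q → ∀ φ : EuclideanSpace ℝ (Fin d) → ℝ, Continuous φ →
      HasCompactSupport φ → tsupport φ ⊆ Q → IntegrableOn (fun x => φ x • H x) Q := by
    intro H hH φ hφ hφc hφQ
    have h1 : IntegrableOn (fun x => φ x • H x) (tsupport φ) := by
      have := (hH.integrableOn_compact_subset hφQ hφc).continuousOn_smul hφ.continuousOn hφc
      exact this
    refine (IntegrableOn.integrable_of_forall_notMem_eq_zero h1 fun x hx => ?_).integrableOn
    rw [image_eq_zero_of_notMem_tsupport hx, zero_smul]
  have h1 := hQ.ae_eq_zero_of_integral_contDiff_smul_eq_zero hli fun φ hφ hφc hφQ => by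
    have hI := hint hG.locallyIntegrableOn_grad φ hφ.continuous hφc hφQ
    have hI' := hint hG'.locallyIntegrableOn_grad φ hφ.continuous hφc hφQ
    have h2 : ∫ x, φ x • (G x - G' x) = ∫ x in Q, φ x • (G x - G' x) := by
      refine (setIntegral_eq_integral_of_forall_compl_eq_zero fun x hx => ?_).symm
      rw [image_eq_zero_of_notMem_tsupport fun h => hx (hφQ h), zero_smul]
    have hcoord : ∀ {H : EuclideanSpace ℝ (Fin d) → EuclideanSpace ℝ (Fin d)},
        IntegrableOn (fun x => φ x • H x) Q → ∀ i,
        (∫ x in Q, φ x • H x) i = ∫ x in Q, H x i * φ x := by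
      intro H hH i
      have := (EuclideanSpace.proj (𝕜 := ℝ) i :
        EuclideanSpace ℝ (Fin d) →L[ℝ] ℝ).integral_comp_comm hH
      simp only [PiLp.proj_apply, PiLp.smul_apply, smul_eq_mul] at this
      rw [← this]
      simp only [mul_comm]
    rw [h2]
    simp only [smul_sub]
    rw [integral_sub hI hI', sub_eq_zero]
    ext i
    rw [hcoord hI, hcoord hI', ← neg_inj, ← hG.integral_eq φ hφ hφc hφQ i,
      ← hG'.integral_eq φ hφ hφc hφQ i]
  rw [EventuallyEq, ae_restrict_iff' hQ.measurableSet]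
  filter_upwards [h1] with x hx hxQ
  exact sub_eq_zero.1 (hx hxQ)

/-- C¹ functions are not dense for p = ∞. On a bounded sector, L_p is contained in L_s, and the
bound of ∫ w|F - F(θ)| by ∫ |G|_{K°} g no longer involves the exponent, so approximating in L_s
suffices. -/
theorem exists_finite_exponent (hpd : (d : ℝ≥0∞) < p) :
    ∃ s : ℝ≥0∞, (d : ℝ≥0∞) < s ∧ s ≤ p ∧ s ≠ ⊤ := by
  obtain ⟨s, hs1, hs2⟩ := exists_between hpd
  exact ⟨s, hs1, hs2.le, (hs2.trans_le le_top).ne⟩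

theorem MemW1p.exists_isContRep (hd : d ≠ 0) (hK : IsSymmBody K) (hC : IsConvexOpenCone C)
    (hh : 0 < h) (hpd : (d : ℝ≥0∞) < p) {f : EuclideanSpace ℝ (Fin d) → ℝ}
    (hf : MemW1p p (h • K ∩ C) f) : ∃ F, IsContRep (h • K ∩ C) f F := by
  obtain ⟨s, hds, hsp, hs⟩ := exists_finite_exponent hpd
  obtain ⟨hfp, G, hfG, hG⟩ := hf
  have hQb := hC.isBounded_sector hK h
  have : IsFiniteMeasure (volume.restrict (h • K ∩ C)) := ⟨by simpa using hQb.measure_lt_top⟩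
  have hs1 : 1 ≤ s := by
    refine le_trans ?_ hds.le
    exact_mod_cast Nat.one_le_iff_ne_zero.2 hd
  obtain ⟨u, F, -, -, hF, -⟩ := hfG.exists_tendstoUniformlyOn (hC.isOpen_sector hK hh)
    (hC.convex_sector hK h) hQb (hC.nonempty_sector hK hh) hds hs1 hs (hfp.mono_exponent hsp)
    (hG.mono_exponent hsp)
  exact ⟨F, hF⟩

/-- The weighted estimate is used with the auxiliary exponent s, Hölder's inequality with the
original pair p, q. The finite bound on ∫ w|F - F(θ)| also gives absolute convergence. -/
theorem MemW.ostrowskiIneq (hw : MemW d q h w) (hd : d ≠ 0) (hK : IsSymmBody K)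
    (hC : IsConvexOpenCone C) (hh : 0 < h) (hpd : (d : ℝ≥0∞) < p) (hpq : p⁻¹ + q⁻¹ = 1)
    (hq0 : q ≠ 0) (hq : q ≠ ⊤) : OstrowskiIneq p K C h w (ostrowskiConst q K C h w) := by
  intro f F G hf hF hfG
  obtain ⟨s, hds, hsp, hs⟩ := exists_finite_exponent hpd
  obtain ⟨hfp, G', hfG', hG'⟩ := hf
  have hwr := hw.isRadialWeight
  have hQo := hC.isOpen_sector hK hh
  have hQb := hC.isBounded_sector hK h
  have hfin : IsFiniteMeasure (volume.restrict (h • K ∩ C)) := ⟨by simpa using hQb.measure_lt_top⟩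
  have hG : MemLp G p (volume.restrict (h • K ∩ C)) := hG'.ae_eq (hfG'.ae_eq hQo hfG)
  set A := eLpNorm (fun y => gauge (polarBody K) (G y)) p (volume.restrict (h • K ∩ C)) with hA
  set B := eLpNorm (fun y => gFun d w h (gauge K y)) q (volume.restrict (h • K ∩ C)) with hB
  have hPm : AEStronglyMeasurable (fun y => gauge (polarBody K) (G y))
      (volume.restrict (h • K ∩ C)) :=
    hK.continuous_gauge_polarBody.comp_aestronglyMeasurable hG.aestronglyMeasurable
  have hAt : A ≠ ⊤ := by
    obtain ⟨L, hL⟩ := hK.exists_gauge_polarBody_le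
    refine (MemLp.of_le_mul hG hPm (c := L) (Eventually.of_forall fun y => ?_)).eLpNorm_lt_top.ne
    rw [Real.norm_of_nonneg (gauge_nonneg _)]
    exact hL _
  have hBt : B ≠ ⊤ := by
    rw [hB, hwr.eLpNorm_gFun_comp_gauge hd hK hC hh hq0 hq]
    refine ENNReal.mul_ne_top (ENNReal.rpow_ne_top_of_nonneg (by positivity) ?_) hw.2.2.2.2.ne
    exact ENNReal.mul_ne_top (by simp) (hC.volume_inter_lt_top hK).ne
  have hgm : AEStronglyMeasurable (fun y => gFun d w h (gauge K y))
      (volume.restrict (h • K ∩ C)) :=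
    hwr.aemeasurable_gFun.aestronglyMeasurable.comp_quasiMeasurePreserving
      (quasiMeasurePreserving_gauge hd hK hC hh)
  have hle : ∫⁻ y in h • K ∩ C, ‖w (gauge K y) * (F y - F 0)‖ₑ ≤ B * A := by
    refine (hwr.lintegral_mul_enorm_sub_le hd hK hC hh hds hs hfG (hfp.mono_exponent hsp)
      (hG.mono_exponent hsp) hF).trans ?_
    have : ENNReal.HolderTriple p q 1 := ⟨by rw [hpq, inv_one]⟩
    have h1 := eLpNorm_smul_le_mul_eLpNorm (p := p) (q := q) (r := 1) hgm hPm
    rw [eLpNorm_one_eq_lintegral_enorm] at h1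
    rw [mul_comm]
    exact h1
  have hint : IntegrableOn (fun y => w (gauge K y) * (F y - F 0)) (h • K ∩ C) := by
    refine ⟨(hwr.aestronglyMeasurable_comp_gauge hd hK hC hh).mul ?_, ?_⟩
    · exact ((hF.1.mono subset_closure).aestronglyMeasurable hQo.measurableSet).sub
        aestronglyMeasurable_const
    · exact hle.trans_lt (ENNReal.mul_lt_top hBt.lt_top hAt.lt_top)
  refine ⟨hint, ?_⟩
  rw [hwr.ostrowskiConst_eq hd hK hC hh hq0 hq, polarLpNorm, ← ENNReal.toReal_mul,
    ← Real.norm_eq_abs, ← toReal_enorm]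
  refine ENNReal.toReal_mono (ENNReal.mul_ne_top hBt hAt) ?_
  exact (enorm_integral_le_lintegral_enorm _).trans hle

end

/-! ### The inclusion of 𝓦*_q in 𝓦_q -/

section

variable {d : ℕ} {h : ℝ} {w : ℝ → ℝ} {q : ℝ≥0∞}

/-- Follows from w ≤ 1 + w^q and the finite measure t^{d-1}dt on (u, h). -/
theorem MemRadialL.one_of_one_le (hq1 : 1 ≤ q) (hq : q ≠ ⊤) {u : ℝ} (hu : 0 < u)
    (hw : MemRadialL d q u h w) : MemRadialL d 1 u h w := by
  refine ⟨hw.1, hw.2.1, ?_⟩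
  have hq1' : 1 ≤ q.toReal := by
    rw [← ENNReal.toReal_one]; exact ENNReal.toReal_mono hq hq1
  have h1 := hw.2.2
  rw [radialNorm, if_neg hq, ENNReal.rpow_lt_top_iff_of_pos (by positivity)] at h1
  simp only [radialNorm, ENNReal.one_ne_top, if_false, ENNReal.toReal_one, Real.rpow_one,
    div_one, ENNReal.rpow_one]
  calc ∫⁻ t in Ioo u h, ENNReal.ofReal (t ^ (d - 1) * w t)
      ≤ ∫⁻ t in Ioo u h, (ENNReal.ofReal (t ^ (d - 1)) +
          ENNReal.ofReal (t ^ (d - 1) * w t ^ q.toReal)) := by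
        refine setLIntegral_mono_ae' measurableSet_Ioo (Eventually.of_forall fun t ht => ?_)
        have ht0 : 0 < t := hu.trans ht.1
        have hwt := hw.1 t ht
        rw [← ENNReal.ofReal_add (by positivity) (by positivity), ← mul_one_add]
        refine ENNReal.ofReal_le_ofReal (mul_le_mul_of_nonneg_left ?_ (by positivity))
        rcases le_total (w t) 1 with h2 | h2
        · have : 0 ≤ w t ^ q.toReal := by positivity
          linarith
        · have := Real.rpow_le_rpow_of_exponent_le h2 hq1'
          rw [Real.rpow_one] at this
          linarith
    _ = (∫⁻ t in Ioo u h, ENNReal.ofReal (t ^ (d - 1))) +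
          ∫⁻ t in Ioo u h, ENNReal.ofReal (t ^ (d - 1) * w t ^ q.toReal) :=
        lintegral_add_left (by fun_prop) _
    _ < ⊤ := by
        refine ENNReal.add_lt_top.2 ⟨?_, h1⟩
        have : IntegrableOn (fun t : ℝ => t ^ (d - 1)) (Ioo u h) :=
          (continuous_pow _).integrableOn_Icc.mono_set Ioo_subset_Icc_self
        exact this.lintegral_lt_top

theorem MemWStar.isRadialWeight (hq1 : 1 ≤ q) (hq : q ≠ ⊤) (hw : MemWStar d q h w) :
    IsRadialWeight d h w :=
  isRadialWeight_of_memRadialL_one hw.1 fun u hu => (hw.2.1 u hu).one_of_one_le hq1 hq hu.1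

theorem le_add_wNu {ν t : ℝ} (hν : ν ∈ Ioo (0 : ℝ) 1) (ht : 0 < t)
    (hb : BddAbove ((fun s => |w s - w t|) '' Icc (ν * t) t)) : w (ν * t) ≤ w t + wNu w ν t := by
  have h1 : |w (ν * t) - w t| ≤ wNu w ν t :=
    le_csSup hb ⟨ν * t, ⟨le_rfl, by nlinarith [hν.2]⟩, rfl⟩
  linarith [le_abs_self (w (ν * t) - w t)]

/-- Split the integral over (νu, h) at νh. In the first piece substitute νt for t and use w(νt) ≤
w(t) + w_ν(t): the powers of ν from t^{d-1} and u^{d-1} cancel, and the Jacobian leaves the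
contraction factor ν. The second piece is a constant times (νu)^{-(d-1)}. -/
theorem gFun_mul_le {ν : ℝ} (hν : ν ∈ Ioo (0 : ℝ) 1) (hw : IsRadialWeight d h w)
    (hwν : IsRadialWeight d h (wNu w ν))
    (hb : ∀ t ∈ Ioc 0 h, BddAbove ((fun s => |w s - w t|) '' Icc (ν * t) t))
    {u : ℝ} (hu : u ∈ Ioo 0 h) :
    gFun d w h (ν * u) ≤ ν * (gFun d w h u + gFun d (wNu w ν) h u) +
      (∫ t in (ν * h)..h, w t * t ^ (d - 1)) * (1 / (ν * u) ^ (d - 1)) := by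
  have hh : 0 < h := hu.1.trans hu.2
  have hνu : ν * u ∈ Ioo 0 h := ⟨mul_pos hν.1 hu.1, by nlinarith [hν.2, hu.1, hu.2]⟩
  have hνh : ν * h ∈ Ioo 0 h := ⟨mul_pos hν.1 hh, by nlinarith [hν.2]⟩
  have hνuh : ν * u ≤ ν * h := mul_le_mul_of_nonneg_left hu.2.le hν.1.le
  have hii : ∀ {v : ℝ → ℝ}, IsRadialWeight d h v → ∀ {a b : ℝ}, 0 < a → a ≤ b → b ≤ h →
      IntervalIntegrable (fun t => v t * t ^ (d - 1)) volume a b := by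
    intro v hv a b ha hab hbh
    rcases hab.eq_or_lt with rfl | hab'
    · exact IntervalIntegrable.refl
    rw [intervalIntegrable_iff_integrableOn_Icc_of_le hab enorm_ne_top]
    exact (hv.integrableOn_Icc ⟨ha, hab'.trans_le hbh⟩).mono_set (Icc_subset_Icc_right hbh)
  have h1 := intervalIntegral.integral_add_adjacent_intervals (hii hw hνu.1 hνuh hνh.2.le)
    (hii hw hνh.1 hνh.2.le le_rfl)
  have h2 := intervalIntegral.mul_integral_comp_mul_left (a := u) (b := h)
    (f := fun t => w t * t ^ (d - 1)) ν
  have h3 : ∫ t in u..h, w (ν * t) * (ν * t) ^ (d - 1) ≤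
      ∫ t in u..h, ν ^ (d - 1) * (w t * t ^ (d - 1) + wNu w ν t * t ^ (d - 1)) := by
    refine intervalIntegral.integral_mono_on hu.2.le ?_ ?_ fun t ht => ?_
    · have := (hii hw hνu.1 hνuh hνh.2.le).comp_mul_left (c := ν) 
      simpa only [mul_div_cancel_left₀ _ hν.1.ne'] using this
    · exact ((hii hw hu.1 hu.2.le le_rfl).add (hii hwν hu.1 hu.2.le le_rfl)).const_mul _
    · have ht0 : 0 < t := hu.1.trans_le ht.1
      have h4 := le_add_wNu hν ht0 (hb t ⟨ht0, ht.2⟩)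
      have h5 : 0 ≤ ν ^ (d - 1) * t ^ (d - 1) := by have := hν.1; positivity
      rw [mul_pow]
      nlinarith [mul_le_mul_of_nonneg_right h4 h5]
  rw [intervalIntegral.integral_const_mul, intervalIntegral.integral_add
    (hii hw hu.1 hu.2.le le_rfl) (hii hwν hu.1 hu.2.le le_rfl)] at h3
  have h6 : (0 : ℝ) < 1 / (ν * u) ^ (d - 1) := by have := hνu.1; positivity
  have hν0 := hν.1
  have hu0 := hu.1
  unfold gFun
  rw [← h1, ← h2, mul_add, mul_comm _ (1 / (ν * u) ^ (d - 1))]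
  refine add_le_add ?_ le_rfl
  calc _ ≤ 1 / (ν * u) ^ (d - 1) * (ν * (ν ^ (d - 1) *
        ((∫ t in u..h, w t * t ^ (d - 1)) + ∫ t in u..h, wNu w ν t * t ^ (d - 1)))) := by
        gcongr
    _ = _ := by
        rw [mul_pow]; field_simp

/-- The class `𝓦*_q(0, h)` is contained in `𝓦_q(0, h)`. -/
theorem MemWStar.memW (hd : d ≠ 0) (hh : 0 < h) (hq1 : 1 ≤ q) (hq : q ≠ ⊤)
    (hq' : (d - 1 : ℝ) * (q.toReal - 1) < 1) (hw : MemWStar d q h w) : MemW d q h w := by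
  have hwr := hw.isRadialWeight hq1 hq
  have hr1 : 1 ≤ q.toReal := by
    rw [← ENNReal.toReal_one]; exact ENNReal.toReal_mono hq hq1
  set r := q.toReal with hr
  have hr0 : 0 < r := zero_lt_one.trans_le hr1
  refine ⟨hw.1, fun u hu => (hw.2.1 u hu).one_of_one_le hq1 hq hu.1,
    fun t ht => hwr.gFun_nonneg (Ioo_subset_Ioc_self ht), hwr.aemeasurable_gFun, ?_⟩
  -- A single ν in (0, 1) with w_ν in 𝓦_q is enough.
  obtain ⟨ν, ⟨hb, hwν⟩, hν⟩ := (hw.2.2.1.and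
    (Ioo_mem_nhdsLT (show (0 : ℝ) < 1 from one_pos))).exists
  have hwνr := hwν.isRadialWeight
  have hν0 := hν.1
  set c := ∫ t in (ν * h)..h, w t * t ^ (d - 1) with hc
  have hνh : ν * h ∈ Ioo 0 h := ⟨mul_pos hν.1 hh, by nlinarith [hν.2]⟩
  have hc0 : 0 ≤ c := intervalIntegral.integral_nonneg hνh.2.le fun t ht =>
    hwr.mul_pow_nonneg ⟨hνh.1.trans_le ht.1, ht.2⟩
  set g : ℝ → ℝ≥0∞ := fun t => ENNReal.ofReal (gFun d w h t) with hg
  set gν : ℝ → ℝ≥0∞ := fun t => ENNReal.ofReal (gFun d (wNu w ν) h t) with hgν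
  set e : ℝ → ℝ≥0∞ := fun t => ENNReal.ofReal (c * (1 / (ν * t) ^ (d - 1))) with he
  set Φ : Set ℝ → (ℝ → ℝ≥0∞) → ℝ≥0∞ := fun S f =>
    (∫⁻ t in S, ENNReal.ofReal (t ^ (d - 1)) * f t ^ r) ^ (1 / r) with hΦ
  have hradial : ∀ v : ℝ → ℝ, IsRadialWeight d h v →
      radialNorm d q 0 h (gFun d v h) = Φ (Ioo 0 h) fun t => ENNReal.ofReal (gFun d v h t) := by
    intro v hv
    rw [radialNorm, if_neg hq]
    congr 1
    refine setLIntegral_congr_fun measurableSet_Ioo fun t ht => ?_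
    have h1 := hv.gFun_nonneg (Ioo_subset_Ioc_self ht)
    have := ht.1
    show ENNReal.ofReal (t ^ (d - 1) * gFun d v h t ^ r) =
      ENNReal.ofReal (t ^ (d - 1)) * ENNReal.ofReal (gFun d v h t) ^ r
    rw [ENNReal.ofReal_mul (by positivity), ENNReal.ofReal_rpow_of_nonneg h1 hr0.le]
  have hmono : ∀ {S T : Set ℝ} (f : ℝ → ℝ≥0∞), S ⊆ T → Φ S f ≤ Φ T f := by
    intro S T f hST
    simp only [hΦ]
    gcongr
  have hadd : ∀ {S : Set ℝ} {f₁ f₂ : ℝ → ℝ≥0∞}, AEMeasurable f₁ (volume.restrict S) →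
      AEMeasurable f₂ (volume.restrict S) → Φ S (f₁ + f₂) ≤ Φ S f₁ + Φ S f₂ := by
    intro S f₁ f₂ h1 h2
    have hden : Measurable fun t : ℝ => ENNReal.ofReal (t ^ (d - 1)) := by fun_prop
    have hac := withDensity_absolutelyContinuous (volume.restrict S)
      (fun t : ℝ => ENNReal.ofReal (t ^ (d - 1)))
    have h3 := ENNReal.lintegral_Lp_add_le (h1.mono_ac hac) (h2.mono_ac hac) hr1
    rw [lintegral_withDensity_eq_lintegral_mul₀ hden.aemeasurable ((h1.add h2).pow_const _),
      lintegral_withDensity_eq_lintegral_mul₀ hden.aemeasurable (h1.pow_const _),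
      lintegral_withDensity_eq_lintegral_mul₀ hden.aemeasurable (h2.pow_const _)] at h3
    exact h3
  -- The three inhomogeneous terms: g_{w_ν} has finite norm by assumption, u^{-(d-1)} because (d -
  -- 1)(q - 1) < 1, and g is bounded on [νh, h) by monotonicity.
  set B : ℝ≥0∞ := Φ (Ioo 0 h) (fun t => ENNReal.ofReal ν * gν t) + Φ (Ioo 0 h) e +
    Φ (Ico (ν * h) h) g with hB
  have hBt : B ≠ ⊤ := by
    refine ENNReal.add_ne_top.2 ⟨ENNReal.add_ne_top.2 ⟨?_, ?_⟩, ?_⟩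
    · have h1 : Φ (Ioo 0 h) gν ≠ ⊤ := by
        rw [← hradial _ hwνr]; exact hwν.2.2.2.2.ne
      refine ne_top_of_le_ne_top h1 ?_
      simp only [hΦ]
      gcongr with t
      exact mul_le_of_le_one_left' (ENNReal.ofReal_le_one.2 hν.2.le)
    · refine ENNReal.rpow_ne_top_of_nonneg (by positivity) ?_
      have h1 : ∫⁻ t in Ioo 0 h, ENNReal.ofReal (t ^ (d - 1)) * e t ^ r =
          ∫⁻ t in Ioo 0 h, ENNReal.ofReal ((c * (1 / ν ^ (d - 1))) ^ r) *
            ENNReal.ofReal (t ^ (-((d - 1 : ℝ) * (r - 1)))) := by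
        refine setLIntegral_congr_fun measurableSet_Ioo fun t ht => ?_
        have ht0 := ht.1
        show ENNReal.ofReal (t ^ (d - 1)) * ENNReal.ofReal (c * (1 / (ν * t) ^ (d - 1))) ^ r = _
        rw [ENNReal.ofReal_rpow_of_nonneg (by positivity) hr0.le,
          ← ENNReal.ofReal_mul (by positivity), ← ENNReal.ofReal_mul (by positivity)]
        congr 1
        have h2 : c * (1 / (ν * t) ^ (d - 1)) = (c * (1 / ν ^ (d - 1))) * (t ^ (d - 1))⁻¹ := by
          rw [mul_pow]; field_simp
        rw [h2, Real.mul_rpow (by positivity) (by positivity), mul_left_comm]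
        congr 1
        rw [← Real.rpow_natCast, ← Real.rpow_neg ht.1.le, ← Real.rpow_mul ht.1.le,
          ← Real.rpow_add ht.1, Nat.cast_sub (Nat.one_le_iff_ne_zero.2 hd)]
        congr 1; push_cast; ring
      rw [h1, lintegral_const_mul _ (by fun_prop)]
      exact ENNReal.mul_ne_top ENNReal.ofReal_ne_top
        (lintegral_Ioo_rpow_lt_top (by linarith) h).ne
    · refine ENNReal.rpow_ne_top_of_nonneg (by positivity) (ne_of_lt ?_)
      calc ∫⁻ t in Ico (ν * h) h, ENNReal.ofReal (t ^ (d - 1)) * g t ^ r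
          ≤ ∫⁻ _ in Ico (ν * h) h, ENNReal.ofReal (h ^ (d - 1)) * g (ν * h) ^ r := by
            refine setLIntegral_mono_ae' measurableSet_Ico (Eventually.of_forall fun t ht => ?_)
            have ht0 : 0 < t := hνh.1.trans_le ht.1
            have h1 := hwr.antitoneOn_gFun ⟨hνh.1, hνh.2.le⟩ ⟨ht0, ht.2.le⟩ ht.1
            have h2 := ht.2.le
            simp only [hg]
            gcongr
        _ < ⊤ := by
            rw [lintegral_const]
            refine ENNReal.mul_lt_top (ENNReal.mul_lt_top ENNReal.ofReal_lt_top
              (ENNReal.rpow_lt_top_of_nonneg hr0.le ENNReal.ofReal_ne_top)) (by simp)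
  have hgm : ∀ {v : ℝ → ℝ}, IsRadialWeight d h v → ∀ {ε : ℝ}, 0 ≤ ε →
      AEMeasurable (fun t => ENNReal.ofReal (gFun d v h t)) (volume.restrict (Ioo ε h)) :=
    fun hv _ hε => (hv.aemeasurable_gFun.mono_measure
      (Measure.restrict_mono (Ioo_subset_Ioo_left hε) le_rfl)).ennreal_ofReal
  -- Rescale (νε, νh) to (ε, h), apply `gFun_mul_le` there and Minkowski's inequality; the interval
  -- [νh, h) contributes to B.
  have hstep : ∀ ε : ℝ, 0 < ε → Φ (Ioo (ν * ε) h) g ≤ ENNReal.ofReal ν * Φ (Ioo ε h) g + B := by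
    intro ε hε
    have hsub : Ioo (ν * ε) h ⊆ Ioo (ν * ε) (ν * h) ∪ Ico (ν * h) h := by
      intro t ht
      rcases lt_or_ge t (ν * h) with h1 | h1
      · exact Or.inl ⟨ht.1, h1⟩
      · exact Or.inr ⟨h1, ht.2⟩
    have h1 : Φ (Ioo (ν * ε) h) g ≤ Φ (Ioo (ν * ε) (ν * h)) g + Φ (Ico (ν * h) h) g := by
      refine (hmono g hsub).trans ?_
      simp only [hΦ]
      refine (ENNReal.rpow_le_rpow (lintegral_union_le _ _ _) (by positivity)).trans ?_
      exact ENNReal.rpow_add_le_add_rpow _ _ (by positivity) ((div_le_one hr0).2 hr1)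
    have himage : (fun t : ℝ => ν * t) '' Ioo ε h = Ioo (ν * ε) (ν * h) := by
      rw [image_mul_left_Ioo hν0]
    have h2 : Φ (Ioo (ν * ε) (ν * h)) g ≤ Φ (Ioo ε h) fun t => g (ν * t) := by
      simp only [hΦ]
      refine ENNReal.rpow_le_rpow ?_ (by positivity)
      have h3 := lintegral_image_eq_lintegral_abs_deriv_mul (s := Ioo ε h)
        (f := fun t : ℝ => ν * t) (f' := fun _ => ν) measurableSet_Ioo
        (fun t _ => by simpa using ((hasDerivAt_id t).const_mul ν).hasDerivWithinAt)
        (fun a _ b _ hab => mul_left_cancel₀ hν0.ne' hab)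
        (fun t => ENNReal.ofReal (t ^ (d - 1)) * g t ^ r)
      rw [himage] at h3
      rw [h3]
      refine setLIntegral_mono_ae' measurableSet_Ioo (Eventually.of_forall fun t ht => ?_)
      have ht0 : 0 < t := hε.trans ht.1
      rw [← mul_assoc, ← ENNReal.ofReal_mul (abs_nonneg _), abs_of_pos hν0, mul_pow]
      gcongr
      -- The Jacobian and the radial density together give ν·ν^{d-1} ≤ 1, which is simply dropped.
      have h4 : ν ^ (d - 1) ≤ 1 := pow_le_one₀ hν0.le hν.2.le
      have h5 : 0 < t ^ (d - 1) := by positivity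
      have h6 : 0 ≤ ν ^ (d - 1) := by positivity
      nlinarith [mul_le_mul hν.2.le h4 h6 zero_le_one]
    have h3 : Φ (Ioo ε h) (fun t => g (ν * t)) ≤
        Φ (Ioo ε h) (((fun t => ENNReal.ofReal ν * g t) + fun t => ENNReal.ofReal ν * gν t) + e) := by
      simp only [hΦ]
      refine ENNReal.rpow_le_rpow ?_ (by positivity)
      refine setLIntegral_mono_ae' measurableSet_Ioo (Eventually.of_forall fun t ht => ?_)
      have ht0 : t ∈ Ioo 0 h := ⟨hε.trans ht.1, ht.2⟩
      have ht1 := ht0.1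
      have h4 := gFun_mul_le hν hwr hwνr hb ht0
      have h5 := hwr.gFun_nonneg (Ioo_subset_Ioc_self ht0)
      have h6 := hwνr.gFun_nonneg (Ioo_subset_Ioc_self ht0)
      have h7 : g (ν * t) ≤ (((fun t => ENNReal.ofReal ν * g t) +
          fun t => ENNReal.ofReal ν * gν t) + e) t := by
        simp only [Pi.add_apply, hg, hgν, he]
        rw [← ENNReal.ofReal_mul hν0.le, ← ENNReal.ofReal_mul hν0.le,
          ← ENNReal.ofReal_add (by positivity) (by positivity),
          ← ENNReal.ofReal_add (by positivity) (by positivity), ← mul_add]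
        exact ENNReal.ofReal_le_ofReal h4
      gcongr
    have hm1 := (hgm hwr hε.le).const_mul (ENNReal.ofReal ν)
    have hm2 := (hgm hwνr hε.le).const_mul (ENNReal.ofReal ν)
    have hem : AEMeasurable e (volume.restrict (Ioo ε h)) := by
      have : Measurable e := by
        refine (Measurable.const_mul ?_ _).ennreal_ofReal
        exact ((measurable_const_mul ν).pow_const _).const_div _
      exact this.aemeasurable
    have h4 := (hadd (hm1.add hm2) hem).trans (add_le_add (hadd hm1 hm2) le_rfl)
    have h5 : Φ (Ioo ε h) (fun t => ENNReal.ofReal ν * g t) = ENNReal.ofReal ν * Φ (Ioo ε h) g := by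
      simp only [hΦ, ENNReal.mul_rpow_of_nonneg _ _ hr0.le]
      have h6 : ∀ t, ENNReal.ofReal (t ^ (d - 1)) * (ENNReal.ofReal ν ^ r * g t ^ r) =
          ENNReal.ofReal ν ^ r * (ENNReal.ofReal (t ^ (d - 1)) * g t ^ r) := fun t => by ring
      simp only [h6]
      rw [lintegral_const_mul' _ _ (ENNReal.rpow_ne_top_of_nonneg hr0.le ENNReal.ofReal_ne_top),
        ENNReal.mul_rpow_of_nonneg _ _ (by positivity), ← ENNReal.rpow_mul,
        mul_one_div_cancel hr0.ne', ENNReal.rpow_one]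
    have hIoo := Ioo_subset_Ioo_left (b := h) hε.le
    calc Φ (Ioo (ν * ε) h) g ≤ Φ (Ioo (ν * ε) (ν * h)) g + Φ (Ico (ν * h) h) g := h1
      _ ≤ (Φ (Ioo ε h) (fun t => ENNReal.ofReal ν * g t) +
            Φ (Ioo ε h) (fun t => ENNReal.ofReal ν * gν t) + Φ (Ioo ε h) e) +
              Φ (Ico (ν * h) h) g := by
          gcongr
          exact h2.trans (h3.trans h4)
      _ ≤ (ENNReal.ofReal ν * Φ (Ioo ε h) g +
            Φ (Ioo 0 h) (fun t => ENNReal.ofReal ν * gν t) + Φ (Ioo 0 h) e) +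
              Φ (Ico (ν * h) h) g := by
          rw [h5]
          gcongr
          · exact hmono _ hIoo
          · exact hmono _ hIoo
      _ = _ := by rw [hB]; ring
  -- The fixed point of x ↦ νx + B, hence a bound for all iterates that start below it.
  set D := B / ENNReal.ofReal (1 - ν) with hD
  have h1ν : 0 < 1 - ν := sub_pos.2 hν.2
  have hDt : D ≠ ⊤ := ENNReal.div_ne_top hBt (by simpa using h1ν)
  have hDB : ENNReal.ofReal ν * D + B = D := by
    have h1 : B = ENNReal.ofReal (1 - ν) * D :=
      (ENNReal.mul_div_cancel (by simpa using h1ν) ENNReal.ofReal_ne_top).symm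
    refine (congrArg (ENNReal.ofReal ν * D + ·) h1).trans ?_
    rw [← add_mul, ← ENNReal.ofReal_add hν0.le h1ν.le, add_sub_cancel, ENNReal.ofReal_one, one_mul]
  have hiter : ∀ n : ℕ, Φ (Ioo (ν ^ n * h) h) g ≤ D := by
    intro n
    induction n with
    -- The iteration starts from the empty interval (h, h), where the norm is 0, so finiteness is
    -- never assumed in advance.
    | zero =>
      simp only [hΦ, pow_zero, one_mul, Ioo_self, Measure.restrict_empty, lintegral_zero_measure]
      rw [ENNReal.zero_rpow_of_pos (by positivity)]
      exact zero_le
    | succ n ih =>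
      rw [pow_succ', mul_assoc, ← hDB]
      refine (hstep _ (by positivity)).trans ?_
      gcongr
  rw [hradial w hwr]
  have hunion : Ioo 0 h = ⋃ n : ℕ, Ioo (ν ^ n * h) h := by
    ext t
    rw [mem_iUnion]
    constructor
    · intro ht
      obtain ⟨n, hn⟩ := exists_pow_lt_of_lt_one (div_pos ht.1 hh) hν.2
      exact ⟨n, (lt_div_iff₀ hh).1 hn, ht.2⟩
    · rintro ⟨n, hn⟩
      exact ⟨lt_trans (by positivity) hn.1, hn.2⟩
  have hdir : Directed (· ⊆ ·) fun n : ℕ => Ioo (ν ^ n * h) h := by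
    refine Monotone.directed_le fun m n hmn => Ioo_subset_Ioo_left ?_
    have := pow_le_pow_of_le_one hν0.le hν.2.le hmn
    gcongr
  refine lt_of_le_of_lt ?_ hDt.lt_top
  simp only [hΦ]
  -- The intervals (νⁿh, h) increase to (0, h), and monotone convergence keeps the bound D.
  rw [one_div, ENNReal.rpow_inv_le_iff hr0, hunion,
    setLIntegral_iUnion_of_directed _ hdir]
  refine iSup_le fun n => ?_
  have := hiter n
  simp only [hΦ] at this
  rwa [one_div, ENNReal.rpow_inv_le_iff hr0] at this

end

/-! ### Weak gradients of radial functions -/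

section

variable {d : ℕ} {K C : Set (EuclideanSpace ℝ (Fin d))} {h : ℝ} {φ : ℝ → ℝ} {p : ℝ≥0∞}

/-- Derivatives of radial functions with an integrable singularity at the origin. -/
structure IsRadialProfile (h : ℝ) (φ : ℝ → ℝ) : Prop where
  nonneg : ∀ t ∈ Ioc 0 h, 0 ≤ φ t
  continuousOn : ContinuousOn φ (Ioc 0 h)
  antitoneOn : AntitoneOn φ (Ioc 0 h)
  integrableOn : IntegrableOn φ (Ioo 0 h)

namespace IsRadialProfile

theorem intervalIntegrable (hφ : IsRadialProfile h φ) (hh : 0 < h) :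
    IntervalIntegrable φ volume 0 h := by
  rw [intervalIntegrable_iff_integrableOn_Ioo_of_le hh.le (by simp)]
  exact hφ.integrableOn

theorem continuousOn_integral (hφ : IsRadialProfile h φ) (hh : 0 < h) :
    ContinuousOn (fun r => ∫ u in (0 : ℝ)..r, φ u) (Icc 0 h) := by
  have h1 := intervalIntegral.continuousOn_primitive_interval (μ := volume) (a := 0) (b := h)
    (f := φ) (by
      rw [uIcc_of_le hh.le]
      exact (integrableOn_Icc_iff_integrableOn_Ioo enorm_ne_top enorm_ne_top).2 hφ.integrableOn)
  rwa [uIcc_of_le hh.le] at h1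

theorem integral_mem_Icc (hφ : IsRadialProfile h φ) (hh : 0 < h) {r : ℝ} (hr : r ∈ Icc 0 h) :
    ∫ u in (0 : ℝ)..r, φ u ∈ Icc 0 (∫ u in (0 : ℝ)..h, φ u) := by
  have h0 := hφ.intervalIntegrable hh
  have h1 : IntervalIntegrable φ volume 0 r :=
    h0.mono_set (by rw [uIcc_of_le hr.1, uIcc_of_le hh.le]; exact Icc_subset_Icc_right hr.2)
  have h2 : IntervalIntegrable φ volume r h :=
    h0.mono_set (by rw [uIcc_of_le hr.2, uIcc_of_le hh.le]; exact Icc_subset_Icc_left hr.1)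
  have hnn : ∀ {a b : ℝ}, 0 ≤ a → a ≤ b → b ≤ h → 0 ≤ ∫ u in a..b, φ u := by
    intro a b ha hab hb
    rw [intervalIntegral.integral_of_le hab]
    refine setIntegral_nonneg measurableSet_Ioc fun u hu => hφ.nonneg u ?_
    exact ⟨ha.trans_lt hu.1, hu.2.trans hb⟩
  refine ⟨hnn le_rfl hr.1 hr.2, ?_⟩
  rw [← intervalIntegral.integral_add_adjacent_intervals h1 h2]
  linarith [hnn hr.1 hr.2 le_rfl]

theorem continuousOn_comp_gauge (hφ : IsRadialProfile h φ) (hK : IsSymmBody K)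
    (hC : IsConvexOpenCone C) (hh : 0 < h) :
    ContinuousOn (fun y => ∫ u in (0 : ℝ)..(gauge K y), φ u) (closure (h • K ∩ C)) :=
  (hφ.continuousOn_integral hh).comp hK.continuous_gauge.continuousOn fun _ hy =>
    ⟨gauge_nonneg _, hC.gauge_le_of_mem_closure hK hh hy⟩

/-- A bounded continuous modification of a profile. -/
def trunc (φ : ℝ → ℝ) (h ε u : ℝ) : ℝ := φ (max ε (min u h))

theorem trunc_mem {ε : ℝ} (hε : ε ∈ Ioo 0 h) (u : ℝ) : max ε (min u h) ∈ Icc ε h :=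
  ⟨le_max_left _ _, max_le hε.2.le (min_le_right _ _)⟩

theorem continuous_trunc (hφ : IsRadialProfile h φ) {ε : ℝ} (hε : ε ∈ Ioo 0 h) :
    Continuous (trunc φ h ε) := by
  refine hφ.continuousOn.comp_continuous (by fun_prop) fun u => ?_
  exact ⟨hε.1.trans_le (trunc_mem hε u).1, (trunc_mem hε u).2⟩

theorem trunc_nonneg (hφ : IsRadialProfile h φ) {ε : ℝ} (hε : ε ∈ Ioo 0 h) (u : ℝ) :
    0 ≤ trunc φ h ε u :=
  hφ.nonneg _ ⟨hε.1.trans_le (trunc_mem hε u).1, (trunc_mem hε u).2⟩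

theorem trunc_le_const (hφ : IsRadialProfile h φ) {ε : ℝ} (hε : ε ∈ Ioo 0 h) (u : ℝ) :
    trunc φ h ε u ≤ φ ε :=
  hφ.antitoneOn ⟨hε.1, hε.2.le⟩ ⟨hε.1.trans_le (trunc_mem hε u).1, (trunc_mem hε u).2⟩
    (trunc_mem hε u).1

theorem trunc_le (hφ : IsRadialProfile h φ) {ε : ℝ} (hε : ε ∈ Ioo 0 h) {u : ℝ} (hu : u ∈ Ioc 0 h) :
    trunc φ h ε u ≤ φ u := by
  refine hφ.antitoneOn hu ⟨hε.1.trans_le (trunc_mem hε u).1, (trunc_mem hε u).2⟩ ?_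
  rw [min_eq_left hu.2]; exact le_max_right _ _

theorem trunc_eq {ε u : ℝ} (hu : u ∈ Icc ε h) : trunc φ h ε u = φ u := by
  rw [trunc, min_eq_left hu.2, max_eq_right hu.1]

theorem hasDerivAt_integral_trunc (hφ : IsRadialProfile h φ) {ε : ℝ} (hε : ε ∈ Ioo 0 h) (r : ℝ) :
    HasDerivAt (fun r => ∫ u in (0 : ℝ)..r, trunc φ h ε u) (trunc φ h ε r) r :=
  intervalIntegral.integral_hasDerivAt_right ((hφ.continuous_trunc hε).intervalIntegrable _ _)
    ((hφ.continuous_trunc hε).stronglyMeasurableAtFilter _ _) (hφ.continuous_trunc hε).continuousAt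

/-- The purpose of the truncation: its primitive composed with the gauge is Lipschitz on the whole
space, so integration by parts for Lipschitz functions applies. -/
theorem lipschitzWith_integral_trunc (hφ : IsRadialProfile h φ) {ε : ℝ} (hε : ε ∈ Ioo 0 h) :
    LipschitzWith (φ ε).toNNReal (fun r => ∫ u in (0 : ℝ)..r, trunc φ h ε u) := by
  refine lipschitzWith_of_nnnorm_deriv_le
    (fun r => (hφ.hasDerivAt_integral_trunc hε r).differentiableAt) fun r => ?_
  rw [(hφ.hasDerivAt_integral_trunc hε r).deriv, ← NNReal.coe_le_coe, coe_nnnorm,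
    Real.norm_of_nonneg (hφ.trunc_nonneg hε r)]
  exact (hφ.trunc_le_const hε r).trans (Real.le_coe_toNNReal _)

end IsRadialProfile

theorem IsSymmBody.exists_norm_gradient_le (hK : IsSymmBody K) :
    ∃ L : NNReal, ∀ x, ‖gradient (gauge K) x‖ ≤ L := by
  obtain ⟨L, hL⟩ := hK.exists_lipschitz
  refine ⟨L, fun x => ?_⟩
  rw [gradient, LinearIsometryEquiv.norm_map]
  exact norm_fderiv_le_of_lipschitz ℝ hL

theorem measurable_gradient_gauge : Measurable (gradient (gauge K)) :=
  (InnerProductSpace.toDual ℝ (EuclideanSpace ℝ (Fin d))).symm.continuous.measurable.comp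
    (measurable_fderiv ℝ (gauge K))

theorem IsSymmBody.ae_differentiableAt (hK : IsSymmBody K) :
    ∀ᵐ x : EuclideanSpace ℝ (Fin d), DifferentiableAt ℝ (gauge K) x := by
  obtain ⟨L, hL⟩ := hK.exists_lipschitz
  exact hL.ae_differentiableAt

namespace IsRadialProfile

/-- Integration by parts of a Lipschitz function against a test function, with the chain rule valid
wherever the gauge is differentiable, hence almost everywhere by Rademacher's theorem. -/
theorem integral_trunc_mul_fderiv (hφ : IsRadialProfile h φ) (hK : IsSymmBody K)
    {Q : Set (EuclideanSpace ℝ (Fin d))} {ε : ℝ}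
    (hε : ε ∈ Ioo 0 h) (a b : ℝ) {ψ : EuclideanSpace ℝ (Fin d) → ℝ} (hψ : ContDiff ℝ ∞ ψ)
    (hψc : HasCompactSupport ψ) (hψQ : tsupport ψ ⊆ Q) (v : EuclideanSpace ℝ (Fin d)) :
    ∫ x in Q, (a * (∫ u in (0 : ℝ)..(gauge K x), trunc φ h ε u) + b) * fderiv ℝ ψ x v =
      - ∫ x in Q, a * trunc φ h ε (gauge K x) * inner ℝ (gradient (gauge K) x) v * ψ x := by
  obtain ⟨L, hL⟩ := hK.exists_lipschitz
  obtain ⟨D, hD⟩ := ContDiff.lipschitzWith_of_hasCompactSupport hψc hψ (by simp)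
  have hψd : Differentiable ℝ ψ := hψ.differentiable (by simp)
  have hlip : LipschitzWith (‖a‖₊ * ((φ ε).toNNReal * L)) fun x =>
      a * (∫ u in (0 : ℝ)..(gauge K x), trunc φ h ε u) + b := by
    have h1 := (hφ.lipschitzWith_integral_trunc hε).comp hL
    have h2 := (lipschitzWith_smul a).comp h1
    have h3 := h2.add (LipschitzWith.const (α := EuclideanSpace ℝ (Fin d)) b)
    rw [add_zero] at h3
    exact h3
  have key := LipschitzWith.integral_lineDeriv_mul_eq (μ := volume) hlip hD hψc v
  have hleft : ∀ᵐ x, lineDeriv ℝ (fun x => a * (∫ u in (0 : ℝ)..(gauge K x), trunc φ h ε u) + b)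
      x v * ψ x = a * trunc φ h ε (gauge K x) * inner ℝ (gradient (gauge K) x) v * ψ x := by
    filter_upwards [hK.ae_differentiableAt] with x hx
    have h1 := (hφ.hasDerivAt_integral_trunc hε (gauge K x)).comp_hasFDerivAt x hx.hasFDerivAt
    have h2 := ((h1.const_mul a).add_const b).hasLineDerivAt v
    have h3 : lineDeriv ℝ (fun x => a * (∫ u in (0 : ℝ)..(gauge K x), trunc φ h ε u) + b) x v =
      _ := h2.lineDeriv
    rw [h3, inner_gradient]
    simp only [FunLike.coe_smul, Pi.smul_apply, smul_eq_mul]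
    ring
  have hright : ∀ x, lineDeriv ℝ ψ x (-v) = - fderiv ℝ ψ x v := by
    intro x
    rw [(hψd x).lineDeriv_eq_fderiv, map_neg]
  rw [integral_congr_ae hleft] at key
  simp only [hright, neg_mul, integral_neg] at key
  have hr1 : ∫ x in Q, (a * (∫ u in (0 : ℝ)..(gauge K x), trunc φ h ε u) + b) * fderiv ℝ ψ x v =
      ∫ x, fderiv ℝ ψ x v * (a * (∫ u in (0 : ℝ)..(gauge K x), trunc φ h ε u) + b) := by
    rw [setIntegral_eq_integral_of_forall_compl_eq_zero fun x hx => ?_]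
    · simp only [mul_comm]
    · have h1 : fderiv ℝ ψ x = 0 := image_eq_zero_of_notMem_tsupport
        fun h => hx (hψQ (tsupport_fderiv_subset ℝ h))
      rw [h1]; simp
  have hr2 : ∫ x in Q, a * trunc φ h ε (gauge K x) * inner ℝ (gradient (gauge K) x) v * ψ x =
      ∫ x, a * trunc φ h ε (gauge K x) * inner ℝ (gradient (gauge K) x) v * ψ x := by
    refine setIntegral_eq_integral_of_forall_compl_eq_zero fun x hx => ?_
    rw [image_eq_zero_of_notMem_tsupport fun h => hx (hψQ h), mul_zero]
  rw [hr1, hr2, key, neg_neg]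

theorem tendsto_integral_trunc (hφ : IsRadialProfile h φ) (hh : 0 < h) {ε : ℕ → ℝ}
    (hε : ∀ n, ε n ∈ Ioo 0 h) (hε0 : Tendsto ε atTop (𝓝 0)) {r : ℝ} (hr : r ∈ Icc 0 h) :
    Tendsto (fun n => ∫ u in (0 : ℝ)..r, trunc φ h (ε n) u) atTop
      (𝓝 (∫ u in (0 : ℝ)..r, φ u)) := by
  have h1 : IntervalIntegrable φ volume 0 r := (hφ.intervalIntegrable hh).mono_set
    (by rw [uIcc_of_le hr.1, uIcc_of_le hh.le]; exact Icc_subset_Icc_right hr.2)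
  refine intervalIntegral.tendsto_integral_filter_of_dominated_convergence φ
    (Eventually.of_forall fun n => (hφ.continuous_trunc (hε n)).aestronglyMeasurable)
    (Eventually.of_forall fun n => Eventually.of_forall fun u hu => ?_) h1
    (Eventually.of_forall fun u hu => ?_)
  · rw [uIoc_of_le hr.1] at hu
    rw [Real.norm_of_nonneg (hφ.trunc_nonneg (hε n) u)]
    exact hφ.trunc_le (hε n) ⟨hu.1, hu.2.trans hr.2⟩
  · rw [uIoc_of_le hr.1] at hu
    refine tendsto_const_nhds.congr' ?_
    filter_upwards [hε0.eventually_lt_const hu.1] with n hn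
    exact (trunc_eq ⟨hn.le, hu.2.trans hr.2⟩).symm

/-- The gradient of `y ↦ a ∫_0^{|y|_K} φ + b`. -/
def grad (φ : ℝ → ℝ) (K : Set (EuclideanSpace ℝ (Fin d))) (a : ℝ)
    (y : EuclideanSpace ℝ (Fin d)) : EuclideanSpace ℝ (Fin d) :=
  (a * φ (gauge K y)) • gradient (gauge K) y

theorem memLp_grad (hK : IsSymmBody K) (a : ℝ) {Q : Set (EuclideanSpace ℝ (Fin d))}
    (hφp : MemLp (fun y => φ (gauge K y)) p (volume.restrict Q)) :
    MemLp (grad φ K a) p (volume.restrict Q) := by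
  obtain ⟨L, hL⟩ := hK.exists_norm_gradient_le
  refine MemLp.of_le_mul hφp (c := |a| * L)
    (((hφp.aestronglyMeasurable.const_mul a)).smul measurable_gradient_gauge.aestronglyMeasurable)
    (Eventually.of_forall fun y => ?_)
  rw [grad, norm_smul, norm_mul, Real.norm_eq_abs a]
  calc |a| * ‖φ (gauge K y)‖ * ‖gradient (gauge K) y‖ ≤ |a| * ‖φ (gauge K y)‖ * L := by
        gcongr; exact hL y
    _ = _ := by ring

theorem gauge_polarBody_grad (hφ : IsRadialProfile h φ) (hd : d ≠ 0) (hK : IsSymmBody K)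
    (hC : IsConvexOpenCone C) (hh : 0 < h) (a : ℝ) :
    ∀ᵐ y ∂volume.restrict (h • K ∩ C),
      gauge (polarBody K) (grad φ K a y) = |a| * φ (gauge K y) := by
  filter_upwards [IsRadialWeight.gauge_mem_Ioo_ae hd hK hC hh,
    ae_restrict_of_ae hK.ae_differentiableAt] with y hy hyd
  rw [grad, hK.gauge_polarBody_smul, hK.gauge_polarBody_gradient (hK.gauge_pos_iff.1 hy.1) hyd,
    mul_one, abs_mul, abs_of_nonneg (hφ.nonneg _ (Ioo_subset_Ioc_self hy))]

/-- Let the truncation level tend to 0 in `integral_trunc_mul_fderiv`. As φ is decreasing, truncated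
profiles lie below φ, which dominates both sides. -/
theorem isWeakGradient (hφ : IsRadialProfile h φ) (hd : d ≠ 0) (hK : IsSymmBody K)
    (hC : IsConvexOpenCone C) (hh : 0 < h)
    (hφi : IntegrableOn (fun y => φ (gauge K y)) (h • K ∩ C)) (a b : ℝ) :
    IsWeakGradient (h • K ∩ C) (fun y => a * (∫ u in (0 : ℝ)..(gauge K y), φ u) + b)
      (grad φ K a) := by
  have hQo := hC.isOpen_sector hK hh
  have hQm := hQo.measurableSet
  have hcont : ContinuousOn (fun y => a * (∫ u in (0 : ℝ)..(gauge K y), φ u) + b) (h • K ∩ C) :=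
    (((hφ.continuousOn_comp_gauge hK hC hh).mono subset_closure).const_mul a).add
      continuousOn_const
  have hGi : IntegrableOn (grad φ K a) (h • K ∩ C) :=
    memLp_one_iff_integrable.1 (memLp_grad hK a (memLp_one_iff_integrable.2 hφi))
  refine ⟨hcont.locallyIntegrableOn hQm, hGi.locallyIntegrableOn, fun ψ hψ hψc hψQ i => ?_⟩
  set v : EuclideanSpace ℝ (Fin d) := EuclideanSpace.single i 1 with hv
  set ε : ℕ → ℝ := fun n => h / (n + 2) with hεd
  have hε : ∀ n, ε n ∈ Ioo 0 h := fun n => div_add_two_mem_Ioo hh n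
  have hε0 : Tendsto ε atTop (𝓝 0) := tendsto_const_nhds.div_atTop
    (tendsto_atTop_add_const_right _ _ tendsto_natCast_atTop_atTop)
  have hψ1 : ContDiff ℝ 1 ψ := hψ.of_le (by exact_mod_cast le_top)
  have hcψ : Continuous fun x => fderiv ℝ ψ x v :=
    (hψ1.continuous_fderiv one_ne_zero).clm_apply continuous_const
  have hψ's : HasCompactSupport fun x => fderiv ℝ ψ x v := hψc.fderiv_apply ℝ v
  obtain ⟨M, hM⟩ := hψ.continuous.bounded_above_of_compact_support hψc
  obtain ⟨L, hL⟩ := hK.exists_norm_gradient_le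
  have hQg : ∀ x ∈ h • K ∩ C, gauge K x ∈ Icc 0 h := fun x hx =>
    ⟨gauge_nonneg _, ((hC.mem_smul_inter_iff hK hh).1 hx).1.le⟩
  have hQI := IsRadialWeight.gauge_mem_Ioo_ae hd hK hC hh
  set I := ∫ u in (0 : ℝ)..h, φ u with hI
  have hlim1 : Tendsto (fun n => ∫ x in h • K ∩ C,
      (a * (∫ u in (0 : ℝ)..(gauge K x), trunc φ h (ε n) u) + b) * fderiv ℝ ψ x v) atTop
      (𝓝 (∫ x in h • K ∩ C, (a * (∫ u in (0 : ℝ)..(gauge K x), φ u) + b) * fderiv ℝ ψ x v)) := by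
    refine tendsto_integral_of_dominated_convergence
      (fun x => (|a| * I + |b|) * ‖fderiv ℝ ψ x v‖) (fun n => ?_) ?_ (fun n => ?_) ?_
    · have h1 : Continuous fun r => ∫ u in (0 : ℝ)..r, trunc φ h (ε n) u :=
        (hφ.lipschitzWith_integral_trunc (hε n)).continuous
      have h2 := h1.comp hK.continuous_gauge
      exact (((h2.const_mul a).add continuous_const).mul hcψ).aestronglyMeasurable
    · exact ((hcψ.integrable_of_hasCompactSupport hψ's).norm.const_mul _).integrableOn
    · filter_upwards [ae_restrict_mem hQm] with x hx
      rw [norm_mul]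
      gcongr
      have h1 : 0 ≤ ∫ u in (0 : ℝ)..(gauge K x), trunc φ h (ε n) u :=
        intervalIntegral.integral_nonneg (gauge_nonneg _) fun u _ => hφ.trunc_nonneg (hε n) u
      have h2 : ∫ u in (0 : ℝ)..(gauge K x), trunc φ h (ε n) u ≤ I := by
        refine le_trans ?_ (hφ.integral_mem_Icc hh (hQg x hx)).2
        refine intervalIntegral.integral_mono_on_of_le_Ioo (gauge_nonneg _)
          ((hφ.continuous_trunc (hε n)).intervalIntegrable _ _)
          ((hφ.intervalIntegrable hh).mono_set ?_) fun u hu => ?_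
        · rw [uIcc_of_le (gauge_nonneg _), uIcc_of_le hh.le]
          exact Icc_subset_Icc_right (hQg x hx).2
        · exact hφ.trunc_le (hε n) ⟨hu.1, hu.2.le.trans (hQg x hx).2⟩
      rw [Real.norm_eq_abs]
      refine (abs_add_le _ _).trans ?_
      rw [abs_mul, abs_of_nonneg h1]
      gcongr
    · filter_upwards [ae_restrict_mem hQm] with x hx
      exact (((hφ.tendsto_integral_trunc hh hε hε0 (hQg x hx)).const_mul a).add_const b).mul_const _
  have hlim2 : Tendsto (fun n => - ∫ x in h • K ∩ C,
      a * trunc φ h (ε n) (gauge K x) * inner ℝ (gradient (gauge K) x) v * ψ x) atTop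
      (𝓝 (- ∫ x in h • K ∩ C,
        a * φ (gauge K x) * inner ℝ (gradient (gauge K) x) v * ψ x)) := by
    refine (tendsto_integral_of_dominated_convergence
      (fun x => |a| * φ (gauge K x) * L * M) (fun n => ?_) ?_ (fun n => ?_) ?_).neg
    · have h1 : Measurable fun x => inner ℝ (gradient (gauge K) x) v :=
        measurable_gradient_gauge.inner measurable_const
      exact (((((hφ.continuous_trunc (hε n)).comp hK.continuous_gauge).measurable.const_mul a).mul
        h1).mul hψ.continuous.measurable).aestronglyMeasurable
    · exact ((hφi.const_mul _).mul_const _).mul_const _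
    · filter_upwards [hQI] with x hx
      have h1 := hφ.trunc_nonneg (hε n) (gauge K x)
      have h2 := hφ.trunc_le (hε n) (Ioo_subset_Ioc_self hx)
      have h3 : |inner ℝ (gradient (gauge K) x) v| ≤ L := by
        refine (abs_real_inner_le_norm _ _).trans ?_
        rw [hv, PiLp.norm_single, norm_one, mul_one]
        exact hL x
      have h4 := hM x
      have h5 : 0 ≤ φ (gauge K x) := h1.trans h2
      rw [norm_mul, norm_mul, norm_mul, Real.norm_eq_abs a, Real.norm_of_nonneg h1]
      gcongr
      exact h3
    · filter_upwards [hQI] with x hx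
      refine Tendsto.mul_const _ (Tendsto.mul_const _ (Tendsto.const_mul a ?_))
      refine tendsto_const_nhds.congr' ?_
      filter_upwards [hε0.eventually_lt_const hx.1] with n hn
      exact (trunc_eq ⟨hn.le, hx.2.le⟩).symm
  have h1 := tendsto_nhds_unique (hlim1.congr fun n =>
    hφ.integral_trunc_mul_fderiv hK (hε n) a b hψ hψc hψQ v) hlim2
  rw [h1, neg_inj]
  refine integral_congr_ae (Eventually.of_forall fun x => ?_)
  have h2 : inner ℝ (gradient (gauge K) x) v = gradient (gauge K) x i := by
    rw [hv, real_inner_comm, EuclideanSpace.inner_single_left]; simp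
  simp only [h2, grad, PiLp.smul_apply, smul_eq_mul]

theorem memW1p (hφ : IsRadialProfile h φ) (hd : d ≠ 0) (hK : IsSymmBody K)
    (hC : IsConvexOpenCone C) (hh : 0 < h) (hp1 : 1 ≤ p)
    (hφp : MemLp (fun y => φ (gauge K y)) p (volume.restrict (h • K ∩ C))) (a b : ℝ) :
    MemW1p p (h • K ∩ C) fun y => a * (∫ u in (0 : ℝ)..(gauge K y), φ u) + b := by
  have hQo := hC.isOpen_sector hK hh
  have hQb := hC.isBounded_sector hK h
  have : IsFiniteMeasure (volume.restrict (h • K ∩ C)) := ⟨by simpa using hQb.measure_lt_top⟩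
  refine ⟨?_, grad φ K a, hφ.isWeakGradient hd hK hC hh (hφp.integrable hp1) a b,
    memLp_grad hK a hφp⟩
  have hcont := ((((hφ.continuousOn_comp_gauge hK hC hh).mono
    subset_closure).const_mul a).add (continuousOn_const (c := b)))
  refine MemLp.of_bound (hcont.aestronglyMeasurable hQo.measurableSet)
    (|a| * (∫ u in (0 : ℝ)..h, φ u) + |b|) ?_
  filter_upwards [ae_restrict_mem hQo.measurableSet] with y hy
  have h1 := hφ.integral_mem_Icc hh
    ⟨gauge_nonneg y, ((hC.mem_smul_inter_iff hK hh).1 hy).1.le⟩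
  rw [Real.norm_eq_abs]
  refine (abs_add_le _ _).trans ?_
  rw [abs_mul, abs_of_nonneg h1.1]
  gcongr
  exact h1.2

end IsRadialProfile

end

/-! ### Extremal functions and sharpness -/

section

variable {d : ℕ} {K C : Set (EuclideanSpace ℝ (Fin d))} {h : ℝ} {w φ : ℝ → ℝ} {p q : ℝ≥0∞}

/-- The bound (d - 1)(q - 1) < 1 is p > d in terms of q, and p(q - 1) = q is the relation behind
equality in Hölder's inequality. For p = ∞ the latter fails, since ∞ · 0 = 0 while q = 1, so that
case is kept apart. -/
theorem conjugate_exponent_facts (hd : 2 ≤ d) (hp : (d : ℝ≥0∞) < p) (hpq : p⁻¹ + q⁻¹ = 1) :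
    1 ≤ p ∧ 1 ≤ q ∧ q ≠ ⊤ ∧ (d - 1 : ℝ) * (q.toReal - 1) < 1 ∧
      ((p = ⊤ ∧ q = 1) ∨
        (p ≠ ⊤ ∧ 0 < q.toReal - 1 ∧ p * ENNReal.ofReal (q.toReal - 1) = q)) := by
  have hp1' : 1 < p := lt_of_le_of_lt (by exact_mod_cast (by omega : 1 ≤ d)) hp
  have hq1 : 1 ≤ q := by
    rw [← ENNReal.inv_le_one, ← hpq]; exact le_add_self
  have hq : q ≠ ⊤ := by
    rintro rfl
    rw [ENNReal.inv_top, add_zero, ENNReal.inv_eq_one] at hpq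
    exact hp1'.ne' hpq
  refine ⟨hp1'.le, hq1, hq, ?_⟩
  rcases eq_or_ne p ⊤ with rfl | hpt
  · have h1 : q = 1 := by rwa [ENNReal.inv_top, zero_add, ENNReal.inv_eq_one] at hpq
    subst h1
    simp
  · lift p to NNReal using hpt
    lift q to NNReal using hq
    have hP1 : (1 : ℝ) < p := by exact_mod_cast hp1'
    have hPd : (d : ℝ) < p := by
      have : (d : NNReal) < p := by exact_mod_cast hp
      exact_mod_cast this
    have hQ1 : (1 : ℝ) ≤ q := by exact_mod_cast hq1
    have hp0 : p ≠ 0 := by rintro rfl; norm_num at hP1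
    have hq0 : q ≠ 0 := by rintro rfl; norm_num at hQ1
    have hR : (p : ℝ)⁻¹ + (q : ℝ)⁻¹ = 1 := by
      rw [← ENNReal.coe_inv hp0, ← ENNReal.coe_inv hq0] at hpq
      exact_mod_cast hpq
    have hPQ : (p : ℝ) * (q - 1) = q := by
      have : (p : ℝ) ≠ 0 := by positivity
      have : (q : ℝ) ≠ 0 := by positivity
      field_simp at hR
      linarith
    have hQ : (0 : ℝ) < q - 1 := by
      by_contra! hcon
      nlinarith
    have hd2 : (2 : ℝ) ≤ d := by exact_mod_cast hd
    rw [ENNReal.coe_toReal]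
    refine ⟨by nlinarith, Or.inr ⟨ENNReal.coe_ne_top, hQ, ?_⟩⟩
    rw [← ENNReal.ofReal_coe_nnreal (p := p), ← ENNReal.ofReal_mul (by positivity), hPQ,
      ENNReal.ofReal_coe_nnreal]

theorem lintegral_mul_lintegral_Ioo_swap {a b : ℝ → ℝ≥0∞}
    (ha : AEMeasurable a (volume.restrict (Ioo 0 h)))
    (hb : AEMeasurable b (volume.restrict (Ioo 0 h))) :
    ∫⁻ r in Ioo 0 h, a r * ∫⁻ u in Ioo 0 r, b u = ∫⁻ u in Ioo 0 h, b u * ∫⁻ r in Ioo u h, a r := by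
  have hm : MeasurableSet {z : ℝ × ℝ | z.2 < z.1} := measurableSet_lt measurable_snd measurable_fst
  have hswap := lintegral_lintegral_swap (μ := volume.restrict (Ioo 0 h))
    (ν := volume.restrict (Ioo 0 h))
    (f := fun r u => {z : ℝ × ℝ | z.2 < z.1}.indicator (fun z => a z.1 * b z.2) (r, u))
    ((ha.comp_fst.mul hb.comp_snd).indicator hm)
  have h1 : ∀ r ∈ Ioo 0 h, a r * ∫⁻ u in Ioo 0 r, b u = ∫⁻ u in Ioo 0 h,
      {z : ℝ × ℝ | z.2 < z.1}.indicator (fun z => a z.1 * b z.2) (r, u) := by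
    intro r hr
    have hs : Ioo 0 h ∩ Iio r = Ioo 0 r := by
      rw [Ioo_inter_Iio, min_eq_right hr.2.le]
    rw [← lintegral_const_mul'' _ (hb.mono_measure
      (Measure.restrict_mono (Ioo_subset_Ioo_right hr.2.le) le_rfl)), ← hs, inter_comm,
      ← Measure.restrict_restrict measurableSet_Iio, ← lintegral_indicator measurableSet_Iio]
    rfl
  have h2 : ∀ u ∈ Ioo 0 h, b u * ∫⁻ r in Ioo u h, a r = ∫⁻ r in Ioo 0 h,
      {z : ℝ × ℝ | z.2 < z.1}.indicator (fun z => a z.1 * b z.2) (r, u) := by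
    intro u hu
    have hs : Ioo 0 h ∩ Ioi u = Ioo u h := by
      rw [Ioo_inter_Ioi, max_eq_right hu.1.le]
    rw [← lintegral_const_mul'' _ (ha.mono_measure
      (Measure.restrict_mono (Ioo_subset_Ioo_left hu.1.le) le_rfl)), ← hs, inter_comm,
      ← Measure.restrict_restrict measurableSet_Ioi, ← lintegral_indicator measurableSet_Ioi]
    simp only [mul_comm (b u)]
    rfl
  rw [setLIntegral_congr_fun measurableSet_Ioo h1, setLIntegral_congr_fun measurableSet_Ioo h2]
  exact hswap

namespace IsRadialProfile

theorem const_one : IsRadialProfile h fun _ => 1 :=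
  ⟨fun _ _ => zero_le_one, continuousOn_const, fun _ _ _ _ _ => le_rfl,
    integrableOn_const (by simp)⟩

theorem aemeasurable (hφ : IsRadialProfile h φ) : AEMeasurable φ (volume.restrict (Ioo 0 h)) :=
  hφ.integrableOn.aestronglyMeasurable.aemeasurable

theorem ofReal_integral (hφ : IsRadialProfile h φ) {r : ℝ} (hr : r ∈ Ioo 0 h) :
    ENNReal.ofReal (∫ u in (0 : ℝ)..r, φ u) = ∫⁻ u in Ioo 0 r, ENNReal.ofReal (φ u) := by
  rw [intervalIntegral.integral_of_le hr.1.le, integral_Ioc_eq_integral_Ioo,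
    ofReal_integral_eq_lintegral_ofReal (hφ.integrableOn.mono_set (Ioo_subset_Ioo_right hr.2.le))]
  filter_upwards [ae_restrict_mem measurableSet_Ioo] with u hu
  exact hφ.nonneg u ⟨hu.1, (hu.2.trans hr.2).le⟩

theorem aemeasurable_integral (hφ : IsRadialProfile h φ) (hh : 0 < h) :
    AEMeasurable (fun r => ∫ u in (0 : ℝ)..r, φ u) (volume.restrict (Ioo 0 h)) :=
  ((hφ.continuousOn_integral hh).mono Ioo_subset_Icc_self).aemeasurable measurableSet_Ioo

/-- Integrating by parts in the radial variable. -/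
theorem lintegral_weight_mul_integral (hφ : IsRadialProfile h φ) (hw : IsRadialWeight d h w)
    (hd : d ≠ 0) (hK : IsSymmBody K) (hC : IsConvexOpenCone C) (hh : 0 < h) :
    ∫⁻ y in h • K ∩ C, ENNReal.ofReal (w (gauge K y) * ∫ u in (0 : ℝ)..(gauge K y), φ u) =
      ∫⁻ y in h • K ∩ C, ENNReal.ofReal (φ (gauge K y) * gFun d w h (gauge K y)) := by
  have hwm := hw.aemeasurable hh
  rw [lintegral_comp_gauge hd hK hC hh
      (φ := fun r => ENNReal.ofReal (w r * ∫ u in (0 : ℝ)..r, φ u))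
      (hwm.mul (hφ.aemeasurable_integral hh)).ennreal_ofReal,
    lintegral_comp_gauge hd hK hC hh (φ := fun r => ENNReal.ofReal (φ r * gFun d w h r))
      (hφ.aemeasurable.mul hw.aemeasurable_gFun).ennreal_ofReal]
  congr 1
  have hswap := lintegral_mul_lintegral_Ioo_swap
    (a := fun r => ENNReal.ofReal (w r) * ENNReal.ofReal (r ^ (d - 1)))
    (hwm.ennreal_ofReal.mul (by fun_prop)) hφ.aemeasurable.ennreal_ofReal
  refine Eq.trans (setLIntegral_congr_fun measurableSet_Ioo fun r hr => ?_) (hswap.trans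
    (setLIntegral_congr_fun measurableSet_Ioo fun u hu => ?_))
  · have := hw.nonneg r (Ioo_subset_Ioc_self hr)
    rw [ENNReal.ofReal_mul this, hφ.ofReal_integral hr]
    ring
  · have h1 := hw.gENN_eq hu
    have hu0 : 0 < u ^ (d - 1) := pow_pos hu.1 _
    rw [ENNReal.ofReal_mul (hφ.nonneg u (Ioo_subset_Ioc_self hu)), ← h1, gENN,
      mul_left_comm (ENNReal.ofReal (φ u)), ← mul_assoc,
      ENNReal.mul_inv_cancel (by simpa using hu0) ENNReal.ofReal_ne_top, one_mul]

theorem aestronglyMeasurable_comp_gauge (hφ : IsRadialProfile h φ) (hd : d ≠ 0)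
    (hK : IsSymmBody K) (hC : IsConvexOpenCone C) (hh : 0 < h) :
    AEStronglyMeasurable (fun y => φ (gauge K y)) (volume.restrict (h • K ∩ C)) :=
  hφ.aemeasurable.aestronglyMeasurable.comp_quasiMeasurePreserving
    (quasiMeasurePreserving_gauge hd hK hC hh)

/-- No cancellation occurs, because the integrand has the sign of a; the exchange of integrals in
`lintegral_weight_mul_integral` is then an exact identity. -/
theorem abs_integral_weight_mul (hφ : IsRadialProfile h φ) (hw : IsRadialWeight d h w)
    (hd : d ≠ 0) (hK : IsSymmBody K) (hC : IsConvexOpenCone C) (hh : 0 < h) (a : ℝ) :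
    |∫ y in h • K ∩ C, w (gauge K y) * (a * ∫ u in (0 : ℝ)..(gauge K y), φ u)| =
      |a| * (∫⁻ y in h • K ∩ C,
        ENNReal.ofReal (φ (gauge K y) * gFun d w h (gauge K y))).toReal := by
  have hm : AEStronglyMeasurable (fun y => w (gauge K y) * ∫ u in (0 : ℝ)..(gauge K y), φ u)
      (volume.restrict (h • K ∩ C)) :=
    (hw.aestronglyMeasurable_comp_gauge hd hK hC hh).mul
      ((hφ.aemeasurable_integral hh).aestronglyMeasurable.comp_quasiMeasurePreserving
        (quasiMeasurePreserving_gauge hd hK hC hh))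
  simp only [mul_left_comm _ a]
  rw [integral_const_mul, abs_mul, integral_eq_lintegral_of_nonneg_ae ?_ hm,
    hφ.lintegral_weight_mul_integral hw hd hK hC hh, abs_of_nonneg ENNReal.toReal_nonneg]
  filter_upwards [IsRadialWeight.gauge_mem_Ioo_ae hd hK hC hh] with y hy
  exact mul_nonneg (hw.nonneg _ (Ioo_subset_Ioc_self hy))
    (hφ.integral_mem_Icc hh (Ioo_subset_Icc_self hy)).1

theorem polarLpNorm_eq (hφ : IsRadialProfile h φ) (hd : d ≠ 0) (hK : IsSymmBody K)
    (hC : IsConvexOpenCone C) (hh : 0 < h) (hp1 : 1 ≤ p)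
    (hφp : MemLp (fun y => φ (gauge K y)) p (volume.restrict (h • K ∩ C))) {a b : ℝ}
    {G : EuclideanSpace ℝ (Fin d) → EuclideanSpace ℝ (Fin d)}
    (hG : IsWeakGradient (h • K ∩ C)
      (fun y => a * (∫ u in (0 : ℝ)..(gauge K y), φ u) + b) G) :
    polarLpNorm p K (h • K ∩ C) G = |a| *
      (eLpNorm (fun y => φ (gauge K y)) p (volume.restrict (h • K ∩ C))).toReal := by
  have hQb := hC.isBounded_sector hK h
  have : IsFiniteMeasure (volume.restrict (h • K ∩ C)) := ⟨by simpa using hQb.measure_lt_top⟩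
  have h1 := hG.ae_eq (hC.isOpen_sector hK hh)
    (hφ.isWeakGradient hd hK hC hh (hφp.integrable hp1) a b)
  have h2 : (fun y => gauge (polarBody K) (G y)) =ᵐ[volume.restrict (h • K ∩ C)]
      |a| • fun y => φ (gauge K y) := by
    filter_upwards [h1, hφ.gauge_polarBody_grad hd hK hC hh a] with y hy hy'
    rw [hy, hy']
    rfl
  rw [polarLpNorm, eLpNorm_congr_ae h2, eLpNorm_const_smul, ENNReal.toReal_mul, toReal_enorm,
    Real.norm_eq_abs, abs_abs]

end IsRadialProfile

/-- Test with |y|_K, the radial function of the profile 1, whose gradient norm is positive. This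
settles sharpness when the constant is 0. -/
theorem OstrowskiIneq.nonneg {M : ℝ} (hM : OstrowskiIneq p K C h w M) (hd : d ≠ 0)
    (hK : IsSymmBody K) (hC : IsConvexOpenCone C) (hh : 0 < h) (hp1 : 1 ≤ p) : 0 ≤ M := by
  have hQb := hC.isBounded_sector hK h
  have : IsFiniteMeasure (volume.restrict (h • K ∩ C)) := ⟨by simpa using hQb.measure_lt_top⟩
  have hφ : IsRadialProfile h fun _ => 1 := IsRadialProfile.const_one
  have hφp : MemLp (fun _ => (1 : ℝ)) p (volume.restrict (h • K ∩ C)) := memLp_const 1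
  have hG := hφ.isWeakGradient hd hK hC hh (hφp.integrable hp1) 1 0
  have h1 := (hM _ _ _ (hφ.memW1p hd hK hC hh hp1 hφp 1 0)
    ⟨((hφ.continuousOn_comp_gauge hK hC hh).const_mul 1).add continuousOn_const,
      EventuallyEq.rfl⟩ hG).2
  have hvol : volume.restrict (h • K ∩ C) ≠ 0 := by
    rw [Ne, Measure.restrict_eq_zero]
    exact ((hC.isOpen_sector hK hh).measure_pos _ (hC.nonempty_sector hK hh)).ne'
  have hN : 0 < (eLpNorm (fun _ : EuclideanSpace ℝ (Fin d) => (1 : ℝ)) p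
      (volume.restrict (h • K ∩ C))).toReal := by
    refine ENNReal.toReal_pos (fun h0 => ?_) hφp.eLpNorm_lt_top.ne
    rw [eLpNorm_eq_zero_iff hφp.aestronglyMeasurable (zero_lt_one.trans_le hp1).ne'] at h0
    have : (ae (volume.restrict (h • K ∩ C))).NeBot := ae_neBot.2 hvol
    obtain ⟨y, hy⟩ := h0.exists
    exact one_ne_zero hy
  rw [hφ.polarLpNorm_eq hd hK hC hh hp1 hφp hG, abs_one, one_mul] at h1
  exact nonneg_of_mul_nonneg_left ((abs_nonneg _).trans h1) hN

namespace MemW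

/-- Only the integrability of g^{q-1} near the origin, without the weight u^{d-1}, needs an
argument. Where u^{d-1}g ≥ 1 it is at most u^{d-1}g^q, integrable since w ∈ 𝓦_q; elsewhere it is at
most u^{-(d-1)(q-1)}. -/
theorem isRadialProfile_rpow (hw : MemW d q h w) (hd : d ≠ 0) (hq1 : 1 ≤ q)
    (hq : q ≠ ⊤) (hq' : (d - 1 : ℝ) * (q.toReal - 1) < 1) :
    IsRadialProfile h fun u => gFun d w h u ^ (q.toReal - 1) := by
  have hwr := hw.isRadialWeight
  have hQ1 : 1 ≤ q.toReal := by
    rw [← ENNReal.toReal_one]; exact ENNReal.toReal_mono hq hq1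
  have hQ0 : 0 ≤ q.toReal - 1 := by linarith
  have hc : ContinuousOn (fun u => gFun d w h u ^ (q.toReal - 1)) (Ioc 0 h) :=
    hwr.continuousOn_gFun.rpow_const fun _ _ => Or.inr hQ0
  refine ⟨fun t ht => Real.rpow_nonneg (hwr.gFun_nonneg ht) _, hc, fun s hs t ht hst => ?_, ?_⟩
  · exact Real.rpow_le_rpow (hwr.gFun_nonneg ht) (hwr.antitoneOn_gFun hs ht hst) hQ0
  refine ⟨(hc.mono Ioo_subset_Ioc_self).aestronglyMeasurable measurableSet_Ioo, ?_⟩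
  rw [hasFiniteIntegral_iff_enorm]
  have h1 : ∫⁻ t in Ioo 0 h, ENNReal.ofReal (t ^ (d - 1) * gFun d w h t ^ q.toReal) < ⊤ := by
    have h2 := hw.2.2.2.2
    rw [radialNorm, if_neg hq] at h2
    exact (ENNReal.rpow_lt_top_iff_of_pos (by positivity)).1 h2
  have h2 := lintegral_Ioo_rpow_lt_top (r := -((d - 1 : ℝ) * (q.toReal - 1))) (by linarith) h
  refine lt_of_le_of_lt ?_ (ENNReal.add_lt_top.2 ⟨h1, h2⟩)
  rw [← lintegral_add_right _ (by fun_prop)]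
  refine setLIntegral_mono_ae' measurableSet_Ioo (Eventually.of_forall fun u hu => ?_)
  have hg := hwr.gFun_nonneg (Ioo_subset_Ioc_self hu)
  have hu0 : 0 < u := hu.1
  rw [Real.enorm_eq_ofReal (Real.rpow_nonneg hg _), ← ENNReal.ofReal_add (by positivity)
    (by positivity)]
  refine ENNReal.ofReal_le_ofReal ?_
  have hcast : ((d - 1 : ℕ) : ℝ) = d - 1 := by
    rw [Nat.cast_sub (Nat.one_le_iff_ne_zero.2 hd), Nat.cast_one]
  rcases le_total (u ^ (d - 1) * gFun d w h u) 1 with hle | hle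
  · have h3 : gFun d w h u ≤ u ^ (-(d - 1 : ℝ)) := by
      rw [Real.rpow_neg hu0.le, ← hcast, Real.rpow_natCast, ← one_div,
        le_div_iff₀ (pow_pos hu0 _), mul_comm]
      exact hle
    have h4 := Real.rpow_le_rpow hg h3 hQ0
    rw [← Real.rpow_mul hu0.le, neg_mul] at h4
    exact h4.trans (le_add_of_nonneg_left (by positivity))
  · have hgpos : 0 < gFun d w h u := by
      by_contra! hcon
      rw [le_antisymm hcon hg, mul_zero] at hle
      linarith
    refine le_trans ?_ (le_add_of_nonneg_right (by positivity))
    calc gFun d w h u ^ (q.toReal - 1)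
        ≤ (u ^ (d - 1) * gFun d w h u) * gFun d w h u ^ (q.toReal - 1) :=
          le_mul_of_one_le_left (by positivity) hle
      _ = u ^ (d - 1) * gFun d w h u ^ q.toReal := by
          rw [mul_assoc, ← Real.rpow_one_add' hgpos.le (by linarith), add_sub_cancel]

theorem eLpNorm_rpow (hw : MemW d q h w) (hd : 2 ≤ d) (hp : (d : ℝ≥0∞) < p)
    (hpq : p⁻¹ + q⁻¹ = 1) (hK : IsSymmBody K) (hC : IsConvexOpenCone C) (hh : 0 < h) :
    eLpNorm (fun y => gFun d w h (gauge K y) ^ (q.toReal - 1)) p (volume.restrict (h • K ∩ C)) =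
      eLpNorm (fun y => gFun d w h (gauge K y)) q (volume.restrict (h • K ∩ C)) ^
        (q.toReal - 1) := by
  have hd0 : d ≠ 0 := by omega
  obtain ⟨hp1, -, -, -, ⟨rfl, rfl⟩ | ⟨-, hQ, hpq'⟩⟩ := conjugate_exponent_facts hd hp hpq
  -- With q = 1 the convention 0^0 = 1 makes the function identically 1, and its L_∞ norm is 1
  -- because the sector is not null.
  · have hvol : volume.restrict (h • K ∩ C) ≠ 0 := by
      rw [Ne, Measure.restrict_eq_zero]
      exact ((hC.isOpen_sector hK hh).measure_pos _ (hC.nonempty_sector hK hh)).ne'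
    simp only [ENNReal.toReal_one, sub_self, Real.rpow_zero, ENNReal.rpow_zero]
    rw [eLpNorm_const _ (by simp) hvol]
    simp
  · have h1 := eLpNorm_norm_rpow (p := p) (μ := volume.restrict (h • K ∩ C))
      (fun y => gFun d w h (gauge K y)) hQ
    rw [hpq'] at h1
    rw [← h1]
    refine eLpNorm_congr_ae ?_
    filter_upwards [IsRadialWeight.gauge_mem_Ioo_ae hd0 hK hC hh] with y hy
    rw [Real.norm_of_nonneg (hw.isRadialWeight.gFun_nonneg (Ioo_subset_Ioc_self hy))]

theorem eLpNorm_gFun_lt_top (hw : MemW d q h w) (hd : d ≠ 0) (hq0 : q ≠ 0) (hq : q ≠ ⊤)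
    (hK : IsSymmBody K) (hC : IsConvexOpenCone C) (hh : 0 < h) :
    eLpNorm (fun y => gFun d w h (gauge K y)) q (volume.restrict (h • K ∩ C)) < ⊤ := by
  rw [hw.isRadialWeight.eLpNorm_gFun_comp_gauge hd hK hC hh hq0 hq]
  refine ENNReal.mul_lt_top (ENNReal.rpow_lt_top_of_nonneg (by positivity) ?_) hw.2.2.2.2
  exact ENNReal.mul_ne_top (by simp) (hC.volume_inter_lt_top hK).ne

theorem memLp_rpow (hw : MemW d q h w) (hd : 2 ≤ d) (hp : (d : ℝ≥0∞) < p)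
    (hpq : p⁻¹ + q⁻¹ = 1) (hK : IsSymmBody K) (hC : IsConvexOpenCone C) (hh : 0 < h) :
    MemLp (fun y => gFun d w h (gauge K y) ^ (q.toReal - 1)) p (volume.restrict (h • K ∩ C)) := by
  have hd0 : d ≠ 0 := by omega
  obtain ⟨-, hq1, hq, hq', -⟩ := conjugate_exponent_facts hd hp hpq
  refine ⟨(hw.isRadialProfile_rpow hd0 hq1 hq hq').aestronglyMeasurable_comp_gauge hd0 hK hC hh, ?_⟩
  rw [hw.eLpNorm_rpow hd hp hpq hK hC hh]
  have hQ1 : 1 ≤ q.toReal := by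
    rw [← ENNReal.toReal_one]; exact ENNReal.toReal_mono hq hq1
  exact ENNReal.rpow_lt_top_of_nonneg (by linarith)
    (hw.eLpNorm_gFun_lt_top hd0 (zero_lt_one.trans_le hq1).ne' hq hK hC hh).ne

theorem memW1p_extremalFun (hw : MemW d q h w) (hd : 2 ≤ d) (hp : (d : ℝ≥0∞) < p)
    (hpq : p⁻¹ + q⁻¹ = 1) (hK : IsSymmBody K) (hC : IsConvexOpenCone C) (hh : 0 < h) (a b : ℝ) :
    MemW1p p (h • K ∩ C) fun y => a * extremalFun q K h w y + b := by
  have hd0 : d ≠ 0 := by omega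
  obtain ⟨hp1, hq1, hq, hq', -⟩ := conjugate_exponent_facts hd hp hpq
  exact (hw.isRadialProfile_rpow hd0 hq1 hq hq').memW1p hd0 hK hC hh hp1
    (hw.memLp_rpow hd hp hpq hK hC hh) a b

theorem continuousOn_extremalFun (hw : MemW d q h w) (hd : 2 ≤ d) (hp : (d : ℝ≥0∞) < p)
    (hpq : p⁻¹ + q⁻¹ = 1) (hK : IsSymmBody K) (hC : IsConvexOpenCone C) (hh : 0 < h) :
    ContinuousOn (extremalFun q K h w) (closure (h • K ∩ C)) := by
  obtain ⟨-, hq1, hq, hq', -⟩ := conjugate_exponent_facts hd hp hpq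
  exact (hw.isRadialProfile_rpow (by omega) hq1 hq hq').continuousOn_comp_gauge hK hC hh

theorem polarLpNorm_extremalFun (hw : MemW d q h w) (hd : 2 ≤ d) (hp : (d : ℝ≥0∞) < p)
    (hpq : p⁻¹ + q⁻¹ = 1) (hK : IsSymmBody K) (hC : IsConvexOpenCone C) (hh : 0 < h) {a b : ℝ}
    {G : EuclideanSpace ℝ (Fin d) → EuclideanSpace ℝ (Fin d)}
    (hG : IsWeakGradient (h • K ∩ C) (fun y => a * extremalFun q K h w y + b) G) :
    polarLpNorm p K (h • K ∩ C) G = |a| * ostrowskiConst q K C h w ^ (q.toReal - 1) := by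
  have hd0 : d ≠ 0 := by omega
  obtain ⟨hp1, hq1, hq, hq', -⟩ := conjugate_exponent_facts hd hp hpq
  rw [(hw.isRadialProfile_rpow hd0 hq1 hq hq').polarLpNorm_eq hd0 hK hC hh hp1
    (hw.memLp_rpow hd hp hpq hK hC hh) hG, hw.eLpNorm_rpow hd hp hpq hK hC hh,
    hw.isRadialWeight.ostrowskiConst_eq hd0 hK hC hh (zero_lt_one.trans_le hq1).ne' hq,
    ENNReal.toReal_rpow]

theorem abs_integral_extremalFun (hw : MemW d q h w) (hd : 2 ≤ d) (hp : (d : ℝ≥0∞) < p)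
    (hpq : p⁻¹ + q⁻¹ = 1) (hK : IsSymmBody K) (hC : IsConvexOpenCone C) (hh : 0 < h) (a b : ℝ) :
    |∫ y in h • K ∩ C, w (gauge K y) *
        (a * extremalFun q K h w y + b - (a * extremalFun q K h w 0 + b))| =
      |a| * ostrowskiConst q K C h w ^ q.toReal := by
  have hd0 : d ≠ 0 := by omega
  obtain ⟨-, hq1, hq, hq', -⟩ := conjugate_exponent_facts hd hp hpq
  have hq0 : q ≠ 0 := (zero_lt_one.trans_le hq1).ne'
  have hQ : 0 < q.toReal := ENNReal.toReal_pos hq0 hq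
  have h0 : extremalFun q K h w 0 = 0 := by
    rw [extremalFun, gauge_zero, intervalIntegral.integral_same]
  have hQ1 : 1 ≤ q.toReal := by
    rw [← ENNReal.toReal_one]; exact ENNReal.toReal_mono hq hq1
  simp only [h0, mul_zero, zero_add, add_sub_cancel_right]
  have h1 := (hw.isRadialProfile_rpow hd0 hq1 hq hq').abs_integral_weight_mul
    hw.isRadialWeight hd0 hK hC hh a
  refine h1.trans ?_
  rw [hw.isRadialWeight.ostrowskiConst_eq hd0 hK hC hh hq0 hq, ENNReal.toReal_rpow,
    eLpNorm_eq_lintegral_rpow_enorm_toReal hq0 hq, one_div, ENNReal.rpow_inv_rpow hQ.ne']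
  congr 2
  refine lintegral_congr_ae ?_
  filter_upwards [IsRadialWeight.gauge_mem_Ioo_ae hd0 hK hC hh] with y hy
  have hg := hw.isRadialWeight.gFun_nonneg (Ioo_subset_Ioc_self hy)
  rw [Real.enorm_eq_ofReal hg, ENNReal.ofReal_rpow_of_nonneg hg hQ.le,
    ← Real.rpow_add_one' hg (by linarith), sub_add_cancel]

/-- With c the constant, the integral is |a|c^q and the gradient norm is |a|c^{q-1}. The identity c
· c^{q-1} = c^q also holds for c = 0, as q ≠ 0. -/
theorem ostrowski_equality (hw : MemW d q h w) (hd : 2 ≤ d) (hp : (d : ℝ≥0∞) < p)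
    (hpq : p⁻¹ + q⁻¹ = 1) (hK : IsSymmBody K) (hC : IsConvexOpenCone C) (hh : 0 < h) {a b : ℝ}
    {G : EuclideanSpace ℝ (Fin d) → EuclideanSpace ℝ (Fin d)}
    (hG : IsWeakGradient (h • K ∩ C) (fun y => a * extremalFun q K h w y + b) G) :
    |∫ y in h • K ∩ C, w (gauge K y) *
        (a * extremalFun q K h w y + b - (a * extremalFun q K h w 0 + b))| =
      ostrowskiConst q K C h w * polarLpNorm p K (h • K ∩ C) G := by
  obtain ⟨-, hq1, hq, -⟩ := conjugate_exponent_facts hd hp hpq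
  have hq0 : q ≠ 0 := (zero_lt_one.trans_le hq1).ne'
  have hQ : 0 < q.toReal := ENNReal.toReal_pos hq0 hq
  have hc : 0 ≤ ostrowskiConst q K C h w := by unfold ostrowskiConst; positivity
  rw [hw.abs_integral_extremalFun hd hp hpq hK hC hh,
    hw.polarLpNorm_extremalFun hd hp hpq hK hC hh hG, mul_left_comm,
    ← Real.rpow_one_add' hc (by linarith), add_sub_cancel]

/-- Insert f_e and divide by its gradient norm c^{q-1}, which is positive when c > 0. -/
theorem ostrowskiConst_le (hw : MemW d q h w) (hd : 2 ≤ d) (hp : (d : ℝ≥0∞) < p)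
    (hpq : p⁻¹ + q⁻¹ = 1) (hK : IsSymmBody K) (hC : IsConvexOpenCone C) (hh : 0 < h) {M : ℝ}
    (hM : OstrowskiIneq p K C h w M) : ostrowskiConst q K C h w ≤ M := by
  have hp1 : 1 ≤ p := (conjugate_exponent_facts hd hp hpq).1
  have hc : 0 ≤ ostrowskiConst q K C h w := by unfold ostrowskiConst; positivity
  rcases hc.eq_or_lt with h0 | hpos
  · exact h0.symm.trans_le (hM.nonneg (by omega) hK hC hh hp1)
  have hf := hw.memW1p_extremalFun hd hp hpq hK hC hh 1 0
  obtain ⟨-, G, hG, -⟩ := id hf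
  have h1 := (hM _ _ G hf ⟨((hw.continuousOn_extremalFun hd hp hpq hK hC hh).const_mul 1).add
    continuousOn_const, EventuallyEq.rfl⟩ hG).2
  refine le_of_mul_le_mul_right
    ((hw.ostrowski_equality hd hp hpq hK hC hh hG).symm.trans_le h1) ?_
  rw [hw.polarLpNorm_extremalFun hd hp hpq hK hC hh hG]
  positivity

end MemW

end

end Ostrowski

end

theorem mainTheorem2 {d : ℕ} (hd : 2 ≤ d) {p p' : ℝ≥0∞} (hp : (d : ℝ≥0∞) < p)
    (hpp' : p⁻¹ + p'⁻¹ = 1)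
    {C : Set (EuclideanSpace ℝ (Fin d))} (hC : IsOpenFGCone C)
    {K : Set (EuclideanSpace ℝ (Fin d))} (hK : IsSymmBody K)
    {h : ℝ} (hh : 0 < h) (w : ℝ → ℝ) :
    -- the value at the origin of a Sobolev function makes sense
    (∀ f, MemW1p p (h • K ∩ C) f → ∃ F, IsContRep (h • K ∩ C) f F) ∧
    -- polytopes
    (IsOpenPolytope K → MemW d p' h w →
      OstrowskiIneq p K C h w (ostrowskiConst p' K C h w) ∧
      (∀ M : ℝ, OstrowskiIneq p K C h w M → ostrowskiConst p' K C h w ≤ M) ∧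
      (∀ a b : ℝ, ∀ f : EuclideanSpace ℝ (Fin d) → ℝ,
        f = (fun y => a * extremalFun p' K h w y + b) →
          MemW1p p (h • K ∩ C) f ∧ ContinuousOn f (closure (h • K ∩ C)) ∧
          ∀ G, IsWeakGradient (h • K ∩ C) f G →
            |∫ y in h • K ∩ C, w (gauge K y) * (f y - f 0)| =
              ostrowskiConst p' K C h w * polarLpNorm p K (h • K ∩ C) G)) ∧
    -- arbitrary bodies
    (MemWStar d p' h w →
      OstrowskiIneq p K C h w (ostrowskiConst p' K C h w) ∧
      (∀ M : ℝ, OstrowskiIneq p K C h w M → ostrowskiConst p' K C h w ≤ M)) := by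
  have hd0 : d ≠ 0 := by omega
  have hC' := hC.isConvexOpenCone
  obtain ⟨-, hq1, hq, hq', -⟩ := conjugate_exponent_facts hd hp hpp'
  -- The common core of both parts; part (ii) reaches it through the inclusion of 𝓦*_{p'} in 𝓦_{p'}.
  have hsharp : MemW d p' h w → OstrowskiIneq p K C h w (ostrowskiConst p' K C h w) ∧
      (∀ M : ℝ, OstrowskiIneq p K C h w M → ostrowskiConst p' K C h w ≤ M) := fun hw =>
    ⟨hw.ostrowskiIneq hd0 hK hC' hh hp hpp' (zero_lt_one.trans_le hq1).ne' hq,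
      fun M hM => hw.ostrowskiConst_le hd hp hpp' hK hC' hh hM⟩
  refine ⟨fun f hf => hf.exists_isContRep hd0 hK hC' hh hp, fun _ hw =>
    ⟨(hsharp hw).1, (hsharp hw).2, ?_⟩, fun hw => hsharp (hw.memW hd0 hh hq1 hq hq')⟩
  rintro a b f rfl
  exact ⟨hw.memW1p_extremalFun hd hp hpp' hK hC' hh a b,
    ((hw.continuousOn_extremalFun hd hp hpp' hK hC' hh).const_mul a).add continuousOn_const,
    fun G hG => hw.ostrowski_equality hd hp hpp' hK hC' hh hG⟩
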